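/- Let $\Omega\subset\mathbb R^n$ be a bounded open set, $S\subset\mathbb R^n$ measurable, $f\in L^2(\Omega)$, $T>0$, and let $K:\mathbb R^n\to\mathbb R$ be a $C^1$ kernel; if $n\ge 2$, suppose also that $\nabla K$ is locally Lipschitz (for instance $K\in C^2$). Put $$(Av)(x)=\chi_S(x)\int_\Omega K(x-y)\,v(y)\,dy,\qquad (A^\top g)(y)=\int_\Omega \chi_S(x)\,K(x-y)\,g(x)\,dx .$$ Let $u_0:\Omega\to\mathbb R$ be continuous, and let $u$ be a continuous weak solution of $$u_t=\nabla_x\cdot\bigl[\,|u|\,\nabla_x(A^\top(Au-f))\bigr]\ \text{ in }\Omega\times(0,T],\qquad u(\cdot,0)=u_0,\qquad u|_{\partial\Omega}=0,$$ that is: $u$ is continuous on $\overline\Omega\times(0,T]$, $u=0$ on $\partial\Omega\times(0,T]$, $$\int_{\Omega\times(0,T]}\bigl[\eta_t\,u-|u|\,\nabla_x\eta\cdot\nabla_x(A^\top(Au-f))\bigr]\,dx\,dt=0$$ for every $C^1$ function $\eta$ with compact support in $\Omega\times(0,T)$, and $$\lim_{t\to0^+}\int_\Omega\eta(x,t)\,u(x,t)\,dx=\int_\Omega\eta(x,0)\,u_0(x)\,dx$$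 for every $C^1$ function $\eta$ with compact support in $\Omega\times\mathbb R$. Then $u(\cdot,t)\in L^1(\Omega)$ for every $t\in(0,T]$, and $\|u(\cdot,t)\|_1=\int_\Omega|u(x,t)|\,dx$ does not depend on $t\in(0,T]$. If moreover $u$ is bounded on $\Omega\times(0,T]$, then $u_0\in L^1(\Omega)$ and $\|u(\cdot,t)\|_1=\|u_0\|_1$ for every $t\in(0,T]$. -/

import Mathlib

open Set Filter Topology MeasureTheory

noncomputable section

namespace MotionPDE

/-- The sampled convolution operator
`(A v)(x) = χ_S(x) ∫_Ω K(x - y) v(y) dy`. -/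
def sampledConv {n : ℕ} (Ω S : Set (EuclideanSpace ℝ (Fin n)))
    (K : EuclideanSpace ℝ (Fin n) → ℝ) (v : EuclideanSpace ℝ (Fin n) → ℝ) :
    EuclideanSpace ℝ (Fin n) → ℝ :=
  S.indicator fun x => ∫ y in Ω, K (x - y) * v y

/-- The conjugate operator `Aᵀ` of `A` with respect to the `L²(Ω)` pairing:
`(Aᵀ g)(y) = ∫_Ω χ_S(x) K(x - y) g(x) dx`. -/
def sampledConvAdj {n : ℕ} (Ω S : Set (EuclideanSpace ℝ (Fin n)))
    (K : EuclideanSpace ℝ (Fin n) → ℝ) (g : EuclideanSpace ℝ (Fin n) → ℝ) :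
    EuclideanSpace ℝ (Fin n) → ℝ :=
  fun y => ∫ x in Ω, S.indicator (fun x => K (x - y) * g x) x

/-- `Aᵀ` is indeed conjugate to `A`: `∫_Ω (A v) g = ∫_Ω v (Aᵀ g)`. -/
theorem integral_sampledConv_mul {n : ℕ} {Ω S : Set (EuclideanSpace ℝ (Fin n))}
    {K v g : EuclideanSpace ℝ (Fin n) → ℝ}
    (hΩ : Bornology.IsBounded Ω) (hS : MeasurableSet S) (hK : Continuous K)
    (hv : IntegrableOn v Ω) (hg : IntegrableOn g Ω) :
    ∫ x in Ω, sampledConv Ω S K v x * g x = ∫ y in Ω, v y * sampledConvAdj Ω S K g y := by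
  set μ := (volume : Measure (EuclideanSpace ℝ (Fin n))).restrict Ω with hμ
  obtain ⟨R, hR⟩ := hΩ.exists_norm_le
  obtain ⟨C, hC⟩ := (isCompact_closedBall (0 : EuclideanSpace ℝ (Fin n))
    (R + R)).exists_bound_of_continuousOn hK.continuousOn
  have hvg : Integrable (fun z : EuclideanSpace ℝ (Fin n) × EuclideanSpace ℝ (Fin n) =>
      g z.1 * v z.2) (μ.prod μ) := hg.mul_prod hv
  have hkm : AEStronglyMeasurable
      (fun z : EuclideanSpace ℝ (Fin n) × EuclideanSpace ℝ (Fin n) =>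
        S.indicator (fun _ => (1 : ℝ)) z.1 * K (z.1 - z.2)) (μ.prod μ) := by
    refine Measurable.aestronglyMeasurable (Measurable.mul ?_ ?_)
    · exact (measurable_const.indicator hS).comp measurable_fst
    · exact (hK.comp (continuous_fst.sub continuous_snd)).measurable
  have hb : ∀ᵐ z ∂(μ.prod μ), ‖S.indicator (fun _ => (1 : ℝ)) z.1 * K (z.1 - z.2)‖ ≤ C := by
    rw [hμ, Measure.prod_restrict]
    have hsub : (Ω ×ˢ Ω) ⊆ {z : EuclideanSpace ℝ (Fin n) × EuclideanSpace ℝ (Fin n) |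
        ‖S.indicator (fun _ => (1 : ℝ)) z.1 * K (z.1 - z.2)‖ ≤ C} := by
      rintro ⟨x, y⟩ ⟨hx, hy⟩
      have h1 : ‖K (x - y)‖ ≤ C := hC _ (by
        rw [mem_closedBall_zero_iff]
        exact (norm_sub_le _ _).trans (add_le_add (hR x hx) (hR y hy)))
      have h2 : ‖S.indicator (fun _ => (1 : ℝ)) x‖ ≤ 1 := by
        by_cases h : x ∈ S <;> simp [h]
      show ‖S.indicator (fun _ => (1 : ℝ)) x * K (x - y)‖ ≤ C
      rw [norm_mul]
      nlinarith [norm_nonneg (K (x - y)), norm_nonneg (S.indicator (fun _ => (1 : ℝ)) x)]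
    have hms : MeasurableSet {z : EuclideanSpace ℝ (Fin n) × EuclideanSpace ℝ (Fin n) |
        ‖S.indicator (fun _ => (1 : ℝ)) z.1 * K (z.1 - z.2)‖ ≤ C} := by
      refine measurableSet_le (Measurable.norm (Measurable.mul ?_ ?_)) measurable_const
      · exact (measurable_const.indicator hS).comp measurable_fst
      · exact (hK.comp (continuous_fst.sub continuous_snd)).measurable
    exact (ae_restrict_iff hms).2 (Eventually.of_forall fun z hz => hsub hz)
  have hint := hvg.bdd_mul hkm hb
  have hswap := integral_integral_swap (μ := μ) (ν := μ)
    (f := fun x y => S.indicator (fun _ => (1 : ℝ)) x * K (x - y) * (g x * v y)) hint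
  calc ∫ x, sampledConv Ω S K v x * g x ∂μ
      = ∫ x, ∫ y, S.indicator (fun _ => (1 : ℝ)) x * K (x - y) * (g x * v y) ∂μ ∂μ := by
        refine integral_congr_ae (Eventually.of_forall fun x => ?_)
        by_cases h : x ∈ S
        · simp only [sampledConv, h, indicator_of_mem, one_mul, ← integral_mul_const]
          exact integral_congr_ae (Eventually.of_forall fun y => by ring)
        · simp [sampledConv, h]
    _ = ∫ y, ∫ x, S.indicator (fun _ => (1 : ℝ)) x * K (x - y) * (g x * v y) ∂μ ∂μ := hswap
    _ = ∫ y, v y * sampledConvAdj Ω S K g y ∂μ := by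
        refine integral_congr_ae (Eventually.of_forall fun y => ?_)
        simp only [sampledConvAdj, ← integral_const_mul]
        refine integral_congr_ae (Eventually.of_forall fun x => ?_)
        by_cases h : x ∈ S
        · simp only [h, indicator_of_mem, one_mul]; ring
        · simp [h]

/-- The residual potential `Aᵀ (A v - f)`. -/
def residualPotential {n : ℕ} (Ω S : Set (EuclideanSpace ℝ (Fin n)))
    (K f : EuclideanSpace ℝ (Fin n) → ℝ) (v : EuclideanSpace ℝ (Fin n) → ℝ) :
    EuclideanSpace ℝ (Fin n) → ℝ :=
  sampledConvAdj Ω S K fun x => sampledConv Ω S K v x - f x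

/-- `u` (written `u t x`) is a continuous weak solution on `Ω × (0, T]` of
`u_t = ∇ₓ · (|u| ∇ₓ (Aᵀ (A u - f)))`, `u(·, 0) = u₀`, `u = 0` on `∂Ω`.
Test functions are `C¹` functions on space-time, compactly supported in `Ω × (0, T)` for the
equation, and in `Ω × ℝ` (so that they need not vanish at time `0`) for the initial condition. -/
structure IsContinuousWeakSolution {n : ℕ} (Ω S : Set (EuclideanSpace ℝ (Fin n)))
    (K f : EuclideanSpace ℝ (Fin n) → ℝ) (T : ℝ) (u₀ : EuclideanSpace ℝ (Fin n) → ℝ)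
    (u : ℝ → EuclideanSpace ℝ (Fin n) → ℝ) : Prop where
  /-- `u` is continuous, up to the lateral boundary -/
  continuousOn : ContinuousOn (fun z : EuclideanSpace ℝ (Fin n) × ℝ => u z.2 z.1)
    (closure Ω ×ˢ Ioc 0 T)
  /-- the boundary condition -/
  boundary : ∀ t ∈ Ioc 0 T, ∀ x ∈ frontier Ω, u t x = 0
  /-- the equation, tested with `η` -/
  weak_eq : ∀ η : EuclideanSpace ℝ (Fin n) × ℝ → ℝ, ContDiff ℝ 1 η → HasCompactSupport η →
    tsupport η ⊆ Ω ×ˢ Ioo 0 T →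
    ∫ z in Ω ×ˢ Ioc 0 T,
      (deriv (fun t => η (z.1, t)) z.2 * u z.2 z.1
        - |u z.2 z.1| * inner ℝ (gradient (fun x => η (x, z.2)) z.1)
            (gradient (residualPotential Ω S K f (u z.2)) z.1)) = 0
  /-- the initial condition, tested with `η` -/
  initial : ∀ η : EuclideanSpace ℝ (Fin n) × ℝ → ℝ, ContDiff ℝ 1 η → HasCompactSupport η →
    tsupport η ⊆ Ω ×ˢ univ →
    Tendsto (fun t => ∫ x in Ω, η (x, t) * u t x) (𝓝[>] 0) (𝓝 (∫ x in Ω, η (x, 0) * u₀ x))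

end MotionPDE

end

/-!
The solution solves the transport equation `u_t = ∇ · (|u| V)` in `Ω`, where `V = ∇(Aᵀ(Au - f))`
inherits its regularity from the kernel `K`: it is jointly continuous in `Ω`, bounded there as long
as `u` is, and Lipschitz in space when `∇K` is locally Lipschitz. Since `u` vanishes on `∂Ω`, its
extension by zero is continuous on the whole space. Testing with products `φ(x) θ(t)`, where `φ` is
supported in `Ω`, turns the weak formulation into the statement that `t ↦ ∫ φ u` is differentiable
with derivative `-∫ |u| ∇φ · V` (`IsContinuousWeakSolution.hasDerivAt`). The boundary values and the
zero set of `u` give no mass flux, so the positive and the negative part should be conserved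
separately. Two different arguments make this precise.

*Lipschitz velocity* (`n ≠ 1`). The equation is renormalized: with a mollifier `ρ` one
differentiates `∫ φ b(ρ * u)`, where `b` is a `C¹` truncation of the positive part that vanishes on
`(-∞, ε]`. Where `b(ρ * u)` is active, `u` is positive and the ball of integration lies inside `Ω`,
so that `|u| = u` and the equation applies. The commutator of mollification and transport is
controlled by the Lipschitz constant of `V` times the oscillation of `u`
(`IsMollifier.abs_commutator_le`), so in the limit `u⁺` satisfies the linear equation `w_t = ∇ · (w
V)` against every `C¹` function (`IsTransportSolution.hasDerivAt_integral_posPart`). The test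
function `1` shows that `∫ u⁺` is constant; the same holds for `u⁻`, since `-u` solves the equation
with velocity `-V`.

*One dimension.* Here `V` is only continuous. The primitive `U(x, t) = ∫_{-∞}^x u` satisfies `U_t =
|U_x| V` classically (`hasDerivAt_primitive`). For fixed weights `σᵢ ∈ [-1, 1]` consider the maximum
over all subdivisions of the signed variation `∑ σᵢ (U(xᵢ₊₁) - U(xᵢ))`. At a maximizer, Fermat's
theorem says that at each position `p` either the total weight of the points there or `U_x(p)` is
zero, so the time derivative of the signed variation is zero (`signedVariation_eq_zero_of_isMaxOn`).
Hence the maximum is constant in time (`exists_signedVariation_le`), and so is `∫ |u|`, being the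
supremum of these maxima over all weights.

*Initial time.* If `u` is bounded, then `u(·, t)` converges to `u₀` weakly against integrable
functions, and lower semicontinuity of the `L¹` norm gives `‖u₀‖₁ ≤ ‖u(·, t)‖₁`
(`setIntegral_abs_le_of_tendsto`). The converse needs that no oscillations disappear as `t → 0`. In
one dimension the primitives converge uniformly, because `U_t` is bounded. Otherwise, for the linear
equation, `‖ρ₁ * u⁺ - ρ₂ * u⁺‖²` in `L²` varies in time at a rate which does not depend on the
mollifiers (`IsTransportSolution.abs_integral_sq_sub_le`). Therefore mollification approximates
`u^±` in `L¹` uniformly as `t → 0`, and the weak convergence of `u` makes the mollified functions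
converge strongly.
-/

namespace MotionPDE

/-! ### Mollifiers and the commutator with transport -/

section Mollifier

variable {E : Type*} [NormedAddCommGroup E] [InnerProductSpace ℝ E] [FiniteDimensional ℝ E]
  [MeasurableSpace E] [BorelSpace E]

/-- `ρ` is a `C¹` mollifier at scale `δ`; `C` bounds the scale-invariant quantity
`δ ∫ ‖∇ρ‖`. -/
structure IsMollifier (C δ : ℝ) (ρ : E → ℝ) : Prop where
  contDiff : ContDiff ℝ 1 ρ
  nonneg : ∀ x, 0 ≤ ρ x
  eq_zero : ∀ x, δ < ‖x‖ → ρ x = 0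
  integral_eq_one : ∫ x, ρ x = 1
  integral_norm_fderiv_le : ∫ x, ‖fderiv ℝ ρ x‖ ≤ C / δ

/-- The bound `C` does not depend on the scale: all mollifiers are rescalings of one function. -/
theorem exists_isMollifier (E : Type*) [NormedAddCommGroup E] [InnerProductSpace ℝ E]
    [FiniteDimensional ℝ E] [MeasurableSpace E] [BorelSpace E] :
    ∃ C : ℝ, 0 ≤ C ∧ ∀ δ : ℝ, 0 < δ → ∃ ρ : E → ℝ, IsMollifier C δ ρ := by
  let f : ContDiffBump (0 : E) := ⟨1 / 2, 1, by norm_num, by norm_num⟩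
  let r : E → ℝ := f.normed volume
  have hr : ContDiff ℝ 1 r := f.contDiff_normed (n := 1)
  refine ⟨∫ x, ‖fderiv ℝ r x‖, integral_nonneg fun x => norm_nonneg _, fun δ hδ => ?_⟩
  set d := Module.finrank ℝ E
  have hdpos : 0 < (δ⁻¹) ^ d := by positivity
  have habs : |((δ⁻¹) ^ d)⁻¹| = ((δ⁻¹) ^ d)⁻¹ := abs_of_pos (inv_pos.2 hdpos)
  refine ⟨fun x => (δ⁻¹) ^ d * r (δ⁻¹ • x), ?_, ?_, ?_, ?_, ?_⟩
  · exact contDiff_const.mul (hr.comp (contDiff_const_smul _))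
  · exact fun x => mul_nonneg hdpos.le (f.nonneg_normed _)
  · intro x hx
    have : r (δ⁻¹ • x) = 0 := by
      have h : δ⁻¹ • x ∉ Function.support r := by
        rw [f.support_normed_eq, mem_ball_zero_iff, norm_smul, norm_inv, Real.norm_of_nonneg hδ.le,
          not_lt]
        change 1 ≤ δ⁻¹ * ‖x‖
        rw [← div_eq_inv_mul, le_div_iff₀ hδ]; linarith
      exact Function.notMem_support.1 h
    simp [this]
  · rw [integral_const_mul, Measure.integral_comp_smul volume r, habs, smul_eq_mul,
      mul_inv_cancel_left₀ hdpos.ne']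
    exact f.integral_normed
  · have h1 : ∀ x, ‖fderiv ℝ (fun x => (δ⁻¹) ^ d * r (δ⁻¹ • x)) x‖
        = (δ⁻¹) ^ d * (δ⁻¹ * ‖fderiv ℝ r (δ⁻¹ • x)‖) := by
      intro x
      have h2 : HasFDerivAt (fun x => (δ⁻¹) ^ d * r (δ⁻¹ • x))
          ((δ⁻¹) ^ d • ((fderiv ℝ r (δ⁻¹ • x)).comp (δ⁻¹ • ContinuousLinearMap.id ℝ E))) x := by
        refine HasFDerivAt.const_mul ?_ _
        exact HasFDerivAt.comp x (hr.differentiable one_ne_zero _).hasFDerivAt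
          ((hasFDerivAt_id x).const_smul δ⁻¹)
      rw [h2.fderiv, norm_smul, ContinuousLinearMap.comp_smul, ContinuousLinearMap.comp_id,
        norm_smul, Real.norm_of_nonneg hdpos.le, norm_inv, Real.norm_of_nonneg hδ.le]
    simp_rw [h1]
    rw [integral_const_mul, integral_const_mul,
      Measure.integral_comp_smul volume (fun x => ‖fderiv ℝ r x‖), habs, smul_eq_mul]
    apply le_of_eq
    field_simp

/-- The mollification `ρ * w`. -/
noncomputable def mollify {F : Type*} [NormedAddCommGroup F] [NormedSpace ℝ F] (ρ : E → ℝ)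
    (w : E → F) (x : E) : F :=
  ∫ y, ρ (x - y) • w y

/-- The divergence of the mollified field `ρ * Z`, the derivative being put on `ρ`. -/
noncomputable def mollDiv (ρ : E → ℝ) (Z : E → E) (x : E) : ℝ := ∫ y, fderiv ℝ ρ (x - y) (Z y)

variable {C δ : ℝ} {ρ : E → ℝ}

theorem IsMollifier.hasCompactSupport (h : IsMollifier C δ ρ) : HasCompactSupport ρ :=
  HasCompactSupport.of_support_subset_isCompact (isCompact_closedBall (0 : E) δ) fun x hx => by
    rw [mem_closedBall_zero_iff]
    by_contra hc
    exact hx (h.eq_zero x (not_le.1 hc))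

theorem IsMollifier.fderiv_eq_zero (h : IsMollifier C δ ρ) {x : E} (hx : δ < ‖x‖) :
    fderiv ℝ ρ x = 0 := by
  have : ρ =ᶠ[𝓝 x] fun _ => 0 := by
    filter_upwards [(isOpen_lt continuous_const continuous_norm).mem_nhds hx] with y hy
    exact h.eq_zero y hy
  rw [this.fderiv_eq]; simp

theorem IsMollifier.continuous_fderiv (h : IsMollifier C δ ρ) : Continuous (fderiv ℝ ρ) :=
  h.contDiff.continuous_fderiv one_ne_zero

theorem IsMollifier.hasCompactSupport_sub (h : IsMollifier C δ ρ) (x : E) :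
    HasCompactSupport fun y => ρ (x - y) :=
  h.hasCompactSupport.comp_homeomorph (Homeomorph.subLeft x)

theorem IsMollifier.hasCompactSupport_fderiv_sub (h : IsMollifier C δ ρ) (x : E) :
    HasCompactSupport fun y => fderiv ℝ ρ (x - y) :=
  (h.hasCompactSupport.fderiv ℝ).comp_homeomorph (Homeomorph.subLeft x)

theorem IsMollifier.integrable_smul {F : Type*} [NormedAddCommGroup F] [NormedSpace ℝ F]
    (h : IsMollifier C δ ρ) {w : E → F} (hw : Continuous w) (x : E) :
    Integrable fun y => ρ (x - y) • w y := by
  refine Continuous.integrable_of_hasCompactSupport ?_ ?_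
  · exact (h.contDiff.continuous.comp (continuous_const.sub continuous_id)).smul hw
  · exact (h.hasCompactSupport_sub x).smul_right

theorem IsMollifier.integrable_fderiv (h : IsMollifier C δ ρ) {Z : E → E} (hZ : Continuous Z)
    (x : E) : Integrable fun y => fderiv ℝ ρ (x - y) (Z y) := by
  refine Continuous.integrable_of_hasCompactSupport ?_ ?_
  · exact (h.continuous_fderiv.comp (continuous_const.sub continuous_id)).clm_apply hZ
  · refine (h.hasCompactSupport_fderiv_sub x).mono fun y hy hc => hy ?_
    simp only at hc
    simp [hc]

theorem IsMollifier.integral_sub_eq_one (h : IsMollifier C δ ρ) (x : E) :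
    ∫ y, ρ (x - y) = 1 := by
  rw [integral_sub_left_eq_self ρ volume x, h.integral_eq_one]

theorem IsMollifier.abs_mollDiv_le (h : IsMollifier C δ ρ) {Z : E → E} {x : E} {m : ℝ}
    (hm : ∀ y, ‖x - y‖ ≤ δ → ‖Z y‖ ≤ m) : |mollDiv ρ Z x| ≤ m * (C / δ) := by
  have hint : Integrable fun y => m * ‖fderiv ℝ ρ (x - y)‖ := by
    refine Integrable.const_mul (Integrable.norm ?_) _
    exact Continuous.integrable_of_hasCompactSupport
      (h.continuous_fderiv.comp (continuous_const.sub continuous_id))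
      (h.hasCompactSupport_fderiv_sub x)
  have h1 : |mollDiv ρ Z x| ≤ ∫ y, m * ‖fderiv ℝ ρ (x - y)‖ := by
    refine (Real.norm_eq_abs _).symm.le.trans
      (norm_integral_le_of_norm_le hint (Eventually.of_forall fun y => ?_))
    by_cases hy : ‖x - y‖ ≤ δ
    · calc _ ≤ ‖fderiv ℝ ρ (x - y)‖ * ‖Z y‖ := ContinuousLinearMap.le_opNorm _ _
        _ ≤ m * ‖fderiv ℝ ρ (x - y)‖ := by
          rw [mul_comm]; exact mul_le_mul_of_nonneg_right (hm y hy) (norm_nonneg _)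
    · rw [h.fderiv_eq_zero (not_le.1 hy)]; simp
  rcases lt_or_ge δ 0 with hδ | hδ
  · have : ∀ y, fderiv ℝ ρ y = 0 := fun y => h.fderiv_eq_zero (hδ.trans_le (norm_nonneg _))
    have h0 : ρ = 0 := funext fun y => h.eq_zero y (hδ.trans_le (norm_nonneg _))
    have := h.integral_eq_one
    simp [h0] at this
  have hm0 : 0 ≤ m := (norm_nonneg _).trans (hm x (by simpa using hδ))
  refine h1.trans ?_
  rw [integral_const_mul, integral_sub_left_eq_self (fun y => ‖fderiv ℝ ρ y‖) volume x]
  exact mul_le_mul_of_nonneg_left h.integral_norm_fderiv_le hm0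

theorem IsMollifier.norm_mollify_sub_le_of_integrable {F : Type*} [NormedAddCommGroup F]
    [NormedSpace ℝ F] [CompleteSpace F] (h : IsMollifier C δ ρ) {w : E → F} {x : E}
    (hw : Integrable fun y => ρ (x - y) • w y) {m : ℝ}
    (hm : ∀ y, ‖x - y‖ ≤ δ → ‖w y - w x‖ ≤ m) : ‖mollify ρ w x - w x‖ ≤ m := by
  have h1 : mollify ρ w x - w x = ∫ y, ρ (x - y) • (w y - w x) := by
    have : w x = ∫ y, ρ (x - y) • w x := by
      rw [integral_smul_const, h.integral_sub_eq_one, one_smul]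
    conv_lhs => rw [this]
    rw [mollify, ← integral_sub hw (h.integrable_smul continuous_const x)]
    simp_rw [smul_sub]
  have hint : Integrable fun y => ρ (x - y) * m := h.integrable_smul continuous_const x
  rw [h1]
  refine (norm_integral_le_of_norm_le hint (Eventually.of_forall fun y => ?_)).trans ?_
  · by_cases hy : ‖x - y‖ ≤ δ
    · rw [norm_smul, Real.norm_of_nonneg (h.nonneg _)]
      exact mul_le_mul_of_nonneg_left (hm y hy) (h.nonneg _)
    · rw [h.eq_zero _ (not_le.1 hy)]; simp
  · rw [integral_mul_const, h.integral_sub_eq_one, one_mul]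

theorem IsMollifier.norm_mollify_sub_le {F : Type*} [NormedAddCommGroup F] [NormedSpace ℝ F]
    [CompleteSpace F]
    (h : IsMollifier C δ ρ) {w : E → F} (hw : Continuous w) {x : E} {m : ℝ}
    (hm : ∀ y, ‖x - y‖ ≤ δ → ‖w y - w x‖ ≤ m) : ‖mollify ρ w x - w x‖ ≤ m :=
  h.norm_mollify_sub_le_of_integrable (h.integrable_smul hw x) hm

theorem IsMollifier.norm_mollify_le {F : Type*} [NormedAddCommGroup F] [NormedSpace ℝ F]
    (h : IsMollifier C δ ρ) {w : E → F} {M : ℝ} (hM : ∀ x, ‖w x‖ ≤ M) (x : E) :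
    ‖mollify ρ w x‖ ≤ M := by
  have hint : Integrable fun y => ρ (x - y) * M := h.integrable_smul continuous_const x
  refine (norm_integral_le_of_norm_le hint (Eventually.of_forall fun y => ?_)).trans ?_
  · rw [norm_smul, Real.norm_of_nonneg (h.nonneg _)]
    exact mul_le_mul_of_nonneg_left (hM y) (h.nonneg _)
  · rw [integral_mul_const, h.integral_sub_eq_one, one_mul]

theorem IsMollifier.contDiff_mollify (h : IsMollifier C δ ρ) {w : E → ℝ} (hw : Continuous w) :
    ContDiff ℝ 1 (mollify ρ w) := by
  have : mollify ρ w = convolution w ρ (ContinuousLinearMap.mul ℝ ℝ) volume := by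
    ext x; simp [mollify, convolution, mul_comm]
  rw [this]
  exact h.hasCompactSupport.contDiff_convolution_right (n := 1) _ hw.locallyIntegrable h.contDiff

theorem IsMollifier.fderiv_mollify (h : IsMollifier C δ ρ) {w : E → ℝ} (hw : Continuous w)
    (x v : E) : fderiv ℝ (mollify ρ w) x v = mollDiv ρ (fun y => w y • v) x := by
  have : mollify ρ w = convolution w ρ (ContinuousLinearMap.mul ℝ ℝ) volume := by
    ext x; simp [mollify, convolution, mul_comm]
  rw [this, (h.hasCompactSupport.hasFDerivAt_convolution_right (ContinuousLinearMap.mul ℝ ℝ)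
    hw.locallyIntegrable h.contDiff x).fderiv, convolution, mollDiv]
  rw [ContinuousLinearMap.integral_apply]
  · refine integral_congr_ae (Eventually.of_forall fun y => ?_)
    simp
  · exact (h.hasCompactSupport.fderiv ℝ).convolutionExists_right _ hw.locallyIntegrable
      h.continuous_fderiv x

theorem IsMollifier.continuous_mollDiv (h : IsMollifier C δ ρ) {Z : E → E} (hZ : Continuous Z) :
    Continuous (mollDiv ρ Z) := by
  have : mollDiv ρ Z = convolution Z (fderiv ℝ ρ) (ContinuousLinearMap.apply ℝ ℝ) volume := by
    ext x; simp [mollDiv, convolution]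
  rw [this]
  exact (h.hasCompactSupport.fderiv ℝ).continuous_convolution_right _ hZ.locallyIntegrable
    h.continuous_fderiv

theorem IsMollifier.continuous_mollify {F : Type*} [NormedAddCommGroup F] [NormedSpace ℝ F]
    (h : IsMollifier C δ ρ) {Z : E → F} (hZ : Continuous Z) :
    Continuous (mollify ρ Z) := by
  have : mollify ρ Z = convolution Z ρ (ContinuousLinearMap.lsmul ℝ ℝ).flip volume := by
    ext x; simp [mollify, convolution]
  rw [this]
  exact h.hasCompactSupport.continuous_convolution_right _ hZ.locallyIntegrable
    h.contDiff.continuous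

theorem IsMollifier.mollDiv_const (h : IsMollifier C δ ρ) (v x : E) :
    mollDiv ρ (fun _ => v) x = 0 := by
  rw [mollDiv, integral_sub_left_eq_self (fun y => fderiv ℝ ρ y v) volume x]
  have hint : Integrable fun y => fderiv ℝ ρ y v := by
    refine Continuous.integrable_of_hasCompactSupport
      (h.continuous_fderiv.clm_apply continuous_const) ?_
    refine (h.hasCompactSupport.fderiv ℝ).mono fun y hy hc => hy ?_
    simp [hc]
  have := integral_mul_fderiv_eq_neg_fderiv_mul_of_integrable (μ := (volume : Measure E))
    (f := fun _ => (1 : ℝ)) (g := ρ) (v := v) (by simp) (by simpa using hint)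
    (by simpa using h.contDiff.continuous.integrable_of_hasCompactSupport h.hasCompactSupport)
    (fun _ _ => differentiableAt_const _) (fun x _ => h.contDiff.differentiable one_ne_zero x)
  simpa using this

/-- The commutator of mollification and transport. Its smallness comes from the
Lipschitz bound on `V`, which compensates for the factor `1 / δ` in `∫ ‖∇ρ‖`. -/
theorem IsMollifier.abs_commutator_le (h : IsMollifier C δ ρ) (hδ : 0 < δ) {w : E → ℝ}
    (hw : Continuous w) {V : E → E} {L : NNReal} (hV : LipschitzWith L V) {x : E} {m : ℝ}
    (hm : ∀ y, ‖x - y‖ ≤ δ → |w y - w x| ≤ m) :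
    |mollDiv ρ (fun y => w y • V y) x - fderiv ℝ (mollify ρ w) x (V x) - w x * mollDiv ρ V x|
      ≤ m * L * C := by
  have h0 : w x * mollDiv ρ V x = mollDiv ρ (fun y => w x • V y) x := by
    simp only [mollDiv, map_smul, smul_eq_mul, integral_const_mul]
  have h1 : mollDiv ρ (fun y => w y • V y) x - fderiv ℝ (mollify ρ w) x (V x)
      - w x * mollDiv ρ V x = mollDiv ρ (fun y => (w y - w x) • (V y - V x)) x := by
    have e : mollDiv ρ (fun y => (w y - w x) • (V y - V x)) x
        = mollDiv ρ (fun y => w y • V y) x - mollDiv ρ (fun y => w y • V x) x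
          - mollDiv ρ (fun y => w x • V y) x + mollDiv ρ (fun _ => w x • V x) x := by
      have i1 := h.integrable_fderiv (Z := fun y => w y • V y) (hw.smul hV.continuous) x
      have i2 := h.integrable_fderiv (Z := fun y => w y • V x) (hw.smul continuous_const) x
      have i3 := h.integrable_fderiv (Z := fun y => w x • V y)
        (continuous_const.smul hV.continuous) x
      have i4 := h.integrable_fderiv (continuous_const (y := w x • V x)) x
      simp only [mollDiv]
      have i12 : Integrable fun y => fderiv ℝ ρ (x - y) (w y • V y)
          - fderiv ℝ ρ (x - y) (w y • V x) := i1.sub i2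
      have i123 : Integrable fun y => fderiv ℝ ρ (x - y) (w y • V y)
          - fderiv ℝ ρ (x - y) (w y • V x) - fderiv ℝ ρ (x - y) (w x • V y) := i12.sub i3
      rw [← integral_sub i1 i2, ← integral_sub i12 i3, ← integral_add i123 i4]
      refine integral_congr_ae (Eventually.of_forall fun y => ?_)
      simp only [map_smul, map_sub, smul_eq_mul]
      ring
    rw [e, h.mollDiv_const, h.fderiv_mollify hw, h0]; ring
  rw [h1]
  have hm0 : 0 ≤ m := (abs_nonneg _).trans (hm x (by simpa using hδ.le))
  refine (h.abs_mollDiv_le (m := m * (L * δ)) fun y hy => ?_).trans (le_of_eq ?_)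
  · rw [norm_smul]
    refine mul_le_mul (hm y hy) ?_ (norm_nonneg _) hm0
    refine (hV.norm_sub_le y x).trans ?_
    rw [norm_sub_rev]
    exact mul_le_mul_of_nonneg_left hy L.2
  · field_simp

theorem IsMollifier.abs_mollDiv_le_of_lipschitz (h : IsMollifier C δ ρ) (hδ : 0 < δ)
    {V : E → E} {L : NNReal} (hV : LipschitzWith L V) (x : E) : |mollDiv ρ V x| ≤ L * C := by
  have h1 : mollDiv ρ V x = mollDiv ρ (fun y => V y - V x) x := by
    have : mollDiv ρ (fun y => V y - V x) x = mollDiv ρ V x - mollDiv ρ (fun _ => V x) x := by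
      simp only [mollDiv, map_sub]
      exact integral_sub (h.integrable_fderiv hV.continuous x)
        (h.integrable_fderiv continuous_const x)
    rw [this, h.mollDiv_const, sub_zero]
  rw [h1]
  refine (h.abs_mollDiv_le (m := L * δ) fun y hy => ?_).trans (le_of_eq ?_)
  · refine (hV.norm_sub_le y x).trans ?_
    rw [norm_sub_rev]
    exact mul_le_mul_of_nonneg_left hy L.2
  · field_simp

theorem integral_mul_fderiv_of_hasCompactSupport {ψ r : E → ℝ} (hψ : ContDiff ℝ 1 ψ)
    (hψc : HasCompactSupport ψ) (hr : ContDiff ℝ 1 r) (v : E) :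
    ∫ x, ψ x * fderiv ℝ r x v = -∫ x, fderiv ℝ ψ x v * r x := by
  have h1 := hψ.continuous_fderiv one_ne_zero
  have h2 := hr.continuous_fderiv one_ne_zero
  refine integral_mul_fderiv_eq_neg_fderiv_mul_of_integrable ?_ ?_ ?_
    (fun x _ => hψ.differentiable one_ne_zero x) (fun x _ => hr.differentiable one_ne_zero x)
  · refine ((h1.clm_apply continuous_const).mul hr.continuous).integrable_of_hasCompactSupport ?_
    refine (hψc.fderiv ℝ).mono fun y hy hc => hy ?_
    simp [hc]
  · exact (hψ.continuous.mul (h2.clm_apply continuous_const)).integrable_of_hasCompactSupport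
      hψc.mul_right
  · exact (hψ.continuous.mul hr.continuous).integrable_of_hasCompactSupport hψc.mul_right

theorem IsMollifier.integral_mul_mollDiv (h : IsMollifier C δ ρ) {ψ : E → ℝ}
    (hψ : ContDiff ℝ 1 ψ) (hψc : HasCompactSupport ψ) {Z : E → E} (hZ : Continuous Z) :
    ∫ x, ψ x * mollDiv ρ Z x = -∫ x, fderiv ℝ ψ x (mollify ρ Z x) := by
  have hψ1 := hψ.continuous_fderiv one_ne_zero
  -- both integrands on `E × E` are supported in a compact set
  have hsupp : ∀ {k : E × E → ℝ}, (∀ z : E × E, k z ≠ 0 → z.1 ∈ tsupport ψ ∧ ‖z.1 - z.2‖ ≤ δ) →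
      HasCompactSupport k := by
    intro k hk
    refine HasCompactSupport.of_support_subset_isCompact
      (hψc.isCompact.prod (hψc.isCompact.cthickening (r := δ))) fun z hz => ?_
    obtain ⟨h1, h2⟩ := hk z hz
    refine ⟨h1, Metric.mem_cthickening_of_dist_le _ z.1 _ _ h1 ?_⟩
    rw [dist_comm, dist_eq_norm]; exact h2
  have i1 : Integrable (fun z : E × E => ψ z.1 * fderiv ℝ ρ (z.1 - z.2) (Z z.2))
      (volume.prod volume) := by
    refine Continuous.integrable_of_hasCompactSupport ?_ (hsupp fun z hz => ⟨?_, ?_⟩)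
    · exact (hψ.continuous.comp continuous_fst).mul
        ((h.continuous_fderiv.comp (continuous_fst.sub continuous_snd)).clm_apply
          (hZ.comp continuous_snd))
    · exact subset_tsupport _ fun hc => hz (by simp [hc])
    · by_contra hc
      exact hz (by simp [h.fderiv_eq_zero (not_le.1 hc)])
  have i2 : Integrable (fun z : E × E => fderiv ℝ ψ z.1 (Z z.2) * ρ (z.1 - z.2))
      (volume.prod volume) := by
    refine Continuous.integrable_of_hasCompactSupport ?_ (hsupp fun z hz => ⟨?_, ?_⟩)
    · exact ((hψ1.comp continuous_fst).clm_apply (hZ.comp continuous_snd)).mul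
        (h.contDiff.continuous.comp (continuous_fst.sub continuous_snd))
    · refine tsupport_fderiv_subset ℝ (subset_tsupport _ fun hc => hz (by simp [hc]))
    · by_contra hc
      exact hz (by simp [h.eq_zero _ (not_le.1 hc)])
  calc ∫ x, ψ x * mollDiv ρ Z x
      = ∫ x, ∫ y, ψ x * fderiv ℝ ρ (x - y) (Z y) := by
        simp only [mollDiv, integral_const_mul]
    _ = ∫ y, ∫ x, ψ x * fderiv ℝ ρ (x - y) (Z y) := integral_integral_swap i1
    _ = ∫ y, -∫ x, fderiv ℝ ψ x (Z y) * ρ (x - y) := by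
        refine integral_congr_ae (Eventually.of_forall fun y => ?_)
        have := integral_mul_fderiv_of_hasCompactSupport hψ hψc
          (r := fun x => ρ (x - y)) (h.contDiff.comp (contDiff_id.sub contDiff_const)) (Z y)
        simpa only [sub_eq_add_neg, fderiv_comp_add_right] using this
    _ = -∫ y, ∫ x, fderiv ℝ ψ x (Z y) * ρ (x - y) := integral_neg _
    _ = -∫ x, ∫ y, fderiv ℝ ψ x (Z y) * ρ (x - y) := by rw [← integral_integral_swap i2]
    _ = -∫ x, fderiv ℝ ψ x (mollify ρ Z x) := by
        congr 1
        refine integral_congr_ae (Eventually.of_forall fun x => ?_)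
        simp only [mollify]
        rw [← ContinuousLinearMap.integral_comp_comm _ (h.integrable_smul hZ x)]
        refine integral_congr_ae (Eventually.of_forall fun y => ?_)
        simp [mul_comm]

theorem IsMollifier.abs_fderiv_mollify_le (h : IsMollifier C δ ρ) {w : E → ℝ}
    (hw : Continuous w) {x : E} {m : ℝ} (hm : ∀ y, ‖x - y‖ ≤ δ → |w y - w x| ≤ m) (v : E) :
    |fderiv ℝ (mollify ρ w) x v| ≤ m * ‖v‖ * (C / δ) := by
  have h1 : fderiv ℝ (mollify ρ w) x v = mollDiv ρ (fun y => (w y - w x) • v) x := by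
    have : mollDiv ρ (fun y => (w y - w x) • v) x
        = mollDiv ρ (fun y => w y • v) x - mollDiv ρ (fun _ => w x • v) x := by
      simp only [mollDiv, sub_smul, map_sub]
      exact integral_sub (h.integrable_fderiv (Z := fun y => w y • v) (hw.smul continuous_const) x)
        (h.integrable_fderiv continuous_const x)
    rw [this, h.mollDiv_const, sub_zero, h.fderiv_mollify hw]
  rw [h1]
  refine h.abs_mollDiv_le fun y hy => ?_
  rw [norm_smul]
  exact mul_le_mul_of_nonneg_right (hm y hy) (norm_nonneg _)

theorem IsMollifier.norm_mollify_sub_le_of_lipschitz (h : IsMollifier C δ ρ) {V : E → E}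
    {L : NNReal} (hV : LipschitzWith L V) (x : E) : ‖mollify ρ V x - V x‖ ≤ L * δ := by
  refine h.norm_mollify_sub_le hV.continuous fun y hy => ?_
  refine (hV.norm_sub_le y x).trans ?_
  rw [norm_sub_rev]
  exact mul_le_mul_of_nonneg_left hy L.2

end Mollifier


/-! ### A smooth truncation of the positive part -/

section Truncation

/-- A `C¹` truncation of the positive part: it vanishes on `(-∞, ε]`, has slope in `[0, 1]` and
stays within `2ε` of the positive part. It equals `(r - ε)² / r` for `r ≥ ε`. -/
noncomputable def softPos (ε r : ℝ) : ℝ := (max r ε - ε) ^ 2 / max r ε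

/-- The derivative of `softPos ε`. -/
noncomputable def softPosDeriv (ε r : ℝ) : ℝ := 1 - (ε / max r ε) ^ 2

variable {ε r : ℝ}

theorem softPos_of_le (h : r ≤ ε) : softPos ε r = 0 := by simp [softPos, max_eq_right h]

theorem softPosDeriv_of_le (hε : 0 < ε) (h : r ≤ ε) : softPosDeriv ε r = 0 := by
  simp [softPosDeriv, max_eq_right h, hε.ne']

theorem continuous_softPos (hε : 0 < ε) : Continuous (softPos ε) := by
  unfold softPos
  refine Continuous.div (by fun_prop) (by fun_prop) fun x => ?_
  exact (hε.trans_le (le_max_right _ _)).ne'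

theorem continuous_softPosDeriv (hε : 0 < ε) : Continuous (softPosDeriv ε) := by
  unfold softPosDeriv
  refine continuous_const.sub (Continuous.pow (Continuous.div (by fun_prop) (by fun_prop)
    fun x => ?_) 2)
  exact (hε.trans_le (le_max_right _ _)).ne'

theorem hasDerivAt_softPos (hε : 0 < ε) (r : ℝ) :
    HasDerivAt (softPos ε) (softPosDeriv ε r) r := by
  have hne : ∀ y ≠ ε, HasDerivAt (softPos ε) (softPosDeriv ε y) y := by
    intro y hy
    rcases lt_or_gt_of_ne hy with h | h
    · rw [softPosDeriv_of_le hε h.le]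
      refine (hasDerivAt_const y (0 : ℝ)).congr_of_eventuallyEq ?_
      filter_upwards [Iio_mem_nhds h] with z hz using softPos_of_le (le_of_lt hz)
    · have hy0 : y ≠ 0 := (hε.trans h).ne'
      have h1 : HasDerivAt (fun z : ℝ => (z - ε) ^ 2 / z) (softPosDeriv ε y) y := by
        have := (((hasDerivAt_id y).sub_const ε).pow 2).div (hasDerivAt_id y) hy0
        convert! this using 1
        simp only [softPosDeriv, max_eq_left h.le, id]
        field_simp
        simp
        ring
      refine h1.congr_of_eventuallyEq ?_
      filter_upwards [Ioi_mem_nhds h] with z hz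
      simp [softPos, max_eq_left (le_of_lt (mem_Ioi.1 hz))]
  by_cases h : r = ε
  · subst h
    exact hasDerivAt_of_hasDerivAt_of_ne hne (continuous_softPos hε).continuousAt
      (continuous_softPosDeriv hε).continuousAt
  · exact hne r h

theorem contDiff_softPos (hε : 0 < ε) : ContDiff ℝ 1 (softPos ε) := by
  rw [contDiff_one_iff_deriv]
  refine ⟨fun x => (hasDerivAt_softPos hε x).differentiableAt, ?_⟩
  have : deriv (softPos ε) = softPosDeriv ε := funext fun x => (hasDerivAt_softPos hε x).deriv
  rw [this]
  exact continuous_softPosDeriv hε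

theorem softPosDeriv_nonneg (hε : 0 < ε) : 0 ≤ softPosDeriv ε r := by
  have h : ε / max r ε ≤ 1 := (div_le_one (hε.trans_le (le_max_right _ _))).2 (le_max_right _ _)
  have h0 : 0 ≤ ε / max r ε := div_nonneg hε.le (hε.le.trans (le_max_right _ _))
  unfold softPosDeriv
  nlinarith

theorem softPosDeriv_le_one : softPosDeriv ε r ≤ 1 := by
  unfold softPosDeriv
  nlinarith [sq_nonneg (ε / max r ε)]

theorem softPos_nonneg (hε : 0 < ε) : 0 ≤ softPos ε r :=
  div_nonneg (sq_nonneg _) (hε.le.trans (le_max_right _ _))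

theorem softPos_le_max (hε : 0 < ε) : softPos ε r ≤ max r 0 := by
  rcases le_total r ε with h | h
  · rw [softPos_of_le h]; exact le_max_right _ _
  · have hr : 0 < r := hε.trans_le h
    rw [softPos, max_eq_left h, max_eq_left hr.le, div_le_iff₀ hr]
    nlinarith

theorem max_sub_softPos_le (hε : 0 < ε) : max r 0 - softPos ε r ≤ 2 * ε := by
  rcases le_total r ε with h | h
  · rw [softPos_of_le h]
    rcases max_cases r 0 with h' | h' <;> linarith
  · have hr : 0 < r := hε.trans_le h
    rw [softPos, max_eq_left h, max_eq_left hr.le, sub_le_iff_le_add, ← sub_le_iff_le_add',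
      le_div_iff₀ hr]
    nlinarith [sq_nonneg ε]

/-- The truncation is almost homogeneous of degree one. -/
theorem abs_softPosDeriv_mul_sub_softPos_le (hε : 0 < ε) :
    |softPosDeriv ε r * r - softPos ε r| ≤ 2 * ε := by
  rcases le_total r ε with h | h
  · rw [softPos_of_le h, softPosDeriv_of_le hε h]; simp [hε.le]
  · have hr : 0 < r := hε.trans_le h
    have : softPosDeriv ε r * r - softPos ε r = 2 * ε - 2 * ε * (ε / r) := by
      rw [softPos, softPosDeriv, max_eq_left h]; field_simp; ring
    rw [this]
    have h1 : ε / r ≤ 1 := (div_le_one hr).2 h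
    have h0 : 0 ≤ ε / r := by positivity
    rw [abs_le]; constructor <;> nlinarith

end Truncation

/-! ### The renormalization estimate -/

section Renormalization

variable {E : Type*} [NormedAddCommGroup E] [InnerProductSpace ℝ E] [FiniteDimensional ℝ E]
  [MeasurableSpace E] [BorelSpace E] {C δ ε : ℝ} {ρ : E → ℝ}

theorem hasCompactSupport_of_bounded {E F : Type*} [NormedAddCommGroup E] [ProperSpace E]
    [Zero F] {Ω : Set E}
    (hΩ : Bornology.IsBounded Ω) {k : E → F} (hk : ∀ x ∉ Ω, k x = 0) : HasCompactSupport k := by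
  refine HasCompactSupport.of_support_subset_isCompact hΩ.isCompact_closure fun x hx => ?_
  by_contra hc
  exact hx (hk x fun h => hc (subset_closure h))

theorem abs_integral_le_of_bounded {Ω : Set E} (hΩ : Bornology.IsBounded Ω) {k : E → ℝ} {c : ℝ}
    (hk : ∀ x ∉ Ω, k x = 0) (hc : ∀ x ∈ Ω, |k x| ≤ c) :
    |∫ x, k x| ≤ c * volume.real Ω := by
  rw [← setIntegral_eq_integral_of_forall_compl_eq_zero hk, ← Real.norm_eq_abs]
  exact norm_setIntegral_le_of_norm_le_const hΩ.measure_lt_top hc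

/-- The renormalization estimate at a fixed time. Only the part of `w` where it exceeds `ε / 2`
contributes, and there `|w| = w`. -/
theorem IsMollifier.abs_integral_renormalized_le (h : IsMollifier C δ ρ) (hδ : 0 < δ)
    (hδε : δ ≤ ε) {Ω : Set E} (hΩ : Bornology.IsBounded Ω)
    {w : E → ℝ} (hw : Continuous w) (hw0 : ∀ x ∉ Ω, w x = 0) {M : ℝ} (hM : ∀ x, |w x| ≤ M)
    (hosc : ∀ x y, ‖x - y‖ ≤ δ → |w y - w x| ≤ ε / 2)
    {V : E → E} {L : NNReal} (hV : LipschitzWith L V) {B : ℝ} (hB : ∀ x ∈ Ω, ‖V x‖ ≤ B)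
    {φ : E → ℝ} (hφ : ContDiff ℝ 1 φ) {P P' : ℝ} (hP : ∀ x ∈ Ω, |φ x| ≤ P)
    (hP' : ∀ x ∈ Ω, ‖fderiv ℝ φ x‖ ≤ P') (hC : 0 ≤ C) :
    |(∫ x, φ x * (softPosDeriv ε (mollify ρ w x) * mollDiv ρ (fun y => |w y| • V y) x))
        - -∫ x, max (w x) 0 * fderiv ℝ φ x (V x)|
      ≤ ε * (4 * P * L * C + 3 * P' * B + M * P' * L) * volume.real Ω := by
  have hε : 0 < ε := hδ.trans_le hδε
  set wδ := mollify ρ w with hwδ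
  set D := mollDiv ρ V with hD
  set b : E → ℝ := fun x => softPos ε (wδ x) with hb
  set b' : E → ℝ := fun x => softPosDeriv ε (wδ x) with hb'
  have hwδc : ContDiff ℝ 1 wδ := h.contDiff_mollify hw
  have hbc : ContDiff ℝ 1 b := (contDiff_softPos hε).comp hwδc
  have hb'c : Continuous b' := (continuous_softPosDeriv hε).comp hwδc.continuous
  have hclose : ∀ x, |wδ x - w x| ≤ ε / 2 := fun x => h.norm_mollify_sub_le hw (hosc x)
  have hsmall : ∀ x ∉ Ω, wδ x ≤ ε := by
    intro x hx
    have := (abs_le.1 (hclose x)).2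
    rw [hw0 x hx] at this
    linarith
  have hb0 : ∀ x ∉ Ω, b x = 0 := fun x hx => softPos_of_le (hsmall x hx)
  have hb'0 : ∀ x ∉ Ω, b' x = 0 := fun x hx => softPosDeriv_of_le hε (hsmall x hx)
  have hfb : ∀ x v, fderiv ℝ (fun x => φ x * b x) x v
      = φ x * (b' x * fderiv ℝ wδ x v) + b x * fderiv ℝ φ x v := by
    intro x v
    have h1 : HasFDerivAt b (b' x • fderiv ℝ wδ x) x :=
      (hasDerivAt_softPos hε (wδ x)).comp_hasFDerivAt x
        (hwδc.differentiable one_ne_zero x).hasFDerivAt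
    have h2 : HasFDerivAt (fun x => φ x * b x) _ x :=
      (hφ.differentiable one_ne_zero x).hasFDerivAt.mul h1
    rw [h2.fderiv]; simp
  -- `|w|` may be replaced by `w` where the truncation is active
  have hrep : ∀ x, b' x * mollDiv ρ (fun y => |w y| • V y) x
      = b' x * mollDiv ρ (fun y => w y • V y) x := by
    intro x
    by_cases hx : wδ x ≤ ε
    · have : b' x = 0 := softPosDeriv_of_le hε hx
      simp [this]
    · congr 1
      refine integral_congr_ae (Eventually.of_forall fun y => ?_)
      by_cases hy : ‖x - y‖ ≤ δ
      · have h1 := (abs_le.1 (hclose x)).2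
        have h2 := (abs_le.1 (hosc x y hy)).1
        have : 0 ≤ w y := by linarith
        simp only [abs_of_nonneg this]
      · simp [h.fderiv_eq_zero (not_le.1 hy)]
  have hφ1 := hφ.continuous_fderiv one_ne_zero
  have hψ : ContDiff ℝ 1 fun x => φ x * b x := hφ.mul hbc
  have hψc : HasCompactSupport fun x => φ x * b x :=
    hasCompactSupport_of_bounded hΩ fun x hx => by simp [hb0 x hx]
  have hparts := h.integral_mul_mollDiv hψ hψc hV.continuous
  have hwV : Continuous fun y => |w y| • V y := hw.abs.smul hV.continuous
  have i1 : Integrable fun x => φ x * (b' x * mollDiv ρ (fun y => |w y| • V y) x) := by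
    refine Continuous.integrable_of_hasCompactSupport
      (hφ.continuous.mul (hb'c.mul (h.continuous_mollDiv hwV))) ?_
    exact hasCompactSupport_of_bounded hΩ fun x hx => by simp [hb'0 x hx]
  have i2 : Integrable fun x => max (w x) 0 * fderiv ℝ φ x (V x) := by
    refine Continuous.integrable_of_hasCompactSupport
      ((hw.max continuous_const).mul (hφ1.clm_apply hV.continuous)) ?_
    exact hasCompactSupport_of_bounded hΩ fun x hx => by simp [hw0 x hx]
  have i3 : Integrable fun x => φ x * b x * D x := by
    refine Continuous.integrable_of_hasCompactSupport
      (hψ.continuous.mul (h.continuous_mollDiv hV.continuous)) hψc.mul_right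
  have i4 : Integrable fun x => fderiv ℝ (fun x => φ x * b x) x (mollify ρ V x) := by
    refine Continuous.integrable_of_hasCompactSupport
      ((hψ.continuous_fderiv one_ne_zero).clm_apply (h.continuous_mollify hV.continuous)) ?_
    exact hasCompactSupport_of_bounded hΩ fun x hx => by rw [hfb, hb'0 x hx, hb0 x hx]; simp
  have i12 : Integrable fun x => φ x * (b' x * mollDiv ρ (fun y => |w y| • V y) x)
      + max (w x) 0 * fderiv ℝ φ x (V x) := i1.add i2
  have i34 : Integrable fun x => φ x * b x * D x
      + fderiv ℝ (fun x => φ x * b x) x (mollify ρ V x) := i3.add i4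
  have hzero : (∫ x, (φ x * b x * D x + fderiv ℝ (fun x => φ x * b x) x (mollify ρ V x))) = 0 := by
    rw [integral_add i3 i4, hparts]; ring
  have hmain : (∫ x, φ x * (b' x * mollDiv ρ (fun y => |w y| • V y) x))
        - -∫ x, max (w x) 0 * fderiv ℝ φ x (V x)
      = ∫ x, (φ x * (b' x * mollDiv ρ (fun y => |w y| • V y) x)
          + max (w x) 0 * fderiv ℝ φ x (V x)
          - (φ x * b x * D x + fderiv ℝ (fun x => φ x * b x) x (mollify ρ V x))) := by
    rw [integral_sub i12 i34, hzero, integral_add i1 i2]; ring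
  rw [hmain]
  refine abs_integral_le_of_bounded hΩ (fun x hx => ?_) fun x hx => ?_
  · rw [hfb, hb'0 x hx, hb0 x hx, hw0 x hx]; simp
  · rw [hrep, hfb]
    set r := mollDiv ρ (fun y => w y • V y) x - fderiv ℝ wδ x (V x) - w x * D x with hr
    have hrle : |r| ≤ ε / 2 * L * C := h.abs_commutator_le hδ hw hV (hosc x)
    have hDle : |D x| ≤ L * C := h.abs_mollDiv_le_of_lipschitz hδ hV x
    have hVδ : ‖V x - mollify ρ V x‖ ≤ L * δ := by
      rw [norm_sub_rev]; exact h.norm_mollify_sub_le_of_lipschitz hV x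
    have hφx := hP x hx
    have hφ'x := hP' x hx
    have hP0 : 0 ≤ P := (abs_nonneg _).trans hφx
    have hP'0 : 0 ≤ P' := (norm_nonneg _).trans hφ'x
    have hM0 : 0 ≤ M := (abs_nonneg _).trans (hM x)
    have hB0 : 0 ≤ B := (norm_nonneg _).trans (hB x hx)
    have hL0 : (0 : ℝ) ≤ L := L.2
    have hb'1 : |b' x| ≤ 1 := abs_le.2 ⟨by linarith [softPosDeriv_nonneg hε (r := wδ x)],
      softPosDeriv_le_one⟩
    have hbM : |b x| ≤ M := by
      rw [abs_of_nonneg (softPos_nonneg hε)]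
      refine (softPos_le_max hε).trans (max_le ?_ hM0)
      have h1 : ‖wδ x‖ ≤ M := h.norm_mollify_le hM x
      exact (le_abs_self _).trans h1
    have t1 : |fderiv ℝ wδ x (V x - mollify ρ V x)| ≤ ε / 2 * (L * C) := by
      refine (h.abs_fderiv_mollify_le hw (hosc x) _).trans ?_
      calc ε / 2 * ‖V x - mollify ρ V x‖ * (C / δ) ≤ ε / 2 * (L * δ) * (C / δ) := by gcongr
        _ = ε / 2 * (L * C) := by field_simp
    have t2 : |b' x * w x - b x| ≤ 5 / 2 * ε := by
      have e : b' x * w x - b x = (b' x * wδ x - b x) + b' x * (w x - wδ x) := by ring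
      rw [e]
      refine (abs_add_le _ _).trans ?_
      have h1 : |b' x * wδ x - b x| ≤ 2 * ε := abs_softPosDeriv_mul_sub_softPos_le hε
      have h2 : |b' x * (w x - wδ x)| ≤ 1 * (ε / 2) := by
        rw [abs_mul, abs_sub_comm]
        exact mul_le_mul hb'1 (hclose x) (abs_nonneg _) zero_le_one
      linarith
    have t3 : |max (w x) 0 - b x| ≤ 5 / 2 * ε := by
      have h1 := max_sub_softPos_le hε (r := wδ x)
      have h2 := softPos_le_max hε (r := wδ x)
      have h3 : |max (w x) 0 - max (wδ x) 0| ≤ ε / 2 := by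
        refine (abs_max_sub_max_le_abs _ _ _).trans ?_
        rw [abs_sub_comm]; exact hclose x
      have h4 : |max (wδ x) 0 - b x| ≤ 2 * ε := abs_le.2 ⟨by linarith, h1⟩
      calc _ ≤ _ := abs_sub_le _ (max (wδ x) 0) _
        _ ≤ _ := by linarith
    have t4 : |fderiv ℝ φ x (V x)| ≤ P' * B :=
      ((fderiv ℝ φ x).le_opNorm _).trans (mul_le_mul hφ'x (hB x hx) (norm_nonneg _) hP'0)
    have t5 : |fderiv ℝ φ x (V x - mollify ρ V x)| ≤ P' * (L * ε) :=
      ((fderiv ℝ φ x).le_opNorm _).trans (mul_le_mul hφ'x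
        (hVδ.trans (mul_le_mul_of_nonneg_left hδε hL0)) (norm_nonneg _) hP'0)
    have e : φ x * (b' x * mollDiv ρ (fun y => w y • V y) x)
          + max (w x) 0 * fderiv ℝ φ x (V x)
          - (φ x * b x * D x + (φ x * (b' x * fderiv ℝ wδ x (mollify ρ V x))
            + b x * fderiv ℝ φ x (mollify ρ V x)))
        = φ x * (b' x * fderiv ℝ wδ x (V x - mollify ρ V x))
          + φ x * ((b' x * w x - b x) * D x) + φ x * (b' x * r)
          + (max (w x) 0 - b x) * fderiv ℝ φ x (V x)
          + b x * fderiv ℝ φ x (V x - mollify ρ V x) := by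
      rw [hr, map_sub, map_sub]; ring
    rw [e]
    have s1 : |φ x * (b' x * fderiv ℝ wδ x (V x - mollify ρ V x))|
        ≤ P * (1 * (ε / 2 * (L * C))) := by
      rw [abs_mul, abs_mul]; gcongr
    have s2 : |φ x * ((b' x * w x - b x) * D x)| ≤ P * (5 / 2 * ε * (L * C)) := by
      rw [abs_mul, abs_mul]; gcongr
    have s3 : |φ x * (b' x * r)| ≤ P * (1 * (ε / 2 * L * C)) := by
      rw [abs_mul, abs_mul]; gcongr
    have s4 : |(max (w x) 0 - b x) * fderiv ℝ φ x (V x)| ≤ 5 / 2 * ε * (P' * B) := by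
      rw [abs_mul]; gcongr
    have s5 : |b x * fderiv ℝ φ x (V x - mollify ρ V x)| ≤ M * (P' * (L * ε)) := by
      rw [abs_mul]; gcongr
    have q1 : 0 ≤ ε * (P' * B) := by positivity
    have q2 : 0 ≤ ε * (P * (L * C)) := by positivity
    refine (abs_add_le _ _).trans ?_
    refine (add_le_add ((abs_add_le _ _).trans (add_le_add ((abs_add_le _ _).trans
      (add_le_add ((abs_add_le _ _).trans (add_le_add s1 s2)) s3)) s4)) s5).trans ?_
    nlinarith

end Renormalization


/-! ### The positive part solves a linear continuity equation -/

section Transport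

variable {E : Type*} [NormedAddCommGroup E] [InnerProductSpace ℝ E] [FiniteDimensional ℝ E]
  [MeasurableSpace E] [BorelSpace E]

/-- `u` is a bounded continuous solution of `u_t = ∇ · (|u| V)` in `Ω × (a, b)`, extended by zero
outside `Ω`, for a velocity field `V` which is Lipschitz in space uniformly in time. The equation
is tested with time-independent functions. Nothing is assumed on the time dependence of `V`. -/
structure IsTransportSolution (Ω : Set E) (a b M B : ℝ) (L : NNReal) (u : ℝ → E → ℝ)
    (V : ℝ → E → E) : Prop where
  isBounded : Bornology.IsBounded Ω
  continuousOn : ContinuousOn (fun z : ℝ × E => u z.1 z.2) (Ioo a b ×ˢ univ)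
  eq_zero : ∀ t ∈ Ioo a b, ∀ x ∉ Ω, u t x = 0
  abs_le : ∀ t ∈ Ioo a b, ∀ x, |u t x| ≤ M
  norm_le : ∀ t ∈ Ioo a b, ∀ x ∈ Ω, ‖V t x‖ ≤ B
  lipschitzWith : ∀ t ∈ Ioo a b, LipschitzWith L (V t)
  hasDerivAt : ∀ φ : E → ℝ, ContDiff ℝ 1 φ → HasCompactSupport φ → tsupport φ ⊆ Ω →
    ∀ t ∈ Ioo a b, HasDerivAt (fun τ => ∫ x, φ x * u τ x)
      (-∫ x, |u t x| * fderiv ℝ φ x (V t x)) t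

variable {Ω : Set E} {a b M B : ℝ} {L : NNReal} {u : ℝ → E → ℝ} {V : ℝ → E → E}

theorem IsTransportSolution.continuous (hu : IsTransportSolution Ω a b M B L u V) {t : ℝ}
    (ht : t ∈ Ioo a b) : Continuous (u t) := by
  rw [← continuousOn_univ]
  exact hu.continuousOn.comp (f := fun x => (t, x)) (by fun_prop) fun x _ => ⟨ht, mem_univ _⟩

theorem IsTransportSolution.neg (hu : IsTransportSolution Ω a b M B L u V) :
    IsTransportSolution Ω a b M B L (fun t x => -u t x) (fun t x => -V t x) where
  isBounded := hu.isBounded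
  continuousOn := hu.continuousOn.neg
  eq_zero t ht x hx := by simp [hu.eq_zero t ht x hx]
  abs_le t ht x := by simpa using hu.abs_le t ht x
  norm_le t ht x hx := by simpa using hu.norm_le t ht x hx
  lipschitzWith t ht := (hu.lipschitzWith t ht).neg
  hasDerivAt φ h1 h2 h3 t ht := by
    have := (hu.hasDerivAt φ h1 h2 h3 t ht).fun_neg
    simpa [integral_neg] using! this

/-- Equicontinuity in space, uniformly over compact time intervals. -/
theorem exists_modulus {E : Type*} [NormedAddCommGroup E] [ProperSpace E] {Ω : Set E}
    {u : ℝ → E → ℝ} {a b c d : ℝ} (hΩ : Bornology.IsBounded Ω)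
    (hu : ContinuousOn (fun z : ℝ × E => u z.1 z.2) (Ioo a b ×ˢ univ))
    (hu0 : ∀ t ∈ Ioo a b, ∀ x ∉ Ω, u t x = 0)
    (hac : a < c) (hdb : d < b) {ε : ℝ} (hε : 0 < ε) :
    ∃ δ > 0, ∀ t ∈ Icc c d, ∀ x y, ‖x - y‖ ≤ δ → |u t y - u t x| ≤ ε := by
  obtain ⟨R, hR⟩ := hΩ.exists_norm_le
  have hsub : Icc c d ⊆ Ioo a b := Icc_subset_Ioo hac hdb
  have hK : IsCompact (Icc c d ×ˢ Metric.closedBall (0 : E) (R + 1)) :=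
    isCompact_Icc.prod (isCompact_closedBall _ _)
  have huc := hK.uniformContinuousOn_of_continuous
    (hu.mono (prod_mono hsub (subset_univ _)))
  rw [Metric.uniformContinuousOn_iff] at huc
  obtain ⟨δ, hδ, h⟩ := huc ε hε
  refine ⟨min (δ / 2) 1, lt_min (half_pos hδ) one_pos, fun t ht x y hxy => ?_⟩
  have hx1 : ‖x - y‖ ≤ 1 := hxy.trans (min_le_right _ _)
  by_cases hmem : ‖x‖ ≤ R + 1 ∧ ‖y‖ ≤ R + 1
  · have := h (t, y) ⟨ht, mem_closedBall_zero_iff.2 hmem.2⟩ (t, x)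
      ⟨ht, mem_closedBall_zero_iff.2 hmem.1⟩ (by
        rw [Prod.dist_eq, dist_self, max_eq_right dist_nonneg, dist_comm, dist_eq_norm]
        exact (hxy.trans (min_le_left _ _)).trans_lt (half_lt_self hδ))
    rw [Real.dist_eq] at this
    exact this.le
  · have hxx := norm_sub_norm_le x y
    have hyy := norm_sub_norm_le y x
    rw [norm_sub_rev y x] at hyy
    have h1 : x ∉ Ω := fun hx => by
      have := hR x hx
      exact hmem ⟨by linarith, by linarith⟩
    have h2 : y ∉ Ω := fun hx => by
      have := hR y hx
      exact hmem ⟨by linarith, by linarith⟩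
    rw [hu0 t (hsub ht) x h1, hu0 t (hsub ht) y h2]
    simpa using hε.le

theorem IsTransportSolution.exists_modulus (hu : IsTransportSolution Ω a b M B L u V) {c d : ℝ}
    (hac : a < c) (hdb : d < b) {ε : ℝ} (hε : 0 < ε) :
    ∃ δ > 0, ∀ t ∈ Icc c d, ∀ x y, ‖x - y‖ ≤ δ → |u t y - u t x| ≤ ε :=
  MotionPDE.exists_modulus hu.isBounded hu.continuousOn hu.eq_zero hac hdb hε

theorem exists_bound_of_continuous {E F : Type*} [NormedAddCommGroup E] [ProperSpace E]
    [NormedAddCommGroup F] {Ω : Set E} (hΩ : Bornology.IsBounded Ω) {k : E → F}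
    (hk : Continuous k) :
    ∃ c, ∀ x ∈ Ω, ‖k x‖ ≤ c := by
  obtain ⟨c, hc⟩ := hΩ.isCompact_closure.exists_bound_of_continuousOn hk.continuousOn
  exact ⟨c, fun x hx => hc x (subset_closure hx)⟩

variable {C δ ε : ℝ} {ρ : E → ℝ}

/-- The equation tested with a translate of the mollifier. -/
theorem IsMollifier.hasDerivAt_mollify (h : IsMollifier C δ ρ)
    (hu : IsTransportSolution Ω a b M B L u V) {x : E} (hx : Metric.closedBall x δ ⊆ Ω) {t : ℝ}
    (ht : t ∈ Ioo a b) :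
    HasDerivAt (fun τ => mollify ρ (u τ) x) (mollDiv ρ (fun y => |u t y| • V t y) x) t := by
  have hsupp : tsupport (fun y => ρ (x - y)) ⊆ Metric.closedBall x δ := by
    refine closure_minimal (fun y hy => ?_) Metric.isClosed_closedBall
    rw [Metric.mem_closedBall, dist_comm, dist_eq_norm]
    by_contra hc
    exact hy (h.eq_zero _ (not_le.1 hc))
  have h1 := hu.hasDerivAt (fun y => ρ (x - y)) (h.contDiff.comp (contDiff_const.sub contDiff_id))
    (h.hasCompactSupport_sub x) (hsupp.trans hx) t ht
  have h2 : ∀ y v, fderiv ℝ (fun y => ρ (x - y)) y v = -fderiv ℝ ρ (x - y) v := by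
    intro y v
    have h3 : HasFDerivAt (fun y => ρ (x - y)) _ y :=
      (h.contDiff.differentiable one_ne_zero (x - y)).hasFDerivAt.comp y
        ((hasFDerivAt_id y).const_sub x)
    rw [h3.fderiv]
    simp
  convert! h1 using 1
  simp only [h2, mollDiv, map_smul, smul_eq_mul, mul_neg, integral_neg, neg_neg]

/-- Differentiation of the truncated mollification. Where the truncation is active the ball of
radius `δ` is inside `Ω`, so that the equation applies. -/
theorem IsMollifier.hasDerivAt_integral_softPos (h : IsMollifier C δ ρ) (hδ : 0 < δ) (hC : 0 ≤ C)
    (hε : 0 < ε) (hu : IsTransportSolution Ω a b M B L u V) {s : Set ℝ} (hs : IsOpen s)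
    (hsub : s ⊆ Ioo a b)
    (hosc : ∀ τ ∈ s, ∀ x y, ‖x - y‖ ≤ δ → |u τ y - u τ x| ≤ ε / 2)
    {φ : E → ℝ} (hφ : Continuous φ) {t : ℝ} (ht : t ∈ s) :
    HasDerivAt (fun τ => ∫ x, φ x * softPos ε (mollify ρ (u τ) x))
      (∫ x, φ x * (softPosDeriv ε (mollify ρ (u t) x)
        * mollDiv ρ (fun y => |u t y| • V t y) x)) t := by
  obtain ⟨P, hP⟩ := exists_bound_of_continuous hu.isBounded hφ
  have hclose : ∀ τ ∈ s, ∀ x, |mollify ρ (u τ) x - u τ x| ≤ ε / 2 := fun τ hτ x =>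
    h.norm_mollify_sub_le (hu.continuous (hsub hτ)) (hosc τ hτ x)
  -- no contribution from balls that meet the complement of `Ω`
  have hsmall : ∀ τ ∈ s, ∀ x y, ‖x - y‖ ≤ δ → y ∉ Ω → mollify ρ (u τ) x ≤ ε := by
    intro τ hτ x y hxy hy
    have h1 := (_root_.abs_le.1 (hclose τ hτ x)).2
    have h2 := (_root_.abs_le.1 (hosc τ hτ x y hxy)).1
    rw [hu.eq_zero τ (hsub hτ) y hy] at h2
    linarith
  have hout : ∀ τ ∈ s, ∀ x ∉ Ω, mollify ρ (u τ) x ≤ ε := fun τ hτ x hx =>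
    hsmall τ hτ x x (by simpa using hδ.le) hx
  have hcont : ∀ τ ∈ s, Continuous fun x => φ x * softPos ε (mollify ρ (u τ) x) := fun τ hτ =>
    hφ.mul ((continuous_softPos hε).comp (h.contDiff_mollify (hu.continuous (hsub hτ))).continuous)
  have hV : Continuous fun y => |u t y| • V t y :=
    (hu.continuous (hsub ht)).abs.smul (hu.lipschitzWith t (hsub ht)).continuous
  refine (hasDerivAt_integral_of_dominated_loc_of_deriv_le
    (F := fun τ x => φ x * softPos ε (mollify ρ (u τ) x))
    (F' := fun τ x => φ x * (softPosDeriv ε (mollify ρ (u τ) x)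
        * mollDiv ρ (fun y => |u τ y| • V τ y) x))
    (bound := fun x => (closure Ω).indicator (fun _ => P * (1 * (M * B * (C / δ)))) x)
    (hs.mem_nhds ht) ?_ ?_ ?_ ?_ ?_ ?_).2
  · filter_upwards [hs.mem_nhds ht] with τ hτ
    exact (hcont τ hτ).aestronglyMeasurable
  · refine (hcont t ht).integrable_of_hasCompactSupport ?_
    exact hasCompactSupport_of_bounded hu.isBounded fun x hx => by
      rw [softPos_of_le (hout t ht x hx), mul_zero]
  · refine (hφ.mul (((continuous_softPosDeriv hε).comp
      (h.contDiff_mollify (hu.continuous (hsub ht))).continuous).mul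
        (h.continuous_mollDiv hV))).aestronglyMeasurable
  · refine Eventually.of_forall fun x τ hτ => ?_
    by_cases hx : x ∈ Ω
    · rw [indicator_of_mem (subset_closure hx), norm_mul, norm_mul]
      have h0 : ‖softPosDeriv ε (mollify ρ (u τ) x)‖ ≤ 1 := by
        rw [Real.norm_of_nonneg (softPosDeriv_nonneg hε)]; exact softPosDeriv_le_one
      have hMB : ∀ y, ‖|u τ y| • V τ y‖ ≤ M * B := by
        intro y
        have hM := hu.abs_le τ (hsub hτ)
        have hM0 : 0 ≤ M := (abs_nonneg _).trans (hM x)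
        by_cases hy : y ∈ Ω
        · rw [norm_smul, Real.norm_of_nonneg (abs_nonneg _)]
          exact mul_le_mul (hM y) (hu.norm_le τ (hsub hτ) y hy) (norm_nonneg _) hM0
        · rw [hu.eq_zero τ (hsub hτ) y hy]
          have := (norm_nonneg _).trans (hu.norm_le τ (hsub hτ) x hx)
          simp; positivity
      have h1 : ‖mollDiv ρ (fun y => |u τ y| • V τ y) x‖ ≤ M * B * (C / δ) :=
        h.abs_mollDiv_le fun y _ => hMB y
      have hP0 := (norm_nonneg _).trans (hP x hx)
      exact mul_le_mul (hP x hx) (mul_le_mul h0 h1 (norm_nonneg _) zero_le_one)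
        (mul_nonneg (norm_nonneg _) (norm_nonneg _)) hP0
    · rw [softPosDeriv_of_le hε (hout τ hτ x hx)]
      simp only [zero_mul, mul_zero, norm_zero]
      refine indicator_nonneg (fun y hy => ?_) _
      obtain ⟨z, hz⟩ : Ω.Nonempty := closure_nonempty_iff.1 ⟨y, hy⟩
      have h1 := (norm_nonneg _).trans (hP z hz)
      have h2 := (norm_nonneg _).trans (hu.norm_le τ (hsub hτ) z hz)
      have h3 := (abs_nonneg _).trans (hu.abs_le τ (hsub hτ) z)
      positivity
  · rw [integrable_indicator_iff isClosed_closure.measurableSet]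
    exact integrableOn_const (hu.isBounded.isCompact_closure.measure_lt_top.ne)
  · refine Eventually.of_forall fun x τ hτ => ?_
    refine HasDerivAt.const_mul _ ?_
    by_cases hx : Metric.closedBall x δ ⊆ Ω
    · exact (hasDerivAt_softPos hε _).comp τ (h.hasDerivAt_mollify hu hx (hsub hτ))
    · obtain ⟨y, hy, hyΩ⟩ := not_subset.1 hx
      have hxy : ‖x - y‖ ≤ δ := by
        rwa [Metric.mem_closedBall, dist_comm, dist_eq_norm] at hy
      rw [softPosDeriv_of_le hε (hsmall τ hτ x y hxy hyΩ), zero_mul]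
      refine (hasDerivAt_const τ (0 : ℝ)).congr_of_eventuallyEq ?_
      filter_upwards [hs.mem_nhds hτ] with σ hσ
      exact softPos_of_le (hsmall σ hσ x y hxy hyΩ)

/-- The positive part solves the linear continuity equation `w_t = ∇ · (w V)` on the whole space:
the zero set of `u` and the boundary of `Ω` do not contribute. -/
theorem IsTransportSolution.hasDerivAt_integral_posPart
    (hu : IsTransportSolution Ω a b M B L u V) {φ : E → ℝ} (hφ : ContDiff ℝ 1 φ) {t : ℝ}
    (ht : t ∈ Ioo a b) :
    HasDerivAt (fun τ => ∫ x, φ x * max (u τ x) 0)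
      (-∫ x, max (u t x) 0 * fderiv ℝ φ x (V t x)) t := by
  obtain ⟨C, hC, hmol⟩ := exists_isMollifier E
  obtain ⟨c, hac, hct⟩ := exists_between ht.1
  obtain ⟨d, htd, hdb⟩ := exists_between ht.2
  obtain ⟨P, hP⟩ := exists_bound_of_continuous hu.isBounded hφ.continuous
  obtain ⟨P', hP'⟩ := exists_bound_of_continuous hu.isBounded (hφ.continuous_fderiv one_ne_zero)
  have hsub : Ioo c d ⊆ Ioo a b := Ioo_subset_Ioo hac.le hdb.le
  -- scales `ε k → 0`, and mollifiers adapted to the modulus of continuity of `u`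
  let ε : ℕ → ℝ := fun k => 1 / ((k : ℝ) + 1)
  have hε : ∀ k, 0 < ε k := fun k => Nat.one_div_pos_of_nat
  have hε0 : Tendsto ε atTop (𝓝 0) := tendsto_one_div_add_atTop_nhds_zero_nat
  have hex : ∀ k, ∃ δ : ℝ, ∃ ρ : E → ℝ, 0 < δ ∧ δ ≤ ε k ∧ IsMollifier C δ ρ ∧
      ∀ τ ∈ Icc c d, ∀ x y, ‖x - y‖ ≤ δ → |u τ y - u τ x| ≤ ε k / 2 := by
    intro k
    obtain ⟨δ, hδ, h⟩ := hu.exists_modulus hac hdb (half_pos (hε k))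
    obtain ⟨ρ, hρ⟩ := hmol (min δ (ε k)) (lt_min hδ (hε k))
    exact ⟨min δ (ε k), ρ, lt_min hδ (hε k), min_le_right _ _, hρ,
      fun τ hτ x y hxy => h τ hτ x y (hxy.trans (min_le_left _ _))⟩
  choose δ ρ hδ hδε hρ hosc using hex
  have hosc' : ∀ k, ∀ τ ∈ Ioo c d, ∀ x y, ‖x - y‖ ≤ δ k → |u τ y - u τ x| ≤ ε k / 2 :=
    fun k τ hτ => hosc k τ (Ioo_subset_Icc_self hτ)
  refine hasDerivAt_of_tendstoUniformlyOn (l := atTop) (s := Ioo c d) isOpen_Ioo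
    (f := fun k τ => ∫ x, φ x * softPos (ε k) (mollify (ρ k) (u τ) x))
    (f' := fun k τ => ∫ x, φ x * (softPosDeriv (ε k) (mollify (ρ k) (u τ) x)
      * mollDiv (ρ k) (fun y => |u τ y| • V τ y) x))
    (g' := fun τ => -∫ x, max (u τ x) 0 * fderiv ℝ φ x (V τ x)) ?_ ?_ ?_ ⟨hct, htd⟩
  · rw [Metric.tendstoUniformlyOn_iff]
    intro η hη
    have hlim : Tendsto (fun k => ε k * (4 * P * L * C + 3 * P' * B + M * P' * L)
        * volume.real Ω) atTop (𝓝 0) := by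
      simpa using (hε0.mul_const (4 * P * L * C + 3 * P' * B + M * P' * L)).mul_const
        (volume.real Ω)
    filter_upwards [hlim.eventually_lt_const hη] with k hk τ hτ
    refine lt_of_le_of_lt ?_ hk
    rw [dist_comm, Real.dist_eq]
    exact (hρ k).abs_integral_renormalized_le (hδ k) (hδε k) hu.isBounded
      (hu.continuous (hsub hτ)) (hu.eq_zero τ (hsub hτ)) (hu.abs_le τ (hsub hτ)) (hosc' k τ hτ)
      (hu.lipschitzWith τ (hsub hτ)) (hu.norm_le τ (hsub hτ)) hφ hP hP' hC
  · exact Eventually.of_forall fun k τ hτ => (hρ k).hasDerivAt_integral_softPos (hδ k) hC (hε k) hu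
      isOpen_Ioo hsub (hosc' k) hφ.continuous hτ
  · intro τ hτ
    have hlim : Tendsto (fun k => P * (3 * ε k) * volume.real Ω) atTop (𝓝 0) := by
      simpa using ((hε0.const_mul 3).const_mul P).mul_const (volume.real Ω)
    refine tendsto_iff_dist_tendsto_zero.2 (squeeze_zero (fun _ => dist_nonneg) (fun k => ?_) hlim)
    have hw := hu.continuous (hsub hτ)
    have hw0 := hu.eq_zero τ (hsub hτ)
    have hclose : ∀ x, |mollify (ρ k) (u τ) x - u τ x| ≤ ε k / 2 := fun x =>
      (hρ k).norm_mollify_sub_le hw (hosc' k τ hτ x)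
    have hout : ∀ x ∉ Ω, softPos (ε k) (mollify (ρ k) (u τ) x) = 0 := by
      intro x hx
      refine softPos_of_le ?_
      have := (_root_.abs_le.1 (hclose x)).2
      rw [hw0 x hx] at this
      linarith [hε k]
    have hout' : ∀ x ∉ Ω, max (u τ x) 0 = 0 := fun x hx => by simp [hw0 x hx]
    rw [Real.dist_eq, ← integral_sub]
    · refine abs_integral_le_of_bounded hu.isBounded
        (fun x hx => by rw [hout x hx, hout' x hx]; ring) fun x hx => ?_
      rw [← mul_sub, abs_mul]
      have h1 := max_sub_softPos_le (hε k) (r := mollify (ρ k) (u τ) x)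
      have h2 := softPos_le_max (hε k) (r := mollify (ρ k) (u τ) x)
      have h3 : |max (mollify (ρ k) (u τ) x) 0 - max (u τ x) 0| ≤ ε k / 2 :=
        (abs_max_sub_max_le_abs _ _ _).trans (hclose x)
      have h4 := _root_.abs_le.1 h3
      refine mul_le_mul (hP x hx) ?_ (abs_nonneg _) ((norm_nonneg _).trans (hP x hx))
      have := hε k
      rw [_root_.abs_le]; constructor <;> linarith
    · exact (hφ.continuous.mul ((continuous_softPos (hε k)).comp
        ((hρ k).contDiff_mollify hw).continuous)).integrable_of_hasCompactSupport
        (hasCompactSupport_of_bounded hu.isBounded fun x hx => by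
          rw [Pi.mul_apply, Function.comp_apply, hout x hx, mul_zero])
    · exact (hφ.continuous.mul (hw.max continuous_const)).integrable_of_hasCompactSupport
        (hasCompactSupport_of_bounded hu.isBounded fun x hx => by
          rw [Pi.mul_apply, hout' x hx, mul_zero])

end Transport


/-! ### Weak convergence of bounded functions -/

section WeakConvergence

variable {E : Type*} [NormedAddCommGroup E] [InnerProductSpace ℝ E] [FiniteDimensional ℝ E]

theorem exists_contDiff_cutoff {K Ω : Set E} (hK : IsCompact K) (hΩ : IsOpen Ω)
    (hKΩ : K ⊆ Ω) : ∃ χ : E → ℝ, ContDiff ℝ 1 χ ∧ HasCompactSupport χ ∧ tsupport χ ⊆ Ω ∧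
      (∀ x ∈ K, χ x = 1) ∧ ∀ x, χ x ∈ Icc (0 : ℝ) 1 := by
  obtain ⟨K', hK', hKK', hK'Ω⟩ := exists_compact_between hK hΩ hKΩ
  obtain ⟨f, hf1, hf0, hf⟩ := exists_contMDiffMap_one_nhds_of_subset_interior (n := 1)
    (modelWithCornersSelf ℝ E) hK.isClosed hKK'
  have hts : tsupport f ⊆ K' := closure_minimal
    (fun x hx => by_contra fun hc => hx (hf0 x hc)) hK'.isClosed
  exact ⟨f, f.contMDiff.contDiff, hK'.of_isClosed_subset (isClosed_tsupport _) hts,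
    hts.trans hK'Ω, fun x hx => hf1.self_of_nhdsSet x hx, hf⟩

variable [MeasurableSpace E] [BorelSpace E]

/-- `C¹` functions with compact support in `Ω` are dense in `L¹(Ω)`. -/
theorem exists_contDiff_setIntegral_sub_le {Ω : Set E} (hΩ : IsOpen Ω)
    (hΩb : Bornology.IsBounded Ω) {g : E → ℝ} (hg : IntegrableOn g Ω) {ε : ℝ} (hε : 0 < ε) :
    ∃ φ : E → ℝ, ContDiff ℝ 1 φ ∧ HasCompactSupport φ ∧ tsupport φ ⊆ Ω ∧
      ∫ x in Ω, |g x - φ x| ≤ ε := by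
  have hμ : volume Ω ≠ ⊤ := hΩb.measure_lt_top.ne
  obtain ⟨h, hhc, hh, hcont, hint⟩ :=
    (hg.integrable_indicator hΩ.measurableSet).exists_hasCompactSupport_integral_sub_le
      (ε := ε / 3) (by positivity)
  have hV : 0 ≤ volume.real Ω := measureReal_nonneg
  obtain ⟨k, hk, hkh⟩ := (hhc.uniformContinuous_of_continuous
    hcont).exists_contDiff_dist_le (ε := ε / 3 / (volume.real Ω + 1)) (by positivity)
  obtain ⟨c, hc⟩ := exists_bound_of_continuous hΩb hk.continuous
  obtain ⟨K, hKΩ, hK, hKlt⟩ := hΩ.measurableSet.exists_isCompact_sdiff_lt hμ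
    (ε := ENNReal.ofReal (ε / 3 / (|c| + 1))) (by simp; positivity)
  obtain ⟨χ, hχ, hχc, hχs, hχ1, hχI⟩ := exists_contDiff_cutoff hK hΩ hKΩ
  refine ⟨fun x => χ x * k x, hχ.mul (hk.of_le (by norm_cast)), hχc.mul_right,
    (tsupport_mul_subset_left (f := χ) (g := k)).trans hχs, ?_⟩
  have hfin : Fact (volume Ω < ⊤) := ⟨hΩb.measure_lt_top⟩
  have i1 : IntegrableOn (fun x => |g x - h x|) Ω := (hg.sub hint.integrableOn).abs
  have hbk : ∀ x ∈ Ω, |h x - k x| ≤ ε / 3 / (volume.real Ω + 1) := fun x _ => by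
    rw [abs_sub_comm]; exact (hkh x).le
  have hcdiff : ∀ x ∈ Ω, |k x - χ x * k x| ≤ (Ω \ K).indicator (fun _ => |c|) x := by
    intro x hx
    by_cases hxK : x ∈ K
    · rw [hχ1 x hxK]; simp [hxK]
    · rw [indicator_of_mem (show x ∈ Ω \ K from ⟨hx, hxK⟩)]
      have h1 := hχI x
      have e : k x - χ x * k x = (1 - χ x) * k x := by ring
      rw [e, abs_mul, abs_of_nonneg (by linarith [h1.2] : 0 ≤ 1 - χ x)]
      have h2 : |k x| ≤ |c| := (hc x hx).trans (le_abs_self c)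
      nlinarith [h1.1, h1.2, abs_nonneg (k x), abs_nonneg c]
  have i2 : IntegrableOn (fun _ : E => ε / 3 / (volume.real Ω + 1)) Ω := integrableOn_const hμ
  have hmd : MeasurableSet (Ω \ K) := hΩ.measurableSet.diff hK.measurableSet
  have i3 : IntegrableOn (fun x => (Ω \ K).indicator (fun _ => |c|) x) Ω :=
    (integrable_const (μ := volume.restrict Ω) |c|).indicator hmd
  have i12 : IntegrableOn (fun x => |g x - h x| + ε / 3 / (volume.real Ω + 1)) Ω := i1.add i2
  have i123 : IntegrableOn (fun x => |g x - h x| + ε / 3 / (volume.real Ω + 1)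
    + (Ω \ K).indicator (fun _ => |c|) x) Ω := i12.add i3
  calc ∫ x in Ω, |g x - χ x * k x|
      ≤ ∫ x in Ω, (|g x - h x| + ε / 3 / (volume.real Ω + 1)
          + (Ω \ K).indicator (fun _ => |c|) x) := by
        refine integral_mono_of_nonneg (Eventually.of_forall fun x => abs_nonneg _) i123 ?_
        filter_upwards [ae_restrict_mem hΩ.measurableSet] with x hx
        calc |g x - χ x * k x| = |(g x - h x) + (h x - k x) + (k x - χ x * k x)| := by ring_nf
          _ ≤ |g x - h x| + |h x - k x| + |k x - χ x * k x| := abs_add_three _ _ _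
          _ ≤ _ := add_le_add (add_le_add le_rfl (hbk x hx)) (hcdiff x hx)
    _ = (∫ x in Ω, |g x - h x|) + (∫ _x in Ω, ε / 3 / (volume.real Ω + 1))
          + ∫ x in Ω, (Ω \ K).indicator (fun _ => |c|) x := by
        rw [integral_add i12 i3, integral_add i1 i2]
    _ ≤ ε / 3 + ε / 3 + ε / 3 := by
        refine add_le_add (add_le_add ?_ ?_) ?_
        · refine le_trans ?_ hh
          have : ∫ x in Ω, |g x - h x| = ∫ x in Ω, ‖Ω.indicator g x - h x‖ := by
            refine setIntegral_congr_fun hΩ.measurableSet fun x hx => ?_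
            simp only [indicator_of_mem hx, Real.norm_eq_abs]
          rw [this]
          exact setIntegral_le_integral
            ((hg.integrable_indicator hΩ.measurableSet).sub hint).norm
            (Eventually.of_forall fun x => norm_nonneg _)
        · rw [setIntegral_const, smul_eq_mul, ← mul_div_assoc, div_le_iff₀ (by positivity)]
          nlinarith
        · rw [setIntegral_indicator hmd, inter_eq_right.2 sdiff_subset, setIntegral_const,
            smul_eq_mul]
          have h1 : volume.real (Ω \ K) ≤ ε / 3 / (|c| + 1) :=
            ENNReal.toReal_le_of_le_ofReal (by positivity) hKlt.le
          have hc0 := abs_nonneg c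
          calc _ ≤ ε / 3 / (|c| + 1) * |c| := by gcongr
            _ ≤ ε / 3 := by rw [div_mul_eq_mul_div, div_le_iff₀ (by positivity)]; nlinarith
    _ = ε := by ring

/-- For uniformly bounded functions, convergence against test functions upgrades to convergence
against integrable functions. -/
theorem tendsto_setIntegral_mul_of_bounded {Ω : Set E} (hΩ : IsOpen Ω)
    (hΩb : Bornology.IsBounded Ω) {ι : Type*} {l : Filter ι} {v : ι → E → ℝ} {v₀ : E → ℝ} {M : ℝ}
    (hv : ∀ᶠ s in l, AEStronglyMeasurable (v s) (volume.restrict Ω) ∧ ∀ x ∈ Ω, |v s x| ≤ M)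
    (hv₀ : AEStronglyMeasurable v₀ (volume.restrict Ω)) (hM₀ : ∀ x ∈ Ω, |v₀ x| ≤ M)
    (hweak : ∀ φ : E → ℝ, ContDiff ℝ 1 φ → HasCompactSupport φ → tsupport φ ⊆ Ω →
      Tendsto (fun s => ∫ x in Ω, φ x * v s x) l (𝓝 (∫ x in Ω, φ x * v₀ x)))
    {g : E → ℝ} (hg : IntegrableOn g Ω) :
    Tendsto (fun s => ∫ x in Ω, g x * v s x) l (𝓝 (∫ x in Ω, g x * v₀ x)) := by
  have key : ∀ w : E → ℝ, AEStronglyMeasurable w (volume.restrict Ω) → (∀ x ∈ Ω, |w x| ≤ M) →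
      ∀ φ : E → ℝ, IntegrableOn φ Ω →
      |(∫ x in Ω, g x * w x) - ∫ x in Ω, φ x * w x| ≤ (∫ x in Ω, |g x - φ x|) * M := by
    intro w hw hwM φ hφ
    have hwM' : ∀ᵐ x ∂volume.restrict Ω, ‖w x‖ ≤ M := by
      filter_upwards [ae_restrict_mem hΩ.measurableSet] with x hx using hwM x hx
    have i1 : IntegrableOn (fun x => g x * w x) Ω := hg.mul_bdd (c := M) hw hwM'
    have i2 : IntegrableOn (fun x => φ x * w x) Ω := hφ.mul_bdd (c := M) hw hwM'
    rw [← integral_sub i1 i2, ← integral_mul_const, ← Real.norm_eq_abs]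
    refine norm_integral_le_of_norm_le ((hg.sub hφ).abs.mul_const M) ?_
    filter_upwards [hwM'] with x hx
    rw [← sub_mul, norm_mul]
    exact mul_le_mul_of_nonneg_left hx (norm_nonneg _)
  rw [Metric.tendsto_nhds]
  intro ε hε
  have hM1 : 0 < |M| + 1 := by positivity
  obtain ⟨φ, hφ, hφc, hφs, hφg⟩ := exists_contDiff_setIntegral_sub_le hΩ hΩb hg
    (ε := ε / 4 / (|M| + 1)) (by positivity)
  have hφi : IntegrableOn φ Ω := (hφ.continuous.integrable_of_hasCompactSupport hφc).integrableOn
  have hsm : ∀ w : E → ℝ, AEStronglyMeasurable w (volume.restrict Ω) → (∀ x ∈ Ω, |w x| ≤ M) →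
      |(∫ x in Ω, g x * w x) - ∫ x in Ω, φ x * w x| ≤ ε / 4 := by
    intro w hw hwM
    refine (key w hw hwM φ hφi).trans ?_
    have h0 : 0 ≤ ∫ x in Ω, |g x - φ x| := integral_nonneg fun x => abs_nonneg _
    calc _ ≤ ε / 4 / (|M| + 1) * (|M| + 1) := by
          refine mul_le_mul_of_nonneg hφg ?_ h0 (by positivity)
          linarith [le_abs_self M]
      _ = ε / 4 := by field_simp
  filter_upwards [hv, (Metric.tendsto_nhds.1 (hweak φ hφ hφc hφs)) (ε / 4) (by positivity)]
    with s hs1 hs2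
  have h1 := hsm (v s) hs1.1 hs1.2
  have h2 := hsm v₀ hv₀ hM₀
  rw [Real.dist_eq] at hs2 ⊢
  rw [abs_le] at h1 h2
  rw [abs_lt] at hs2 ⊢
  constructor <;> linarith [h1.1, h1.2, h2.1, h2.2, hs2.1, hs2.2]

/-- Lower semicontinuity of the `L¹` norm along a weakly convergent bounded family. -/
theorem setIntegral_abs_le_of_tendsto {Ω : Set E} (hΩ : IsOpen Ω)
    (hΩb : Bornology.IsBounded Ω) {ι : Type*} {l : Filter ι} [l.NeBot] {v : ι → E → ℝ} {v₀ : E → ℝ}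
    {M m : ℝ}
    (hv : ∀ᶠ s in l, AEStronglyMeasurable (v s) (volume.restrict Ω) ∧ ∀ x ∈ Ω, |v s x| ≤ M)
    (hv₀ : AEStronglyMeasurable v₀ (volume.restrict Ω)) (hM₀ : ∀ x ∈ Ω, |v₀ x| ≤ M)
    (hweak : ∀ φ : E → ℝ, ContDiff ℝ 1 φ → HasCompactSupport φ → tsupport φ ⊆ Ω →
      Tendsto (fun s => ∫ x in Ω, φ x * v s x) l (𝓝 (∫ x in Ω, φ x * v₀ x)))
    (hm : ∀ᶠ s in l, ∫ x in Ω, |v s x| ≤ m) : ∫ x in Ω, |v₀ x| ≤ m := by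
  have hfin : Fact (volume Ω < ⊤) := ⟨hΩb.measure_lt_top⟩
  -- test with the sign of a measurable representative of the limit
  set w := hv₀.mk v₀ with hw
  have hwm : StronglyMeasurable w := hv₀.stronglyMeasurable_mk
  let g : E → ℝ := fun x => if 0 ≤ w x then 1 else -1
  have hgm : Measurable g :=
    Measurable.ite (measurableSet_le measurable_const hwm.measurable) measurable_const
      measurable_const
  have hg1 : ∀ x, |g x| = 1 := fun x => by
    by_cases h : 0 ≤ w x <;> simp [g, h]
  have hgi : IntegrableOn g Ω := Integrable.of_bound hgm.aestronglyMeasurable 1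
    (Eventually.of_forall fun x => (hg1 x).le)
  have hlim := tendsto_setIntegral_mul_of_bounded hΩ hΩb hv hv₀ hM₀ hweak hgi
  have heq : ∫ x in Ω, g x * v₀ x = ∫ x in Ω, |v₀ x| := by
    refine integral_congr_ae ?_
    filter_upwards [hv₀.ae_eq_mk] with x hx
    by_cases h : 0 ≤ w x
    · have : 0 ≤ v₀ x := by rw [hx]; exact h
      simp [g, h, abs_of_nonneg this]
    · have : v₀ x ≤ 0 := by rw [hx]; exact (not_le.1 h).le
      simp [g, h, abs_of_nonpos this]
  rw [heq] at hlim
  refine le_of_tendsto hlim ?_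
  filter_upwards [hv, hm] with s hs hsm
  refine le_trans ?_ hsm
  refine (le_abs_self _).trans ?_
  rw [← Real.norm_eq_abs]
  refine norm_integral_le_of_norm_le ?_ (Eventually.of_forall fun x => ?_)
  · refine Integrable.of_bound hs.1.norm M ?_
    filter_upwards [ae_restrict_mem hΩ.measurableSet] with x hx
    simpa using hs.2 x hx
  · rw [norm_mul, Real.norm_eq_abs, hg1, one_mul, Real.norm_eq_abs]

/-- A continuous weak limit of functions bounded by `M` is bounded by `M`. -/
theorem abs_le_of_tendsto_weak {Ω : Set E} (hΩ : IsOpen Ω) {ι : Type*} {l : Filter ι} [l.NeBot]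
    {v : ι → E → ℝ} {v₀ : E → ℝ} {M : ℝ}
    (hM : ∀ᶠ s in l, ∀ x ∈ Ω, |v s x| ≤ M) (hv₀ : ContinuousOn v₀ Ω)
    (hweak : ∀ φ : E → ℝ, ContDiff ℝ 1 φ → HasCompactSupport φ → tsupport φ ⊆ Ω →
      Tendsto (fun s => ∫ x in Ω, φ x * v s x) l (𝓝 (∫ x in Ω, φ x * v₀ x))) :
    ∀ x ∈ Ω, |v₀ x| ≤ M := by
  intro x hx
  obtain ⟨C, hC, hmol⟩ := exists_isMollifier E
  refine le_of_forall_pos_le_add fun ε hε => ?_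
  obtain ⟨δ₁, hδ₁, hball⟩ := Metric.isOpen_iff.1 hΩ x hx
  obtain ⟨δ₂, hδ₂, hosc⟩ := Metric.continuousAt_iff.1 (hv₀.continuousAt (hΩ.mem_nhds hx)) ε hε
  set δ := min (δ₁ / 2) (δ₂ / 2) with hδdef
  have hδ : 0 < δ := lt_min (half_pos hδ₁) (half_pos hδ₂)
  obtain ⟨ρ, h⟩ := hmol δ hδ
  have hsub : Metric.closedBall x δ ⊆ Ω := fun y hy => hball (by
    rw [Metric.mem_ball]
    have := Metric.mem_closedBall.1 hy
    linarith [min_le_left (δ₁ / 2) (δ₂ / 2)])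
  have hout : ∀ y ∉ Metric.closedBall x δ, ρ (x - y) = 0 := by
    intro y hy
    refine h.eq_zero _ ?_
    rwa [Metric.mem_closedBall, dist_comm, dist_eq_norm, not_le] at hy
  have hsupp : tsupport (fun y => ρ (x - y)) ⊆ Metric.closedBall x δ :=
    closure_minimal (fun y hy => by_contra fun hc => hy (hout y hc)) Metric.isClosed_closedBall
  have hlim := hweak (fun y => ρ (x - y)) (h.contDiff.comp (contDiff_const.sub contDiff_id))
    (h.hasCompactSupport_sub x) (hsupp.trans hsub)
  have hto : ∀ w : E → ℝ, ∫ y in Ω, ρ (x - y) * w y = mollify ρ w x := fun w =>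
    setIntegral_eq_integral_of_forall_compl_eq_zero fun y hy => by
      rw [hout y fun hc => hy (hsub hc), zero_mul]
  have h1 : |∫ y in Ω, ρ (x - y) * v₀ y| ≤ M := by
    refine le_of_tendsto hlim.abs ?_
    filter_upwards [hM] with s hs
    have e : ∫ y in Ω, ρ (x - y) * v s y = mollify ρ (Ω.indicator (v s)) x := by
      rw [← hto]
      refine setIntegral_congr_fun hΩ.measurableSet fun y hy => ?_
      simp only [indicator_of_mem hy]
    rw [e]
    refine (Real.norm_eq_abs _).symm.le.trans (h.norm_mollify_le (fun y => ?_) x)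
    by_cases hy : y ∈ Ω
    · rw [indicator_of_mem hy]; exact hs y hy
    · rw [indicator_of_notMem hy, norm_zero]; exact (abs_nonneg _).trans (hs x hx)
  rw [hto] at h1
  have hint : Integrable fun y => ρ (x - y) • v₀ y := by
    have : IntegrableOn (fun y => ρ (x - y) • v₀ y) (Metric.closedBall x δ) :=
      ((h.contDiff.continuous.comp (continuous_const.sub continuous_id)).continuousOn.smul
        (hv₀.mono hsub)).integrableOn_compact (isCompact_closedBall x δ)
    refine (integrableOn_iff_integrable_of_support_subset fun y hy => ?_).1 this
    exact by_contra fun hc => hy (by simp [hout y hc])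
  have h2 : ‖mollify ρ v₀ x - v₀ x‖ ≤ ε := h.norm_mollify_sub_le_of_integrable hint fun y hy => by
    refine (hosc ?_).le
    rw [dist_comm, dist_eq_norm]
    linarith [min_le_right (δ₁ / 2) (δ₂ / 2)]
  rw [Real.norm_eq_abs] at h2
  rw [abs_le] at h1 h2 ⊢
  constructor <;> linarith [h1.1, h1.2, h2.1, h2.2]

end WeakConvergence


/-! ### Time regularity of differences of mollifications -/

section InitialTime

variable {E : Type*} [NormedAddCommGroup E] [InnerProductSpace ℝ E] [FiniteDimensional ℝ E]
  [MeasurableSpace E] [BorelSpace E] {Ω : Set E} {a b M B : ℝ} {L : NNReal} {u : ℝ → E → ℝ}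
  {V : ℝ → E → E} {C δ : ℝ} {ρ : E → ℝ}

/-- A Lipschitz field has bounded divergence in the sense of distributions. -/
theorem abs_integral_fderiv_le_of_lipschitz
    (hmol : ∀ δ : ℝ, 0 < δ → ∃ ρ : E → ℝ, IsMollifier C δ ρ) {ψ : E → ℝ}
    (hψ : ContDiff ℝ 1 ψ) (hψc : HasCompactSupport ψ) {V : E → E} (hV : LipschitzWith L V) :
    |∫ x, fderiv ℝ ψ x (V x)| ≤ L * C * ∫ x, |ψ x| := by
  have hL : (0 : ℝ) ≤ L := L.2
  have hψ1 := hψ.continuous_fderiv one_ne_zero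
  have hψ1c : ∀ {Z : E → E}, Continuous Z → Integrable fun x => fderiv ℝ ψ x (Z x) := by
    intro Z hZ
    refine (hψ1.clm_apply hZ).integrable_of_hasCompactSupport ?_
    exact (hψc.fderiv ℝ).mono fun x hx hc => hx (by simp [hc])
  have hψn : Integrable fun x => ‖fderiv ℝ ψ x‖ :=
    (hψ1.integrable_of_hasCompactSupport (hψc.fderiv ℝ)).norm
  have hψi : Integrable fun x => |ψ x| :=
    (hψ.continuous.integrable_of_hasCompactSupport hψc).abs
  set J := ∫ x, ‖fderiv ℝ ψ x‖ with hJ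
  have hJ0 : 0 ≤ J := integral_nonneg fun x => norm_nonneg _
  refine le_of_forall_pos_le_add fun ε hε => ?_
  set δ := ε / (L * J + 1) with hδdef
  have hδ : 0 < δ := by positivity
  obtain ⟨ρ, h⟩ := hmol δ hδ
  have h1 := h.integral_mul_mollDiv hψ hψc hV.continuous
  have h2 : ∫ x, fderiv ℝ ψ x (V x) = (∫ x, fderiv ℝ ψ x (V x - mollify ρ V x))
      - ∫ x, ψ x * mollDiv ρ V x := by
    have i1 : Integrable fun x => fderiv ℝ ψ x (V x - mollify ρ V x) :=
      hψ1c (hV.continuous.sub (h.continuous_mollify hV.continuous))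
    rw [h1, sub_neg_eq_add, ← integral_add i1 (hψ1c (h.continuous_mollify hV.continuous))]
    simp
  have h3 : |∫ x, fderiv ℝ ψ x (V x - mollify ρ V x)| ≤ J * (L * δ) := by
    rw [hJ, ← integral_mul_const, ← Real.norm_eq_abs]
    refine norm_integral_le_of_norm_le (hψn.mul_const _) (Eventually.of_forall fun x => ?_)
    refine ((fderiv ℝ ψ x).le_opNorm _).trans (mul_le_mul_of_nonneg_left ?_ (norm_nonneg _))
    rw [norm_sub_rev]; exact h.norm_mollify_sub_le_of_lipschitz hV x
  have h4 : |∫ x, ψ x * mollDiv ρ V x| ≤ L * C * ∫ x, |ψ x| := by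
    rw [← integral_const_mul, ← Real.norm_eq_abs]
    refine norm_integral_le_of_norm_le (hψi.const_mul _) (Eventually.of_forall fun x => ?_)
    rw [norm_mul, mul_comm]
    exact mul_le_mul_of_nonneg_right (h.abs_mollDiv_le_of_lipschitz hδ hV x) (norm_nonneg _)
  have h5 : J * (L * δ) ≤ ε := by
    rw [hδdef, ← mul_assoc, ← mul_div_assoc, div_le_iff₀ (by positivity)]
    nlinarith
  rw [h2]
  refine (abs_sub _ _).trans ?_
  linarith

/-- The linear equation for the positive part, tested with a translate of the mollifier. -/
theorem IsMollifier.hasDerivAt_mollify_posPart (h : IsMollifier C δ ρ)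
    (hu : IsTransportSolution Ω a b M B L u V) (x : E) {t : ℝ} (ht : t ∈ Ioo a b) :
    HasDerivAt (fun τ => mollify ρ (fun y => max (u τ y) 0) x)
      (mollDiv ρ (fun y => max (u t y) 0 • V t y) x) t := by
  have h1 := hu.hasDerivAt_integral_posPart (φ := fun y => ρ (x - y))
    (h.contDiff.comp (contDiff_const.sub contDiff_id)) ht
  have h2 : ∀ y v, fderiv ℝ (fun y => ρ (x - y)) y v = -fderiv ℝ ρ (x - y) v := by
    intro y v
    have h3 : HasFDerivAt (fun y => ρ (x - y)) _ y :=
      (h.contDiff.differentiable one_ne_zero (x - y)).hasFDerivAt.comp y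
        ((hasFDerivAt_id y).const_sub x)
    rw [h3.fderiv]
    simp
  convert! h1 using 1
  simp only [h2, mollDiv, map_smul, smul_eq_mul, mul_neg, integral_neg, neg_neg]

theorem IsMollifier.mollify_eq_zero (h : IsMollifier C δ ρ) {w : E → ℝ} (hw : ∀ x ∉ Ω, w x = 0)
    {x : E} (hx : x ∉ Metric.cthickening δ Ω) : mollify ρ w x = 0 := by
  refine integral_eq_zero_of_ae (Eventually.of_forall fun y => ?_)
  by_cases hy : y ∈ Ω
  · have : δ < ‖x - y‖ := by
      by_contra hc
      refine hx (Metric.mem_cthickening_of_dist_le x y _ _ hy ?_)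
      rw [dist_eq_norm]; exact not_lt.1 hc
    simp [h.eq_zero _ this]
  · simp [hw y hy]

/-- The difference of two mollifications of the positive part satisfies the transport equation up
to a bounded error, so that its `L²` norm varies at a bounded rate, independently of the scales. -/
theorem IsTransportSolution.abs_integral_sq_sub_le (hu : IsTransportSolution Ω a b M B L u V)
    (hC : 0 ≤ C) (hmol : ∀ δ : ℝ, 0 < δ → ∃ ρ : E → ℝ, IsMollifier C δ ρ)
    {δ₁ δ₂ : ℝ} {ρ₁ ρ₂ : E → ℝ} (h₁ : IsMollifier C δ₁ ρ₁) (h₂ : IsMollifier C δ₂ ρ₂)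
    (hδ₁ : 0 < δ₁) (hδ₂ : 0 < δ₂) (hδ₁1 : δ₁ ≤ 1) (hδ₂1 : δ₂ ≤ 1) (hM : 0 ≤ M)
    {s t : ℝ} (hs : s ∈ Ioo a b) (ht : t ∈ Ioo a b) :
    |(∫ x, (mollify ρ₁ (fun y => max (u t y) 0) x - mollify ρ₂ (fun y => max (u t y) 0) x) ^ 2)
      - ∫ x, (mollify ρ₁ (fun y => max (u s y) 0) x - mollify ρ₂ (fun y => max (u s y) 0) x) ^ 2|
      ≤ 9 * M ^ 2 * L * C * volume.real (Metric.cthickening 1 Ω) * |t - s| := by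
  set Ω' := Metric.cthickening 1 Ω with hΩ'
  have hΩ'b : Bornology.IsBounded Ω' := hu.isBounded.cthickening
  have hL : (0 : ℝ) ≤ L := L.2
  set W : ℝ → E → ℝ := fun τ y => max (u τ y) 0 with hW
  have hWc : ∀ τ ∈ Ioo a b, Continuous (W τ) := fun τ hτ => (hu.continuous hτ).max continuous_const
  have hW0 : ∀ τ ∈ Ioo a b, ∀ x ∉ Ω, W τ x = 0 := fun τ hτ x hx => by
    simp [hW, hu.eq_zero τ hτ x hx]
  have hWM : ∀ τ ∈ Ioo a b, ∀ x, |W τ x| ≤ M := fun τ hτ x => by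
    rw [abs_of_nonneg (le_max_right _ _)]
    exact max_le ((le_abs_self _).trans (hu.abs_le τ hτ x)) hM
  have hWosc : ∀ τ ∈ Ioo a b, ∀ x y, |W τ y - W τ x| ≤ M := fun τ hτ x y => by
    have h1 := hWM τ hτ x
    have h2 := hWM τ hτ y
    rw [abs_of_nonneg (le_max_right _ _)] at h1 h2
    have h3 : 0 ≤ W τ x := le_max_right _ _
    have h4 : 0 ≤ W τ y := le_max_right _ _
    rw [_root_.abs_le]; constructor <;> linarith
  have hVc : ∀ τ ∈ Ioo a b, Continuous fun y => W τ y • V τ y := fun τ hτ =>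
    (hWc τ hτ).smul (hu.lipschitzWith τ hτ).continuous
  let d : ℝ → E → ℝ := fun τ x => mollify ρ₁ (W τ) x - mollify ρ₂ (W τ) x
  let q : ℝ → E → ℝ := fun τ x =>
    mollDiv ρ₁ (fun y => W τ y • V τ y) x - mollDiv ρ₂ (fun y => W τ y • V τ y) x
  have hd1 : ∀ τ ∈ Ioo a b, ContDiff ℝ 1 (d τ) := fun τ hτ =>
    (h₁.contDiff_mollify (hWc τ hτ)).sub (h₂.contDiff_mollify (hWc τ hτ))
  have hd0 : ∀ τ ∈ Ioo a b, ∀ x ∉ Ω', d τ x = 0 := fun τ hτ x hx => by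
    simp only [d]
    rw [h₁.mollify_eq_zero (hW0 τ hτ) fun hc => hx (Metric.cthickening_mono hδ₁1 _ hc),
      h₂.mollify_eq_zero (hW0 τ hτ) fun hc => hx (Metric.cthickening_mono hδ₂1 _ hc), sub_zero]
  have hdM : ∀ τ ∈ Ioo a b, ∀ x, |d τ x| ≤ M := fun τ hτ x => by
    have hnn : ∀ {δ : ℝ} {ρ : E → ℝ}, IsMollifier C δ ρ → 0 ≤ mollify ρ (W τ) x := fun h =>
      integral_nonneg fun y => mul_nonneg (h.nonneg _) (le_max_right _ _)
    have hle : ∀ {δ : ℝ} {ρ : E → ℝ}, IsMollifier C δ ρ → mollify ρ (W τ) x ≤ M := by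
      intro δ ρ h
      have : ‖mollify ρ (W τ) x‖ ≤ M := h.norm_mollify_le (hWM τ hτ) x
      exact (le_abs_self _).trans this
    have a1 := hnn h₁
    have a2 := hnn h₂
    have a3 := hle h₁
    have a4 := hle h₂
    rw [_root_.abs_le]; constructor <;> simp only [d] <;> linarith
  have hqc : ∀ τ ∈ Ioo a b, Continuous (q τ) := fun τ hτ =>
    (h₁.continuous_mollDiv (hVc τ hτ)).sub (h₂.continuous_mollDiv (hVc τ hτ))
  -- transport equation for `d` with a bounded error
  have herr : ∀ τ ∈ Ioo a b, ∀ x, |q τ x - fderiv ℝ (d τ) x (V τ x)| ≤ 4 * M * L * C := by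
    intro τ hτ x
    have key : ∀ {δ : ℝ} {ρ : E → ℝ}, 0 < δ → IsMollifier C δ ρ →
        |mollDiv ρ (fun y => W τ y • V τ y) x - fderiv ℝ (mollify ρ (W τ)) x (V τ x)|
          ≤ 2 * M * L * C := by
      intro δ ρ hδ h
      have k1 := h.abs_commutator_le hδ (hWc τ hτ) (hu.lipschitzWith τ hτ)
        (fun y _ => hWosc τ hτ x y)
      have k2 : |W τ x * mollDiv ρ (V τ) x| ≤ M * (L * C) := by
        rw [abs_mul]
        exact mul_le_mul (hWM τ hτ x) (h.abs_mollDiv_le_of_lipschitz hδ (hu.lipschitzWith τ hτ) x)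
          (abs_nonneg _) hM
      have := abs_add_le (mollDiv ρ (fun y => W τ y • V τ y) x
        - fderiv ℝ (mollify ρ (W τ)) x (V τ x) - W τ x * mollDiv ρ (V τ) x)
        (W τ x * mollDiv ρ (V τ) x)
      rw [sub_add_cancel] at this
      linarith
    have e : fderiv ℝ (d τ) x (V τ x) = fderiv ℝ (mollify ρ₁ (W τ)) x (V τ x)
        - fderiv ℝ (mollify ρ₂ (W τ)) x (V τ x) := by
      have : fderiv ℝ (d τ) x = fderiv ℝ (mollify ρ₁ (W τ)) x - fderiv ℝ (mollify ρ₂ (W τ)) x :=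
        fderiv_fun_sub ((h₁.contDiff_mollify (hWc τ hτ)).differentiable one_ne_zero x)
          ((h₂.contDiff_mollify (hWc τ hτ)).differentiable one_ne_zero x)
      rw [this]; rfl
    have k1 := key hδ₁ h₁
    have k2 := key hδ₂ h₂
    rw [_root_.abs_le] at k1 k2 ⊢
    simp only [q, e]
    constructor <;> linarith [k1.1, k1.2, k2.1, k2.2]
  have hdd : ∀ τ ∈ Ioo a b, ∀ x, HasDerivAt (fun σ => d σ x ^ 2) (2 * d τ x * q τ x) τ := by
    intro τ hτ x
    have := ((h₁.hasDerivAt_mollify_posPart hu x hτ).sub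
      (h₂.hasDerivAt_mollify_posPart hu x hτ)).pow 2
    convert! this using 1
    simp [d, q, hW]
  have hB0 : ∀ τ ∈ Ioo a b, ∀ y, ‖W τ y • V τ y‖ ≤ M * |B| := by
    intro τ hτ y
    by_cases hy : y ∈ Ω
    · rw [norm_smul]
      exact mul_le_mul (hWM τ hτ y) ((hu.norm_le τ hτ y hy).trans (le_abs_self _))
        (norm_nonneg _) hM
    · rw [hW0 τ hτ y hy, zero_smul, norm_zero]; positivity
  have hderiv : ∀ τ ∈ Ioo a b,
      HasDerivAt (fun σ => ∫ x, d σ x ^ 2) (∫ x, 2 * d τ x * q τ x) τ := by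
    intro τ hτ
    refine (hasDerivAt_integral_of_dominated_loc_of_deriv_le
      (F := fun σ x => d σ x ^ 2) (F' := fun σ x => 2 * d σ x * q σ x)
      (bound := fun x => Ω'.indicator
        (fun _ => 2 * M * (M * |B| * (C / δ₁) + M * |B| * (C / δ₂))) x)
      (isOpen_Ioo.mem_nhds hτ) ?_ ?_ ?_ ?_ ?_ ?_).2
    · filter_upwards [isOpen_Ioo.mem_nhds hτ] with σ hσ
      exact ((hd1 σ hσ).continuous.pow 2).aestronglyMeasurable
    · refine ((hd1 τ hτ).continuous.pow 2).integrable_of_hasCompactSupport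
        (hasCompactSupport_of_bounded hΩ'b fun x hx => ?_)
      rw [Pi.pow_apply, hd0 τ hτ x hx]; simp
    · exact (((continuous_const.mul (hd1 τ hτ).continuous)).mul (hqc τ hτ)).aestronglyMeasurable
    · refine Eventually.of_forall fun x σ hσ => ?_
      by_cases hx : x ∈ Ω'
      · rw [indicator_of_mem hx, norm_mul, norm_mul, Real.norm_of_nonneg zero_le_two]
        refine mul_le_mul (mul_le_mul_of_nonneg_left (hdM σ hσ x) zero_le_two) ?_
          (norm_nonneg _) (by positivity)
        refine (norm_sub_le _ _).trans (add_le_add ?_ ?_)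
        · exact h₁.abs_mollDiv_le fun y _ => hB0 σ hσ y
        · exact h₂.abs_mollDiv_le fun y _ => hB0 σ hσ y
      · rw [indicator_of_notMem hx, hd0 σ hσ x hx]; simp
    · rw [integrable_indicator_iff Metric.isClosed_cthickening.measurableSet]
      exact integrableOn_const hΩ'b.measure_lt_top.ne
    · exact Eventually.of_forall fun x σ hσ => hdd σ hσ x
  have hbound : ∀ τ ∈ Ioo a b, ‖∫ x, 2 * d τ x * q τ x‖ ≤ 9 * M ^ 2 * L * C * volume.real Ω' := by
    intro τ hτ
    have hV := hu.lipschitzWith τ hτ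
    have hd2 : ContDiff ℝ 1 fun x => d τ x ^ 2 := (hd1 τ hτ).pow 2
    have hd2c : HasCompactSupport fun x => d τ x ^ 2 :=
      hasCompactSupport_of_bounded hΩ'b fun x hx => by rw [hd0 τ hτ x hx]; simp
    have e1 : ∀ x, fderiv ℝ (fun x => d τ x ^ 2) x (V τ x)
        = 2 * d τ x * fderiv ℝ (d τ) x (V τ x) := by
      intro x
      have : HasFDerivAt (fun x => d τ x ^ 2) _ x :=
        ((hd1 τ hτ).differentiable one_ne_zero x).hasFDerivAt.pow 2
      rw [this.fderiv]; simp
    have i1 : Integrable fun x => 2 * d τ x * fderiv ℝ (d τ) x (V τ x) := by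
      refine Continuous.integrable_of_hasCompactSupport
        ((continuous_const.mul (hd1 τ hτ).continuous).mul
          (((hd1 τ hτ).continuous_fderiv one_ne_zero).clm_apply hV.continuous))
        (hasCompactSupport_of_bounded hΩ'b fun x hx => by rw [hd0 τ hτ x hx]; simp)
    have i2 : Integrable fun x => 2 * d τ x * (q τ x - fderiv ℝ (d τ) x (V τ x)) := by
      refine Continuous.integrable_of_hasCompactSupport
        ((continuous_const.mul (hd1 τ hτ).continuous).mul ((hqc τ hτ).sub
          (((hd1 τ hτ).continuous_fderiv one_ne_zero).clm_apply hV.continuous)))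
        (hasCompactSupport_of_bounded hΩ'b fun x hx => by rw [hd0 τ hτ x hx]; simp)
    have e2 : ∫ x, 2 * d τ x * q τ x = (∫ x, fderiv ℝ (fun x => d τ x ^ 2) x (V τ x))
        + ∫ x, 2 * d τ x * (q τ x - fderiv ℝ (d τ) x (V τ x)) := by
      simp_rw [e1]
      rw [← integral_add i1 i2]
      refine integral_congr_ae (Eventually.of_forall fun x => ?_)
      simp only []; ring
    have b1 : |∫ x, fderiv ℝ (fun x => d τ x ^ 2) x (V τ x)|
        ≤ L * C * (M ^ 2 * volume.real Ω') := by
      refine (abs_integral_fderiv_le_of_lipschitz hmol hd2 hd2c hV).trans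
        (mul_le_mul_of_nonneg_left ?_ (mul_nonneg hL hC))
      refine (le_abs_self _).trans (abs_integral_le_of_bounded hΩ'b (fun x hx => ?_) fun x _ => ?_)
      · rw [hd0 τ hτ x hx]; simp
      · rw [abs_abs, abs_pow]
        exact pow_le_pow_left₀ (abs_nonneg _) (hdM τ hτ x) 2
    have b2 : |∫ x, 2 * d τ x * (q τ x - fderiv ℝ (d τ) x (V τ x))|
        ≤ 2 * M * (4 * M * L * C) * volume.real Ω' := by
      refine abs_integral_le_of_bounded hΩ'b (fun x hx => ?_) fun x _ => ?_
      · rw [hd0 τ hτ x hx]; simp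
      · rw [abs_mul, abs_mul, abs_of_nonneg (zero_le_two (α := ℝ))]
        exact mul_le_mul (mul_le_mul_of_nonneg_left (hdM τ hτ x) zero_le_two) (herr τ hτ x)
          (abs_nonneg _) (by positivity)
    rw [e2, Real.norm_eq_abs]
    refine (abs_add_le _ _).trans ((add_le_add b1 b2).trans (le_of_eq ?_))
    ring
  exact (convex_Ioo a b).norm_image_sub_le_of_norm_hasDerivWithin_le
    (fun τ hτ => (hderiv τ hτ).hasDerivWithinAt) hbound hs ht

end InitialTime


/-! ### Strong convergence at the initial time -/

section StrongConvergence

variable {E : Type*} [NormedAddCommGroup E] [InnerProductSpace ℝ E] [FiniteDimensional ℝ E]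
  [MeasurableSpace E] [BorelSpace E] {Ω : Set E} {M B : ℝ} {L : NNReal} {u : ℝ → E → ℝ}
  {V : ℝ → E → E} {C δ : ℝ} {ρ : E → ℝ}

theorem tendsto_mollify {κ : ℕ → ℝ} {r : ℕ → E → ℝ} (hκ : Tendsto κ atTop (𝓝 0))
    (hr : ∀ k, IsMollifier C (κ k) (r k)) {w : E → ℝ} (hw : Continuous w) (x : E) :
    Tendsto (fun k => mollify (r k) w x) atTop (𝓝 (w x)) := by
  rw [Metric.tendsto_nhds]
  intro ε hε
  obtain ⟨η, hη, h⟩ := Metric.continuous_iff.1 hw x (ε / 2) (half_pos hε)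
  filter_upwards [hκ.eventually_lt_const hη] with k hk
  rw [dist_eq_norm]
  refine lt_of_le_of_lt ((hr k).norm_mollify_sub_le hw fun y hy => ?_) (half_lt_self hε)
  refine (h y ?_).le
  rw [dist_comm, dist_eq_norm]
  exact hy.trans_lt hk

/-- Mollification approximates the positive part in `L¹` uniformly in time up to the initial time,
although no equicontinuity is available there. -/
theorem IsTransportSolution.exists_forall_integral_abs_sub_mollify_le {T : ℝ} (hT : 0 < T)
    (hu : IsTransportSolution Ω 0 T M B L u V) (hC : 0 ≤ C)
    (hmol : ∀ δ : ℝ, 0 < δ → ∃ ρ : E → ℝ, IsMollifier C δ ρ) (hM : 0 ≤ M) {η : ℝ} (hη : 0 < η) :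
    ∃ t₀ ∈ Ioo 0 T, ∃ δ₀ > 0, ∀ δ ρ, 0 < δ → δ ≤ δ₀ → IsMollifier C δ ρ → ∀ s ∈ Ioc 0 t₀,
      ∫ x, |max (u s x) 0 - mollify ρ (fun y => max (u s y) 0) x| ≤ η := by
  set Ω' := Metric.cthickening 1 Ω with hΩ'
  have hΩ'b : Bornology.IsBounded Ω' := hu.isBounded.cthickening
  have hΩΩ' : Ω ⊆ Ω' := Metric.self_subset_cthickening Ω
  set v := volume.real Ω' with hv
  have hv0 : 0 ≤ v := measureReal_nonneg
  have hL : (0 : ℝ) ≤ L := L.2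
  set K := 9 * M ^ 2 * L * C * v with hK
  have hK0 : 0 ≤ K := by positivity
  -- `K` bounds the rate of the squared `L²` distance; `lam` and `ν` are chosen such that a squared
  -- distance at most `ν` forces an `L¹` distance at most `v * lam + ν / lam ≤ η`
  set lam := η / (2 * (v + 1)) with hlam
  have hlam0 : 0 < lam := by positivity
  set ν := lam * η / 2 with hν
  have hν0 : 0 < ν := by positivity
  set t₀ := min (T / 2) (ν / (2 * (K + 1))) with ht₀
  have ht₀0 : 0 < t₀ := lt_min (half_pos hT) (by positivity)
  have ht₀T : t₀ < T := (min_le_left _ _).trans_lt (half_lt_self hT)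
  have hKt : K * t₀ ≤ ν / 2 := by
    have h1 : t₀ ≤ ν / (2 * (K + 1)) := min_le_right _ _
    rw [le_div_iff₀ (by positivity)] at h1
    nlinarith
  set m := min 1 (ν / (2 * (v + 1))) with hm
  have hm0 : 0 < m := lt_min one_pos (by positivity)
  have hmv : m ^ 2 * v ≤ ν / 2 := by
    have h1 : m ≤ ν / (2 * (v + 1)) := min_le_right _ _
    rw [le_div_iff₀ (by positivity)] at h1
    have h2 : m ^ 2 ≤ m := by nlinarith [min_le_left 1 (ν / (2 * (v + 1)))]
    nlinarith
  obtain ⟨δ₁, hδ₁, hmod⟩ := hu.exists_modulus (c := t₀) (d := t₀) ht₀0 ht₀T hm0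
  set W : ℝ → E → ℝ := fun τ y => max (u τ y) 0 with hW
  have hWc : ∀ τ ∈ Ioo 0 T, Continuous (W τ) := fun τ hτ => (hu.continuous hτ).max continuous_const
  have hW0 : ∀ τ ∈ Ioo 0 T, ∀ x ∉ Ω, W τ x = 0 := fun τ hτ x hx => by
    simp [hW, hu.eq_zero τ hτ x hx]
  have hWM : ∀ τ ∈ Ioo 0 T, ∀ x, |W τ x| ≤ M := fun τ hτ x => by
    rw [abs_of_nonneg (le_max_right _ _)]
    exact max_le ((le_abs_self _).trans (hu.abs_le τ hτ x)) hM
  refine ⟨t₀, ⟨ht₀0, ht₀T⟩, min 1 δ₁, lt_min one_pos hδ₁, fun δ ρ hδ hδle h s hs => ?_⟩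
  have hδ1 : δ ≤ 1 := hδle.trans (min_le_left _ _)
  have hsT : s ∈ Ioo 0 T := ⟨hs.1, hs.2.trans_lt ht₀T⟩
  have hd0 : ∀ {κ : ℝ} {r : E → ℝ}, IsMollifier C κ r → κ ≤ 1 → ∀ τ ∈ Ioo 0 T, ∀ x ∉ Ω',
      mollify r (W τ) x = 0 := fun h hκ τ hτ x hx =>
    h.mollify_eq_zero (hW0 τ hτ) fun hc => hx (Metric.cthickening_mono hκ _ hc)
  -- let the first scale tend to zero
  let κ : ℕ → ℝ := fun k => 1 / ((k : ℝ) + 1)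
  have hκ : ∀ k, 0 < κ k := fun k => Nat.one_div_pos_of_nat
  have hκ1 : ∀ k, κ k ≤ 1 := fun k => by
    simp only [κ]
    rw [div_le_one (by positivity)]
    have : (0 : ℝ) ≤ k := Nat.cast_nonneg k
    linarith
  have hκ0 : Tendsto κ atTop (𝓝 0) := tendsto_one_div_add_atTop_nhds_zero_nat
  choose r hr using fun k => hmol (κ k) (hκ k)
  have hlim : ∀ τ ∈ Ioo 0 T, Tendsto (fun k => ∫ x, (mollify (r k) (W τ) x - mollify ρ (W τ) x) ^ 2)
      atTop (𝓝 (∫ x, (W τ x - mollify ρ (W τ) x) ^ 2)) := by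
    intro τ hτ
    refine tendsto_integral_of_dominated_convergence
      (fun x => Ω'.indicator (fun _ => (M + M) ^ 2) x) ?_ ?_ ?_ ?_
    · exact fun k => ((((hr k).contDiff_mollify (hWc τ hτ)).continuous.sub
        (h.contDiff_mollify (hWc τ hτ)).continuous).pow 2).aestronglyMeasurable
    · rw [integrable_indicator_iff Metric.isClosed_cthickening.measurableSet]
      exact integrableOn_const hΩ'b.measure_lt_top.ne
    · refine fun k => Eventually.of_forall fun x => ?_
      by_cases hx : x ∈ Ω'
      · rw [indicator_of_mem hx, norm_pow]
        exact pow_le_pow_left₀ (norm_nonneg _) ((norm_sub_le _ _).trans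
          (add_le_add ((hr k).norm_mollify_le (hWM τ hτ) x) (h.norm_mollify_le (hWM τ hτ) x))) 2
      · rw [indicator_of_notMem hx, hd0 (hr k) (hκ1 k) τ hτ x hx, hd0 h hδ1 τ hτ x hx]; simp
    · exact Eventually.of_forall fun x =>
        ((tendsto_mollify hκ0 hr (hWc τ hτ) x).sub_const _).pow 2
  have hcmp : |(∫ x, (W s x - mollify ρ (W s) x) ^ 2)
      - ∫ x, (W t₀ x - mollify ρ (W t₀) x) ^ 2| ≤ K * |s - t₀| := by
    refine le_of_tendsto ((hlim s hsT).sub (hlim t₀ ⟨ht₀0, ht₀T⟩)).abs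
      (Eventually.of_forall fun k => ?_)
    exact hu.abs_integral_sq_sub_le hC hmol (hr k) h (hκ k) hδ (hκ1 k) hδ1 hM ⟨ht₀0, ht₀T⟩ hsT
  have hst : |s - t₀| ≤ t₀ := by rw [_root_.abs_le]; constructor <;> linarith [hs.1, hs.2]
  have hout : ∀ τ ∈ Ioo 0 T, ∀ x ∉ Ω', W τ x - mollify ρ (W τ) x = 0 := fun τ hτ x hx => by
    rw [hW0 τ hτ x fun hc => hx (hΩΩ' hc), hd0 h hδ1 τ hτ x hx, sub_zero]
  have ht₀le : ∫ x, (W t₀ x - mollify ρ (W t₀) x) ^ 2 ≤ ν / 2 := by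
    refine (le_abs_self _).trans ((abs_integral_le_of_bounded hΩ'b (c := m ^ 2) (fun x hx => ?_)
      fun x _ => ?_).trans hmv)
    · rw [hout t₀ ⟨ht₀0, ht₀T⟩ x hx]; simp
    · rw [abs_pow]
      refine pow_le_pow_left₀ (abs_nonneg _) ?_ 2
      rw [abs_sub_comm]
      refine h.norm_mollify_sub_le (hWc t₀ ⟨ht₀0, ht₀T⟩) fun y hy => ?_
      refine (abs_max_sub_max_le_abs _ _ _).trans (hmod t₀ ⟨le_rfl, le_rfl⟩ x y ?_)
      exact hy.trans (hδle.trans (min_le_right _ _))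
  have hsq : ∫ x, (W s x - mollify ρ (W s) x) ^ 2 ≤ ν := by
    have h1 := (_root_.abs_le.1 hcmp).2
    have h2 : K * |s - t₀| ≤ K * t₀ := mul_le_mul_of_nonneg_left hst hK0
    linarith
  have hfc : Continuous fun x => W s x - mollify ρ (W s) x :=
    (hWc s hsT).sub (h.contDiff_mollify (hWc s hsT)).continuous
  have i1 : Integrable fun x => (W s x - mollify ρ (W s) x) ^ 2 / lam :=
    ((hfc.pow 2).div_const _).integrable_of_hasCompactSupport
      (hasCompactSupport_of_bounded hΩ'b fun x hx => by
        rw [Pi.pow_apply, hout s hsT x hx]; simp)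
  have i2 : Integrable fun x => Ω'.indicator (fun _ => lam) x := by
    rw [integrable_indicator_iff Metric.isClosed_cthickening.measurableSet]
    exact integrableOn_const hΩ'b.measure_lt_top.ne
  -- `|r| ≤ lam + r² / lam` on a set of finite measure
  calc ∫ x, |W s x - mollify ρ (W s) x|
      ≤ ∫ x, (Ω'.indicator (fun _ => lam) x + (W s x - mollify ρ (W s) x) ^ 2 / lam) := by
        refine integral_mono_of_nonneg (Eventually.of_forall fun x => abs_nonneg _) (i2.add i1)
          (Eventually.of_forall fun x => ?_)
        by_cases hx : x ∈ Ω'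
        · simp only [indicator_of_mem hx]
          rw [← sub_le_iff_le_add', le_div_iff₀ hlam0, ← sq_abs (W s x - _)]
          nlinarith [sq_nonneg (|W s x - mollify ρ (W s) x| - lam),
            mul_nonneg hlam0.le (abs_nonneg (W s x - mollify ρ (W s) x))]
        · simp [indicator_of_notMem hx, hout s hsT x hx]
    _ = v * lam + (∫ x, (W s x - mollify ρ (W s) x) ^ 2) / lam := by
        rw [integral_add i2 i1, integral_div,
          integral_indicator_const _ Metric.isClosed_cthickening.measurableSet, smul_eq_mul]
    _ ≤ η / 2 + η / 2 := by
        refine add_le_add ?_ ?_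
        · rw [hlam, ← mul_div_assoc, div_le_iff₀ (by positivity)]
          nlinarith
        · rw [div_le_iff₀ hlam0]; rw [hν] at hsq; linarith
    _ = η := by ring

theorem IsMollifier.integral_abs_mollify_le {C δ : ℝ} {ρ : E → ℝ} (h : IsMollifier C δ ρ)
    {w : E → ℝ} (hw : Integrable w) : ∫ x, |mollify ρ w x| ≤ ∫ x, |w x| := by
  have hρ : Integrable ρ := h.contDiff.continuous.integrable_of_hasCompactSupport
    h.hasCompactSupport
  have e : mollify ρ (fun y => |w y|)
      = convolution (fun y => |w y|) ρ (ContinuousLinearMap.mul ℝ ℝ) volume := by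
    ext x; simp [mollify, convolution, mul_comm]
  have hi : Integrable (mollify ρ fun y => |w y|) := by
    rw [e]; exact hw.abs.integrable_convolution _ hρ
  have h1 : ∫ x, mollify ρ (fun y => |w y|) x = ∫ x, |w x| := by
    rw [e, integral_convolution _ hw.abs hρ, h.integral_eq_one]; simp
  rw [← h1]
  refine integral_mono_of_nonneg (Eventually.of_forall fun x => abs_nonneg _) hi
    (Eventually.of_forall fun x => ?_)
  change |∫ y, ρ (x - y) * w y| ≤ ∫ y, ρ (x - y) * |w y|
  refine (abs_integral_le_integral_abs).trans (le_of_eq ?_)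
  refine integral_congr_ae (Eventually.of_forall fun y => ?_)
  simp [abs_mul, abs_of_nonneg (h.nonneg (x - y))]

/-- No mass is lost at the initial time: mollification changes `u t` little in `L¹`, uniformly for
small `t`, it turns weak into pointwise convergence as `t → 0`, and it does not increase the `L¹`
norm of `u₀`. -/
theorem IsTransportSolution.le_setIntegral_abs_initial {T : ℝ} (hT : 0 < T)
    (hu : IsTransportSolution Ω 0 T M B L u V) (hΩ : IsOpen Ω) {u₀ : E → ℝ}
    (hu₀ : AEStronglyMeasurable u₀ (volume.restrict Ω)) (hM₀ : ∀ x ∈ Ω, |u₀ x| ≤ M)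
    (hweak : ∀ φ : E → ℝ, ContDiff ℝ 1 φ → HasCompactSupport φ → tsupport φ ⊆ Ω →
      Tendsto (fun t => ∫ x in Ω, φ x * u t x) (𝓝[>] 0) (𝓝 (∫ x in Ω, φ x * u₀ x)))
    {m : ℝ} (hm : ∀ t ∈ Ioo 0 T, m ≤ ∫ x in Ω, |u t x|) : m ≤ ∫ x in Ω, |u₀ x| := by
  have hIoo : ∀ t₀ ∈ Ioo 0 T, Ioc 0 t₀ ∈ 𝓝[>] (0 : ℝ) := fun t₀ ht₀ => Ioc_mem_nhdsGT ht₀.1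
  have hfin : Fact (volume Ω < ⊤) := ⟨hu.isBounded.measure_lt_top⟩
  have hu₀i : IntegrableOn u₀ Ω := by
    refine Integrable.of_bound hu₀ M ?_
    filter_upwards [ae_restrict_mem hΩ.measurableSet] with x hx using hM₀ x hx
  have hu₀I : Integrable (Ω.indicator u₀) := hu₀i.integrable_indicator hΩ.measurableSet
  obtain ⟨C, hC, hmol⟩ := exists_isMollifier E
  have hM : 0 ≤ M := (abs_nonneg _).trans (hu.abs_le (T / 2) ⟨by linarith, by linarith⟩ 0)
  refine le_of_forall_pos_le_add fun η hη => ?_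
  obtain ⟨t₁, ht₁, δ₁, hδ₁, h1⟩ :=
    hu.exists_forall_integral_abs_sub_mollify_le hT hC hmol hM (half_pos hη)
  obtain ⟨t₂, ht₂, δ₂, hδ₂, h2⟩ :=
    hu.neg.exists_forall_integral_abs_sub_mollify_le hT hC hmol hM (half_pos hη)
  obtain ⟨ρ, h⟩ := hmol (min δ₁ δ₂) (lt_min hδ₁ hδ₂)
  -- `m ≤ ∫ |u t| ≤ η + ∫ |ρ * u t|` for small `t`
  have hle : ∀ᶠ t in 𝓝[>] (0 : ℝ), m ≤ η + ∫ x in Ω, |mollify ρ (u t) x| := by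
    filter_upwards [hIoo t₁ ht₁, hIoo t₂ ht₂] with t ha hb
    have htT : t ∈ Ioo 0 T := ⟨ha.1, ha.2.trans_lt ht₁.2⟩
    have hc := hu.continuous htT
    have hP := h1 _ ρ (lt_min hδ₁ hδ₂) (min_le_left _ _) h t ha
    have hN := h2 _ ρ (lt_min hδ₁ hδ₂) (min_le_right _ _) h t hb
    set p : E → ℝ := fun y => max (u t y) 0 with hp
    set q : E → ℝ := fun y => max (-u t y) 0 with hq
    have hpc : Continuous p := hc.max continuous_const
    have hqc : Continuous q := hc.neg.max continuous_const
    have hupq : ∀ y, u t y = p y - q y := fun y => by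
      simp only [hp, hq]
      rcases le_total 0 (u t y) with h0 | h0
      · rw [max_eq_left h0, max_eq_right (by linarith)]; ring
      · rw [max_eq_right h0, max_eq_left (by linarith)]; ring
    have hmu : ∀ x, mollify ρ (u t) x = mollify ρ p x - mollify ρ q x := fun x => by
      have e : ∀ y, ρ (x - y) • u t y = ρ (x - y) • p y - ρ (x - y) • q y := fun y => by
        rw [hupq, smul_sub]
      simp only [mollify, e]
      exact integral_sub (h.integrable_smul hpc x) (h.integrable_smul hqc x)
    have hp0 : ∀ x ∉ Ω, p x = 0 := fun x hx => by simp [hp, hu.eq_zero t htT x hx]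
    have hq0 : ∀ x ∉ Ω, q x = 0 := fun x hx => by simp [hq, hu.eq_zero t htT x hx]
    have hi : ∀ {w : E → ℝ}, Continuous w → (∀ x ∉ Ω, w x = 0) →
        Integrable fun x => |w x - mollify ρ w x| := by
      intro w hw hw0
      have : Integrable w := hw.integrable_of_hasCompactSupport
        (hasCompactSupport_of_bounded hu.isBounded hw0)
      refine (this.sub ?_).abs
      refine (h.contDiff_mollify hw).continuous.integrable_of_hasCompactSupport
        (hasCompactSupport_of_bounded (hu.isBounded.cthickening (δ := min δ₁ δ₂)) fun x hx => ?_)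
      exact h.mollify_eq_zero hw0 hx
    have hmc : Continuous fun x => |mollify ρ (u t) x| := (h.contDiff_mollify hc).continuous.abs
    have hmi : IntegrableOn (fun x => |mollify ρ (u t) x|) Ω :=
      (hmc.continuousOn.integrableOn_compact
        hu.isBounded.isCompact_closure).mono_set subset_closure
    have ip := (hi hpc hp0).integrableOn (s := Ω)
    have iq := (hi hqc hq0).integrableOn (s := Ω)
    have ipq : IntegrableOn (fun x => |p x - mollify ρ p x| + |q x - mollify ρ q x|) Ω := ip.add iq
    calc m ≤ ∫ x in Ω, |u t x| := hm t htT
      _ ≤ ∫ x in Ω, (|p x - mollify ρ p x| + |q x - mollify ρ q x| + |mollify ρ (u t) x|) := by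
          refine integral_mono_of_nonneg (Eventually.of_forall fun x => abs_nonneg _)
            (ipq.add hmi) (Eventually.of_forall fun x => ?_)
          have e : u t x = (p x - mollify ρ p x) - (q x - mollify ρ q x) + mollify ρ (u t) x := by
            rw [hmu, hupq]; ring
          calc |u t x| = |(p x - mollify ρ p x) - (q x - mollify ρ q x) + mollify ρ (u t) x| := by
                rw [← e]
            _ ≤ |(p x - mollify ρ p x) - (q x - mollify ρ q x)| + |mollify ρ (u t) x| :=
                abs_add_le _ _
            _ ≤ _ := add_le_add (abs_sub _ _) le_rfl
      _ = (∫ x in Ω, |p x - mollify ρ p x|) + (∫ x in Ω, |q x - mollify ρ q x|)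
            + ∫ x in Ω, |mollify ρ (u t) x| := by
          rw [integral_add ipq hmi, integral_add ip iq]
      _ ≤ η / 2 + η / 2 + ∫ x in Ω, |mollify ρ (u t) x| := by
          refine add_le_add (add_le_add ?_ ?_) le_rfl
          · exact (setIntegral_le_integral (hi hpc hp0)
              (Eventually.of_forall fun x => abs_nonneg _)).trans hP
          · exact (setIntegral_le_integral (hi hqc hq0)
              (Eventually.of_forall fun x => abs_nonneg _)).trans hN
      _ = η + ∫ x in Ω, |mollify ρ (u t) x| := by ring
  have hev : ∀ᶠ t in 𝓝[>] (0 : ℝ), t ∈ Ioo 0 T := Ioo_mem_nhdsGT hT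
  have hpt : ∀ x, Tendsto (fun t => mollify ρ (u t) x) (𝓝[>] 0)
      (𝓝 (mollify ρ (Ω.indicator u₀) x)) := by
    intro x
    have hg : IntegrableOn (fun y => ρ (x - y)) Ω :=
      ((h.contDiff.continuous.comp (continuous_const.sub continuous_id)
        ).integrable_of_hasCompactSupport (h.hasCompactSupport_sub x)).integrableOn
    have hl := tendsto_setIntegral_mul_of_bounded hΩ hu.isBounded (M := M)
      (by
        filter_upwards [hev] with t ht
        exact ⟨(hu.continuous ht).aestronglyMeasurable, fun x _ => hu.abs_le t ht x⟩)
      hu₀ hM₀ hweak hg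
    have e : ∫ y in Ω, ρ (x - y) * u₀ y = mollify ρ (Ω.indicator u₀) x := by
      rw [mollify, ← integral_indicator hΩ.measurableSet]
      refine integral_congr_ae (Eventually.of_forall fun y => ?_)
      by_cases hy : y ∈ Ω <;> simp [hy]
    rw [e] at hl
    refine hl.congr' ?_
    filter_upwards [hev] with t ht
    exact setIntegral_eq_integral_of_forall_compl_eq_zero fun y hy => by
      rw [hu.eq_zero t ht y hy, mul_zero]
  have hlim : Tendsto (fun t => ∫ x in Ω, |mollify ρ (u t) x|) (𝓝[>] 0)
      (𝓝 (∫ x in Ω, |mollify ρ (Ω.indicator u₀) x|)) := by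
    refine tendsto_integral_filter_of_dominated_convergence (fun _ => M) ?_ ?_
      (integrable_const M) (Eventually.of_forall fun x => (hpt x).abs)
    · filter_upwards [hev] with t ht
      exact (h.contDiff_mollify (hu.continuous ht)).continuous.abs.aestronglyMeasurable
    · filter_upwards [hev] with t ht
      refine Eventually.of_forall fun x => ?_
      have : ‖mollify ρ (u t) x‖ ≤ M := h.norm_mollify_le (hu.abs_le t ht) x
      rwa [Real.norm_eq_abs, abs_abs]
  have hfinal := ge_of_tendsto (hlim.const_add η) hle
  have hY : ∫ x in Ω, |mollify ρ (Ω.indicator u₀) x| ≤ ∫ x in Ω, |u₀ x| := by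
    have hmi : Integrable fun x => |mollify ρ (Ω.indicator u₀) x| := by
      have e : mollify ρ (Ω.indicator u₀)
          = convolution (Ω.indicator u₀) ρ (ContinuousLinearMap.mul ℝ ℝ) volume := by
        ext x; simp [mollify, convolution, mul_comm]
      rw [e]
      exact (hu₀I.integrable_convolution _
        (h.contDiff.continuous.integrable_of_hasCompactSupport h.hasCompactSupport)).abs
    refine (setIntegral_le_integral hmi (Eventually.of_forall fun x => abs_nonneg _)).trans ?_
    refine (h.integral_abs_mollify_le hu₀I).trans (le_of_eq ?_)
    rw [← integral_indicator hΩ.measurableSet]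
    refine integral_congr_ae (Eventually.of_forall fun y => ?_)
    by_cases hy : y ∈ Ω <;> simp [hy]
  linarith

end StrongConvergence


/-! ### Continuous weak derivatives on the line -/

section WeakDerivative

theorem integrable_of_continuousOn_of_eq_zero {X F : Type*} [TopologicalSpace X] [T2Space X]
    [MeasurableSpace X] [OpensMeasurableSpace X] {μ : Measure X} [IsFiniteMeasureOnCompacts μ]
    [NormedAddCommGroup F] {k : X → F} {K : Set X} (hK : IsCompact K)
    (hk : ContinuousOn k K) (hk0 : ∀ x ∉ K, k x = 0) : Integrable k μ := by
  refine (integrableOn_iff_integrable_of_support_subset fun y hy => ?_).1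
    (hk.integrableOn_compact hK)
  exact by_contra fun hc => hy (hk0 y hc)

/-- A continuous function whose weak derivative is continuous is differentiable. -/
theorem hasDerivAt_of_forall_integral_eq_zero {m F : ℝ → ℝ} {a b : ℝ}
    (hm : ContinuousOn m (Ioo a b)) (hF : ContinuousOn F (Ioo a b))
    (h : ∀ θ : ℝ → ℝ, ContDiff ℝ 1 θ → HasCompactSupport θ → tsupport θ ⊆ Ioo a b →
      ∫ x, (deriv θ x * m x + θ x * F x) = 0) :
    ∀ t ∈ Ioo a b, HasDerivAt m (F t) t := by
  intro t₀ ht₀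
  set c := t₀ with hc
  set H : ℝ → ℝ := fun x => ∫ y in c..x, F y with hH
  have hHd : ∀ x ∈ Ioo a b, HasDerivAt H (F x) x := by
    intro x hx
    have hsub : uIcc c x ⊆ Ioo a b := (ordConnected_Ioo).uIcc_subset ht₀ hx
    refine intervalIntegral.integral_hasDerivAt_right
      (hF.mono hsub).intervalIntegrable ?_ (hF.continuousAt (isOpen_Ioo.mem_nhds hx))
    exact hF.stronglyMeasurableAtFilter isOpen_Ioo x hx
  have hHc : ContinuousOn H (Ioo a b) := fun x hx => (hHd x hx).continuousAt.continuousWithinAt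
  set G : ℝ → ℝ := fun x => m x - H x with hG
  have hGc : ContinuousOn G (Ioo a b) := hm.sub hHc
  -- integrability of products with test functions
  have hint : ∀ {θ k : ℝ → ℝ}, Continuous θ → HasCompactSupport θ → tsupport θ ⊆ Ioo a b →
      ContinuousOn k (Ioo a b) → Integrable fun x => θ x * k x := by
    intro θ k hθ hθc hθs hk
    refine integrable_of_continuousOn_of_eq_zero hθc.isCompact
      (hθ.continuousOn.mul (hk.mono hθs)) fun x hx => ?_
    rw [image_eq_zero_of_notMem_tsupport hx, zero_mul]
  have hdG : ∀ θ : ℝ → ℝ, ContDiff ℝ 1 θ → HasCompactSupport θ → tsupport θ ⊆ Ioo a b →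
      ∫ x, deriv θ x * G x = 0 := by
    intro θ hθ hθc hθs
    have hθ' : Continuous (deriv θ) := hθ.continuous_deriv le_rfl
    have hθ'c : HasCompactSupport (deriv θ) := hθc.deriv
    have hθ's : tsupport (deriv θ) ⊆ Ioo a b := tsupport_deriv_subset.trans hθs
    have hder : ∀ x, HasDerivAt (fun x => θ x * H x) (deriv θ x * H x + θ x * F x) x := by
      intro x
      by_cases hx : x ∈ tsupport θ
      · exact ((hθ.differentiable one_ne_zero x).hasDerivAt).mul (hHd x (hθs hx))
      · have h0 : θ =ᶠ[𝓝 x] 0 := notMem_tsupport_iff_eventuallyEq.1 hx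
        rw [h0.deriv_eq, h0.eq_of_nhds]
        simp only [Pi.zero_def, deriv_const, zero_mul, add_zero]
        refine (hasDerivAt_const x (0 : ℝ)).congr_of_eventuallyEq ?_
        filter_upwards [h0] with y hy
        simp [hy]
    have i1 := hint hθ' hθ'c hθ's hHc
    have i2 := hint hθ.continuous hθc hθs hF
    have i3 := hint hθ' hθ'c hθ's hm
    have i4 := hint hθ.continuous hθc hθs hHc
    have e1 := integral_eq_zero_of_hasDerivAt_of_integrable hder (i1.add i2) i4
    have e2 := h θ hθ hθc hθs
    rw [integral_add i1 i2] at e1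
    rw [integral_add i3 i2] at e2
    have e3 : ∫ x, deriv θ x * G x = (∫ x, deriv θ x * m x) - ∫ x, deriv θ x * H x := by
      rw [← integral_sub i3 i1]
      simp only [hG, mul_sub]
    rw [e3]; linarith
  -- a fixed test function of integral one
  obtain ⟨r, hr, hball⟩ := Metric.isOpen_iff.1 (isOpen_Ioo (a := a) (b := b)) t₀ ht₀
  let f : ContDiffBump t₀ := ⟨r / 4, r / 2, by positivity, by linarith⟩
  let ψ : ℝ → ℝ := f.normed volume
  have hψ : ContDiff ℝ 1 ψ := f.contDiff_normed (n := 1)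
  have hψc : HasCompactSupport ψ := f.hasCompactSupport_normed
  have hψs : tsupport ψ ⊆ Ioo a b := by
    rw [f.tsupport_normed_eq]
    exact (Metric.closedBall_subset_ball (by change r / 2 < r; linarith)).trans hball
  have hψ1 : ∫ x, ψ x = 1 := f.integral_normed
  set k := ∫ x, ψ x * G x with hk
  have hconst : ∀ᵐ x, x ∈ Ioo a b → G x - k = 0 := by
    refine isOpen_Ioo.ae_eq_zero_of_integral_contDiff_smul_eq_zero
      ((hGc.sub continuousOn_const).locallyIntegrableOn isOpen_Ioo.measurableSet) ?_
    intro θ hθ hθc hθs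
    have hθ1 : ContDiff ℝ 1 θ := hθ.of_le (by norm_cast)
    set J := ∫ x, θ x with hJ
    -- the primitive of `θ - J ψ` is again a test function
    obtain ⟨l, hal, hl⟩ : ∃ l, a < l ∧ ∀ x < l, θ x - J * ψ x = 0 := by
      rcases (tsupport θ ∪ tsupport ψ).eq_empty_or_nonempty with he | hne
      · refine ⟨a + 1, by linarith, fun x _ => ?_⟩
        have h1 : x ∉ tsupport θ := fun hx => (he ▸ Or.inl hx : x ∈ (∅ : Set ℝ))
        have h2 : x ∉ tsupport ψ := fun hx => (he ▸ Or.inr hx : x ∈ (∅ : Set ℝ))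
        rw [image_eq_zero_of_notMem_tsupport h1, image_eq_zero_of_notMem_tsupport h2]; simp
      · obtain ⟨l, hl, hmin⟩ := (hθc.isCompact.union hψc.isCompact).exists_isLeast hne
        refine ⟨l, ((union_subset hθs hψs) hl).1, fun x hx => ?_⟩
        have h1 : x ∉ tsupport θ := fun hc => (hmin (Or.inl hc)).not_gt hx
        have h2 : x ∉ tsupport ψ := fun hc => (hmin (Or.inr hc)).not_gt hx
        rw [image_eq_zero_of_notMem_tsupport h1, image_eq_zero_of_notMem_tsupport h2]; simp
    obtain ⟨R, hRb, hR⟩ : ∃ R, R < b ∧ ∀ x > R, θ x - J * ψ x = 0 := by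
      rcases (tsupport θ ∪ tsupport ψ).eq_empty_or_nonempty with he | hne
      · refine ⟨b - 1, by linarith, fun x _ => ?_⟩
        have h1 : x ∉ tsupport θ := fun hx => (he ▸ Or.inl hx : x ∈ (∅ : Set ℝ))
        have h2 : x ∉ tsupport ψ := fun hx => (he ▸ Or.inr hx : x ∈ (∅ : Set ℝ))
        rw [image_eq_zero_of_notMem_tsupport h1, image_eq_zero_of_notMem_tsupport h2]; simp
      · obtain ⟨l, hl, hmax⟩ := (hθc.isCompact.union hψc.isCompact).exists_isGreatest hne
        refine ⟨l, ((union_subset hθs hψs) hl).2, fun x hx => ?_⟩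
        have h1 : x ∉ tsupport θ := fun hc => (hmax (Or.inl hc)).not_gt hx
        have h2 : x ∉ tsupport ψ := fun hc => (hmax (Or.inr hc)).not_gt hx
        rw [image_eq_zero_of_notMem_tsupport h1, image_eq_zero_of_notMem_tsupport h2]; simp
    have hgc : Continuous fun x => θ x - J * ψ x :=
      hθ.continuous.sub (continuous_const.mul hψ.continuous)
    have hθi : Integrable θ := hθ.continuous.integrable_of_hasCompactSupport hθc
    have hψi : Integrable ψ := hψ.continuous.integrable_of_hasCompactSupport hψc
    have hgi : Integrable fun x => θ x - J * ψ x := hθi.sub (hψi.const_mul J)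
    have hg0 : ∫ x, (θ x - J * ψ x) = 0 := by
      rw [integral_sub hθi (hψi.const_mul J), integral_const_mul, hψ1]; simp [hJ]
    set Θ : ℝ → ℝ := fun x => ∫ y in l..x, (θ y - J * ψ y) with hΘ
    have hΘd : ∀ x, HasDerivAt Θ (θ x - J * ψ x) x := fun x =>
      intervalIntegral.integral_hasDerivAt_right (hgc.intervalIntegrable _ _)
        (hgc.stronglyMeasurableAtFilter _ _) hgc.continuousAt
    have hΘderiv : deriv Θ = fun x => θ x - J * ψ x := funext fun x => (hΘd x).deriv
    have hΘ1 : ContDiff ℝ 1 Θ := by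
      rw [contDiff_one_iff_deriv, hΘderiv]
      exact ⟨fun x => (hΘd x).differentiableAt, hgc⟩
    have hΘl : ∀ x < l, Θ x = 0 := by
      intro x hx
      refine intervalIntegral.integral_zero_ae ?_
      have : ∀ᵐ y : ℝ, y ≠ l := by simp [ae_iff]
      filter_upwards [this] with y hyl hy
      rw [uIoc_of_ge hx.le] at hy
      exact hl y (lt_of_le_of_ne hy.2 hyl)
    have hΘR : ∀ x > R, Θ x = 0 := by
      intro x hx
      rcases lt_or_ge x l with hxl | hxl
      · exact hΘl x hxl
      · rw [hΘ]
        simp only []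
        rw [intervalIntegral.integral_of_le hxl, ← hg0]
        refine setIntegral_eq_integral_of_ae_compl_eq_zero ?_
        have : ∀ᵐ y : ℝ, y ≠ l := by simp [ae_iff]
        filter_upwards [this] with y hyl hy
        rw [mem_Ioc, not_and_or, not_lt, not_le] at hy
        rcases hy with hy | hy
        · exact hl y (lt_of_le_of_ne hy hyl)
        · exact hR y (hx.trans hy)
    have hΘs : tsupport Θ ⊆ Icc l R := by
      refine closure_minimal (fun x hx => ?_) isClosed_Icc
      exact ⟨by_contra fun hc => hx (hΘl x (not_le.1 hc)),
        by_contra fun hc => hx (hΘR x (not_le.1 hc))⟩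
    have hz := hdG Θ hΘ1 (isCompact_Icc.of_isClosed_subset (isClosed_tsupport _) hΘs)
      (hΘs.trans (Icc_subset_Ioo hal hRb))
    rw [hΘderiv] at hz
    have j1 := hint hθ.continuous hθc hθs hGc
    have j2 := hint hψ.continuous hψc hψs hGc
    have e1 : ∫ x, (θ x - J * ψ x) * G x = (∫ x, θ x * G x) - J * k := by
      rw [hk, ← integral_const_mul, ← integral_sub j1 (j2.const_mul J)]
      refine integral_congr_ae (Eventually.of_forall fun x => ?_)
      simp only []; ring
    have e2 : ∫ x, θ x • (G x - k) = (∫ x, θ x * G x) - J * k := by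
      rw [hJ, ← integral_mul_const, ← integral_sub j1 (hθi.mul_const k)]
      refine integral_congr_ae (Eventually.of_forall fun x => ?_)
      simp only [smul_eq_mul]; ring
    rw [e2, ← e1, hz]
  have heq : EqOn G (fun _ => k) (Ioo a b) := by
    refine Measure.eqOn_open_of_ae_eq (μ := volume) ?_ isOpen_Ioo hGc continuousOn_const
    rw [EventuallyEq, ae_restrict_iff' measurableSet_Ioo]
    filter_upwards [hconst] with x hx hxI using by linarith [hx hxI]
  refine ((hHd t₀ ht₀).add_const k).congr_of_eventuallyEq ?_
  filter_upwards [isOpen_Ioo.mem_nhds ht₀] with x hx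
  have := heq hx
  simp only [hG] at this
  linarith

end WeakDerivative


/-! ### The velocity field -/

section Velocity

theorem continuous_setIntegral_smul_comp_sub {E F : Type*} [NormedAddCommGroup E]
    [NormedSpace ℝ E] [FiniteDimensional ℝ E]
    [MeasurableSpace E] [BorelSpace E] [NormedAddCommGroup F] [NormedSpace ℝ F] {μ : Measure E}
    {Ω : Set E} (hΩb : Bornology.IsBounded Ω) (hΩ : MeasurableSet Ω) {k : E → F}
    (hk : Continuous k) {G : E → ℝ} (hG : IntegrableOn G Ω μ) :
    Continuous fun x => ∫ y in Ω, G y • k (x - y) ∂μ := by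
  obtain ⟨R, hR⟩ := hΩb.exists_norm_le
  refine continuous_iff_continuousAt.2 fun x₀ => ?_
  obtain ⟨c, hc⟩ := (isCompact_closedBall (0 : E) (‖x₀‖ + 1 + R)).exists_bound_of_continuousOn
    hk.continuousOn
  refine continuousAt_of_dominated (bound := fun y => ‖G y‖ * c) ?_ ?_ (hG.norm.mul_const c) ?_
  · exact Eventually.of_forall fun x => hG.aestronglyMeasurable.smul
      (hk.comp (continuous_const.sub continuous_id)).aestronglyMeasurable
  · filter_upwards [Metric.ball_mem_nhds x₀ one_pos] with x hx
    filter_upwards [ae_restrict_mem hΩ] with y hy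
    rw [norm_smul]
    refine mul_le_mul_of_nonneg_left (hc _ ?_) (norm_nonneg _)
    rw [mem_closedBall_zero_iff]
    have h1 : ‖x‖ ≤ ‖x₀‖ + 1 := by
      have := norm_le_norm_add_norm_sub x₀ x
      rw [norm_sub_rev] at this
      have h2 := (mem_ball_iff_norm.1 hx)
      linarith
    exact (norm_sub_le _ _).trans (add_le_add h1 (hR y hy))
  · exact Eventually.of_forall fun y =>
      (continuous_const.smul (hk.comp (continuous_id.sub continuous_const))).continuousAt

variable {n : ℕ} {Ω S : Set (EuclideanSpace ℝ (Fin n))} {K f : EuclideanSpace ℝ (Fin n) → ℝ}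

theorem hasFDerivAt_sampledConvAdj (hΩ : MeasurableSet Ω) (hΩb : Bornology.IsBounded Ω)
    (hS : MeasurableSet S) (hK : ContDiff ℝ 1 K) {g : EuclideanSpace ℝ (Fin n) → ℝ}
    (hg : IntegrableOn g Ω) (y : EuclideanSpace ℝ (Fin n)) :
    HasFDerivAt (sampledConvAdj Ω S K g)
      (∫ x in Ω, S.indicator g x • -fderiv ℝ K (x - y)) y := by
  obtain ⟨R, hR⟩ := hΩb.exists_norm_le
  have hK1 := hK.continuous_fderiv one_ne_zero
  obtain ⟨c, hc⟩ := (isCompact_closedBall (0 : EuclideanSpace ℝ (Fin n))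
    (R + (‖y‖ + 1))).exists_bound_of_continuousOn hK1.continuousOn
  have hG : IntegrableOn (S.indicator g) Ω := hg.indicator hS
  have e : sampledConvAdj Ω S K g = fun y => ∫ x in Ω, S.indicator g x * K (x - y) := by
    ext y
    refine integral_congr_ae (Eventually.of_forall fun x => ?_)
    by_cases hx : x ∈ S <;> simp [hx, mul_comm]
  have hneg : ∀ z, Continuous fun x => K (x - z) := fun z =>
    hK.continuous.comp (continuous_id.sub continuous_const)
  rw [e]
  refine hasFDerivAt_integral_of_dominated_of_fderiv_le
    (F := fun y x => S.indicator g x * K (x - y))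
    (F' := fun y x => S.indicator g x • -fderiv ℝ K (x - y))
    (bound := fun x => ‖S.indicator g x‖ * c) (Metric.ball_mem_nhds y one_pos) ?_ ?_ ?_ ?_
    (hG.norm.mul_const c) ?_
  · exact Eventually.of_forall fun z => hG.aestronglyMeasurable.mul
      (hneg z).aestronglyMeasurable
  · obtain ⟨c', hc'⟩ := (isCompact_closedBall (0 : EuclideanSpace ℝ (Fin n))
      (R + ‖y‖)).exists_bound_of_continuousOn hK.continuous.continuousOn
    refine Integrable.mul_bdd (c := c') hG (hneg y).aestronglyMeasurable ?_
    filter_upwards [ae_restrict_mem hΩ] with x hx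
    refine hc' _ ?_
    rw [mem_closedBall_zero_iff]
    exact (norm_sub_le _ _).trans (add_le_add (hR x hx) le_rfl)
  · exact hG.aestronglyMeasurable.smul
      (hK1.comp (continuous_id.sub continuous_const)).neg.aestronglyMeasurable
  · filter_upwards [ae_restrict_mem hΩ] with x hx z hz
    rw [norm_smul, norm_neg]
    refine mul_le_mul_of_nonneg_left (hc _ ?_) (norm_nonneg _)
    rw [mem_closedBall_zero_iff]
    have h1 : ‖z‖ ≤ ‖y‖ + 1 := by
      have := norm_le_norm_add_norm_sub y z
      rw [norm_sub_rev] at this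
      have h2 := (mem_ball_iff_norm.1 hz)
      linarith
    exact (norm_sub_le _ _).trans (add_le_add (hR x hx) h1)
  · refine Eventually.of_forall fun x z _ => ?_
    have h1 : HasFDerivAt (fun z => K (x - z)) _ z :=
      (hK.differentiable one_ne_zero (x - z)).hasFDerivAt.comp z ((hasFDerivAt_id z).const_sub x)
    have h2 := h1.const_mul (S.indicator g x)
    convert! h2 using 1
    ext v; simp

/-- The velocity field `∇(Aᵀ(A v - f))` of the equation. -/
noncomputable def velocity (Ω S : Set (EuclideanSpace ℝ (Fin n)))
    (K f v : EuclideanSpace ℝ (Fin n) → ℝ) (y : EuclideanSpace ℝ (Fin n)) :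
    EuclideanSpace ℝ (Fin n) :=
  gradient (residualPotential Ω S K f v) y

variable {v w : EuclideanSpace ℝ (Fin n) → ℝ}

theorem integrableOn_residual (hΩ : MeasurableSet Ω) (hΩb : Bornology.IsBounded Ω)
    (hS : MeasurableSet S) (hK : Continuous K) (hf : IntegrableOn f Ω) (hv : IntegrableOn v Ω) :
    IntegrableOn (fun x => sampledConv Ω S K v x) Ω ∧
      IntegrableOn (fun x => sampledConv Ω S K v x - f x) Ω := by
  have hc : Continuous fun x => ∫ y in Ω, K (x - y) * v y := by
    have := continuous_setIntegral_smul_comp_sub hΩb hΩ hK hv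
    simpa only [smul_eq_mul, mul_comm] using this
  have h1 : IntegrableOn (fun x => sampledConv Ω S K v x) Ω :=
    ((hc.continuousOn.integrableOn_compact hΩb.isCompact_closure).mono_set
      subset_closure).indicator hS
  exact ⟨h1, h1.sub hf⟩

theorem toDual_velocity (hΩ : MeasurableSet Ω) (hΩb : Bornology.IsBounded Ω)
    (hS : MeasurableSet S) (hK : ContDiff ℝ 1 K) (hf : IntegrableOn f Ω) (hv : IntegrableOn v Ω)
    (y : EuclideanSpace ℝ (Fin n)) :
    InnerProductSpace.toDual ℝ _ (velocity Ω S K f v y)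
      = ∫ x in Ω, S.indicator (fun x => sampledConv Ω S K v x - f x) x • -fderiv ℝ K (x - y) := by
  rw [velocity, gradient, LinearIsometryEquiv.apply_symm_apply]
  exact (hasFDerivAt_sampledConvAdj hΩ hΩb hS hK
    (integrableOn_residual hΩ hΩb hS hK.continuous hf hv).2 y).fderiv

theorem continuous_velocity (hΩ : MeasurableSet Ω) (hΩb : Bornology.IsBounded Ω)
    (hS : MeasurableSet S) (hK : ContDiff ℝ 1 K) (hf : IntegrableOn f Ω)
    (hv : IntegrableOn v Ω) : Continuous (velocity Ω S K f v) := by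
  have hG := (integrableOn_residual hΩ hΩb hS hK.continuous hf hv).2.indicator hS
  have hk : Continuous fun z => -fderiv ℝ K (-z) :=
    ((hK.continuous_fderiv one_ne_zero).comp continuous_neg).neg
  have h1 := continuous_setIntegral_smul_comp_sub hΩb hΩ hk hG
  have h2 : velocity Ω S K f v = fun y => (InnerProductSpace.toDual ℝ _).symm
      (∫ x in Ω, S.indicator (fun x => sampledConv Ω S K v x - f x) x
        • -fderiv ℝ K (-(y - x))) := by
    ext1 y
    simp only [neg_sub]
    rw [← toDual_velocity hΩ hΩb hS hK hf hv, LinearIsometryEquiv.symm_apply_apply]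
  rw [h2]
  exact (LinearIsometryEquiv.continuous _).comp h1

theorem abs_sampledConv_le (hΩb : Bornology.IsBounded Ω) {R c M : ℝ}
    (hR : ∀ x ∈ Ω, ‖x‖ ≤ R) (hc : ∀ z ∈ Metric.closedBall 0 (R + R), ‖K z‖ ≤ c)
    (hM : ∀ x ∈ Ω, |v x| ≤ M) : ∀ x ∈ Ω, |sampledConv Ω S K v x| ≤ c * M * volume.real Ω := by
  intro x hx
  have h0 : |∫ y in Ω, K (x - y) * v y| ≤ c * M * volume.real Ω := by
    rw [← Real.norm_eq_abs]
    refine norm_setIntegral_le_of_norm_le_const hΩb.measure_lt_top fun y hy => ?_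
    have h1 : ‖K (x - y)‖ ≤ c := hc _ (by
      rw [mem_closedBall_zero_iff]
      exact (norm_sub_le _ _).trans (add_le_add (hR x hx) (hR y hy)))
    rw [norm_mul]
    exact mul_le_mul h1 (hM y hy) (norm_nonneg _) ((norm_nonneg _).trans h1)
  rw [sampledConv]
  by_cases hxS : x ∈ S
  · rwa [indicator_of_mem hxS]
  · rw [indicator_of_notMem hxS, abs_zero]; exact (abs_nonneg _).trans h0

/-- The velocity depends on `v` only through a bound for `v`, as far as its size is concerned. -/
theorem exists_norm_velocity_le (hΩ : MeasurableSet Ω) (hΩb : Bornology.IsBounded Ω)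
    (hS : MeasurableSet S) (hK : ContDiff ℝ 1 K) (hf : IntegrableOn f Ω) (M : ℝ) :
    ∃ B, ∀ v, IntegrableOn v Ω → (∀ x ∈ Ω, |v x| ≤ M) → ∀ y ∈ Ω,
      ‖velocity Ω S K f v y‖ ≤ B := by
  obtain ⟨R, hR⟩ := hΩb.exists_norm_le
  have hK1 := hK.continuous_fderiv one_ne_zero
  obtain ⟨c, hc⟩ := (isCompact_closedBall (0 : EuclideanSpace ℝ (Fin n))
    (R + R)).exists_bound_of_continuousOn hK.continuous.continuousOn
  obtain ⟨c₁, hc₁⟩ := (isCompact_closedBall (0 : EuclideanSpace ℝ (Fin n))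
    (R + R)).exists_bound_of_continuousOn hK1.continuousOn
  have hfin : Fact (volume Ω < ⊤) := ⟨hΩb.measure_lt_top⟩
  refine ⟨∫ x in Ω, (c * M * volume.real Ω + |f x|) * c₁, fun v hv hM y hy => ?_⟩
  rw [← (InnerProductSpace.toDual ℝ (EuclideanSpace ℝ (Fin n))).norm_map,
    toDual_velocity hΩ hΩb hS hK hf hv]
  refine norm_integral_le_of_norm_le (((integrable_const _).add hf.abs).mul_const c₁) ?_
  filter_upwards [ae_restrict_mem hΩ] with x hx
  rw [norm_smul, norm_neg]
  have h1 : ‖fderiv ℝ K (x - y)‖ ≤ c₁ := hc₁ _ (by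
    rw [mem_closedBall_zero_iff]
    exact (norm_sub_le _ _).trans (add_le_add (hR x hx) (hR y hy)))
  refine mul_le_mul ((norm_indicator_le_norm_self _ _).trans ?_) h1 (norm_nonneg _) ?_
  · exact (norm_sub_le _ _).trans (add_le_add (abs_sampledConv_le hΩb hR hc hM x hx) le_rfl)
  · exact add_nonneg ((abs_nonneg _).trans (abs_sampledConv_le (S := univ) hΩb hR hc hM x hx))
      (abs_nonneg _)

/-- The Lipschitz constant, too, depends on `v` only through a bound for `v`. -/
theorem exists_lipschitzOnWith_velocity (hΩ : MeasurableSet Ω) (hΩb : Bornology.IsBounded Ω)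
    (hS : MeasurableSet S) (hK : ContDiff ℝ 1 K) (hK' : LocallyLipschitz (fderiv ℝ K))
    (hf : IntegrableOn f Ω) (M : ℝ) :
    ∃ L : NNReal, ∀ v, IntegrableOn v Ω → (∀ x ∈ Ω, |v x| ≤ M) →
      LipschitzOnWith L (velocity Ω S K f v) Ω := by
  obtain ⟨R, hR⟩ := hΩb.exists_norm_le
  obtain ⟨c, hc⟩ := (isCompact_closedBall (0 : EuclideanSpace ℝ (Fin n))
    (R + R)).exists_bound_of_continuousOn hK.continuous.continuousOn
  obtain ⟨l, hl⟩ := (hK'.locallyLipschitzOn (s := Metric.closedBall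
    (0 : EuclideanSpace ℝ (Fin n)) (R + R))).exists_lipschitzOnWith_of_compact
      (isCompact_closedBall _ _)
  have hfin : Fact (volume Ω < ⊤) := ⟨hΩb.measure_lt_top⟩
  have hK1 := hK.continuous_fderiv one_ne_zero
  refine ⟨Real.toNNReal ((∫ x in Ω, (c * M * volume.real Ω + |f x|)) * l), fun v hv hM => ?_⟩
  refine LipschitzOnWith.of_dist_le_mul fun y hy z hz => ?_
  have hG := (integrableOn_residual hΩ hΩb hS hK.continuous hf hv).2.indicator hS
  have hmem : ∀ x ∈ Ω, ∀ y ∈ Ω, x - y ∈ Metric.closedBall (0 : EuclideanSpace ℝ (Fin n)) (R + R) :=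
    fun x hx y hy => by
      rw [mem_closedBall_zero_iff]
      exact (norm_sub_le _ _).trans (add_le_add (hR x hx) (hR y hy))
  have hi : ∀ y ∈ Ω, IntegrableOn (fun x => S.indicator (fun x => sampledConv Ω S K v x - f x) x
      • -fderiv ℝ K (x - y)) Ω := by
    intro y hy
    obtain ⟨c₁, hc₁⟩ := (isCompact_closedBall (0 : EuclideanSpace ℝ (Fin n))
      (R + R)).exists_bound_of_continuousOn hK1.continuousOn
    refine Integrable.smul_bdd hG c₁
      (hK1.comp (continuous_id.sub continuous_const)).neg.aestronglyMeasurable ?_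
    filter_upwards [ae_restrict_mem hΩ] with x hx
    rw [norm_neg]; exact hc₁ _ (hmem x hx y hy)
  have h0 : ∀ x ∈ Ω, 0 ≤ c * M * volume.real Ω := fun x hx =>
    (abs_nonneg _).trans (abs_sampledConv_le (S := univ) hΩb hR hc hM x hx)
  have hI : 0 ≤ ∫ x in Ω, (c * M * volume.real Ω + |f x|) :=
    setIntegral_nonneg hΩ fun x hx => add_nonneg (h0 x hx) (abs_nonneg _)
  rw [Real.coe_toNNReal _ (mul_nonneg hI l.coe_nonneg), dist_eq_norm,
    ← (InnerProductSpace.toDual ℝ (EuclideanSpace ℝ (Fin n))).norm_map, map_sub,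
    toDual_velocity hΩ hΩb hS hK hf hv, toDual_velocity hΩ hΩb hS hK hf hv,
    ← integral_sub (hi y hy) (hi z hz), mul_assoc, ← MeasureTheory.integral_mul_const]
  refine norm_integral_le_of_norm_le (((integrable_const _).add hf.abs).mul_const _) ?_
  filter_upwards [ae_restrict_mem hΩ] with x hx
  rw [← smul_sub, norm_smul]
  refine mul_le_mul ((norm_indicator_le_norm_self _ _).trans ?_) ?_ (norm_nonneg _) ?_
  · exact (norm_sub_le _ _).trans (add_le_add (abs_sampledConv_le hΩb hR hc hM x hx) le_rfl)
  · have := hl.dist_le_mul (x - z) (hmem x hx z hz) (x - y) (hmem x hx y hy)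
    rw [dist_eq_norm, dist_eq_norm] at this
    rw [show -fderiv ℝ K (x - y) - -fderiv ℝ K (x - z) = fderiv ℝ K (x - z) - fderiv ℝ K (x - y) by
      abel]
    refine this.trans (le_of_eq ?_)
    rw [dist_eq_norm]
    congr 2; abel
  · exact add_nonneg (h0 x hx) (abs_nonneg _)

/-- The velocity depends continuously on `v` in the uniform norm, uniformly on `Ω`. -/
theorem exists_norm_velocity_sub_le (hΩ : MeasurableSet Ω) (hΩb : Bornology.IsBounded Ω)
    (hS : MeasurableSet S) (hK : ContDiff ℝ 1 K) (hf : IntegrableOn f Ω) :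
    ∃ A : ℝ, ∀ v w, IntegrableOn v Ω → IntegrableOn w Ω → ∀ m : ℝ, (∀ x ∈ Ω, |v x - w x| ≤ m) →
      ∀ y ∈ Ω, ‖velocity Ω S K f v y - velocity Ω S K f w y‖ ≤ A * m := by
  obtain ⟨R, hR⟩ := hΩb.exists_norm_le
  have hK1 := hK.continuous_fderiv one_ne_zero
  obtain ⟨c, hc⟩ := (isCompact_closedBall (0 : EuclideanSpace ℝ (Fin n))
    (R + R)).exists_bound_of_continuousOn hK.continuous.continuousOn
  obtain ⟨c₁, hc₁⟩ := (isCompact_closedBall (0 : EuclideanSpace ℝ (Fin n))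
    (R + R)).exists_bound_of_continuousOn hK1.continuousOn
  refine ⟨c * volume.real Ω * c₁ * volume.real Ω, fun v w hv hw m hm y hy => ?_⟩
  have hmem : ∀ x ∈ Ω, x - y ∈ Metric.closedBall (0 : EuclideanSpace ℝ (Fin n)) (R + R) :=
    fun x hx => by
      rw [mem_closedBall_zero_iff]
      exact (norm_sub_le _ _).trans (add_le_add (hR x hx) (hR y hy))
  have hi : ∀ v, IntegrableOn v Ω → IntegrableOn (fun x =>
      S.indicator (fun x => sampledConv Ω S K v x - f x) x • -fderiv ℝ K (x - y)) Ω := by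
    intro v hv
    refine Integrable.smul_bdd
      ((integrableOn_residual hΩ hΩb hS hK.continuous hf hv).2.indicator hS) c₁
      (hK1.comp (continuous_id.sub continuous_const)).neg.aestronglyMeasurable ?_
    filter_upwards [ae_restrict_mem hΩ] with x hx
    rw [norm_neg]; exact hc₁ _ (hmem x hx)
  have hlin : ∀ x ∈ Ω, |sampledConv Ω S K v x - sampledConv Ω S K w x|
      ≤ c * m * volume.real Ω := by
    intro x hx
    have hKi : ∀ v, IntegrableOn v Ω → IntegrableOn (fun z => K (x - z) * v z) Ω := by
      intro v hv
      refine Integrable.bdd_mul (c := c) hv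
        (hK.continuous.comp (continuous_const.sub continuous_id)).aestronglyMeasurable ?_
      filter_upwards [ae_restrict_mem hΩ] with z hz
      refine hc _ ?_
      rw [mem_closedBall_zero_iff]
      exact (norm_sub_le _ _).trans (add_le_add (hR x hx) (hR z hz))
    have e : sampledConv Ω S K v x - sampledConv Ω S K w x
        = sampledConv Ω S K (fun z => v z - w z) x := by
      by_cases hxS : x ∈ S
      · simp only [sampledConv, indicator_of_mem hxS, mul_sub]
        rw [integral_sub (hKi v hv) (hKi w hw)]
      · simp [sampledConv, hxS]
    rw [e]
    exact abs_sampledConv_le hΩb hR hc hm x hx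
  rw [← (InnerProductSpace.toDual ℝ (EuclideanSpace ℝ (Fin n))).norm_map, map_sub,
    toDual_velocity hΩ hΩb hS hK hf hv, toDual_velocity hΩ hΩb hS hK hf hw,
    ← integral_sub (hi v hv) (hi w hw)]
  refine (norm_setIntegral_le_of_norm_le_const (C := c * m * volume.real Ω * c₁)
    hΩb.measure_lt_top fun x hx => ?_).trans (le_of_eq (by ring))
  rw [← sub_smul, norm_smul, norm_neg]
  refine mul_le_mul ?_ (hc₁ _ (hmem x hx)) (norm_nonneg _) ((abs_nonneg _).trans (hlin x hx))
  by_cases hxS : x ∈ S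
  · rw [indicator_of_mem hxS, indicator_of_mem hxS, sub_sub_sub_cancel_right]
    exact hlin x hx
  · rw [indicator_of_notMem hxS, indicator_of_notMem hxS, sub_zero, norm_zero]
    exact (abs_nonneg _).trans (hlin x hx)

end Velocity


/-! ### Continuous weak solutions -/

section WeakSolution

/-- Extension by zero of a function on `Ω` vanishing on the boundary keeps joint continuity. -/
theorem continuousOn_uncurry_indicator {X Y : Type*} [TopologicalSpace X] [TopologicalSpace Y]
    {Ω : Set Y} (hΩ : IsOpen Ω) {I : Set X} {u : X → Y → ℝ}
    (hu : ContinuousOn (fun z : X × Y => u z.1 z.2) (I ×ˢ closure Ω))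
    (h0 : ∀ t ∈ I, ∀ x ∈ frontier Ω, u t x = 0) :
    ContinuousOn (fun z : X × Y => Ω.indicator (u z.1) z.2) (I ×ˢ univ) := by
  have h1 : ContinuousOn (fun z : X × Y => Ω.indicator (u z.1) z.2) (I ×ˢ closure Ω) := by
    refine hu.congr fun z hz => ?_
    by_cases hx : z.2 ∈ Ω
    · rw [indicator_of_mem hx]
    · rw [indicator_of_notMem hx]
      exact (h0 z.1 hz.1 z.2 (by rw [hΩ.frontier_eq]; exact ⟨hz.2, hx⟩)).symm
  have h2 : ContinuousOn (fun z : X × Y => Ω.indicator (u z.1) z.2) (I ×ˢ Ωᶜ) :=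
    continuousOn_const.congr fun z hz => indicator_of_notMem hz.2 _
  have hun : I ×ˢ (univ : Set Y) = I ×ˢ closure Ω ∪ I ×ˢ Ωᶜ := by
    rw [← prod_union]
    congr 1
    exact (eq_univ_of_forall fun x => (em (x ∈ Ω)).imp (fun h => subset_closure h) id).symm
  intro z hz
  rw [hun]
  refine ContinuousWithinAt.union ?_ ?_
  · by_cases hx : z.2 ∈ closure Ω
    · exact h1 z ⟨hz.1, hx⟩
    · refine continuousWithinAt_of_notMem_closure fun hc => hx ?_
      rw [closure_prod_eq, closure_closure] at hc
      exact hc.2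
  · by_cases hx : z.2 ∈ Ωᶜ
    · exact h2 z ⟨hz.1, hx⟩
    · refine continuousWithinAt_of_notMem_closure fun hc => hx ?_
      rw [closure_prod_eq, hΩ.isClosed_compl.closure_eq] at hc
      exact hc.2

variable {n : ℕ} {Ω S : Set (EuclideanSpace ℝ (Fin n))} {K f u₀ : EuclideanSpace ℝ (Fin n) → ℝ}
  {T : ℝ} {u : ℝ → EuclideanSpace ℝ (Fin n) → ℝ}

namespace IsContinuousWeakSolution

theorem continuousOn_swap (hu : IsContinuousWeakSolution Ω S K f T u₀ u) :
    ContinuousOn (fun z : ℝ × EuclideanSpace ℝ (Fin n) => u z.1 z.2) (Ioc 0 T ×ˢ closure Ω) :=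
  hu.continuousOn.comp continuous_swap.continuousOn fun _ hz => ⟨hz.2, hz.1⟩

theorem continuousOn_indicator (hu : IsContinuousWeakSolution Ω S K f T u₀ u) (hΩ : IsOpen Ω) :
    ContinuousOn (fun z : ℝ × EuclideanSpace ℝ (Fin n) => Ω.indicator (u z.1) z.2)
      (Ioc 0 T ×ˢ univ) :=
  continuousOn_uncurry_indicator hΩ hu.continuousOn_swap hu.boundary

theorem continuous_indicator (hu : IsContinuousWeakSolution Ω S K f T u₀ u) (hΩ : IsOpen Ω)
    {t : ℝ} (ht : t ∈ Ioc 0 T) : Continuous (Ω.indicator (u t)) := by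
  rw [← continuousOn_univ]
  exact (hu.continuousOn_indicator hΩ).comp (f := fun x => (t, x)) (by fun_prop)
    fun x _ => ⟨ht, mem_univ _⟩

theorem integrableOn (hu : IsContinuousWeakSolution Ω S K f T u₀ u) (hΩ : IsOpen Ω)
    (hΩb : Bornology.IsBounded Ω) {t : ℝ} (ht : t ∈ Ioc 0 T) : IntegrableOn (u t) Ω := by
  rw [← integrable_indicator_iff hΩ.measurableSet]
  exact (hu.continuous_indicator hΩ ht).integrable_of_hasCompactSupport
    (hasCompactSupport_of_bounded hΩb fun x hx => indicator_of_notMem hx _)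

theorem exists_abs_le (hu : IsContinuousWeakSolution Ω S K f T u₀ u)
    (hΩb : Bornology.IsBounded Ω) {s : ℝ} (hs : 0 < s) :
    ∃ M, ∀ t ∈ Icc s T, ∀ x ∈ Ω, |u t x| ≤ M := by
  obtain ⟨M, hM⟩ := (isCompact_Icc.prod hΩb.isCompact_closure).exists_bound_of_continuousOn
    (hu.continuousOn_swap.mono (prod_mono_left fun t (ht : t ∈ Icc s T) =>
      ⟨hs.trans_le ht.1, ht.2⟩))
  exact ⟨M, fun t ht x hx => hM (t, x) ⟨ht, subset_closure hx⟩⟩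

theorem continuousOn_setIntegral_abs (hu : IsContinuousWeakSolution Ω S K f T u₀ u)
    (hΩ : IsOpen Ω) (hΩb : Bornology.IsBounded Ω) :
    ContinuousOn (fun t => ∫ x in Ω, |u t x|) (Ioc 0 T) := by
  have h := continuousOn_integral_of_compact_support (μ := volume)
    (f := fun t x => |Ω.indicator (u t) x|) hΩb.isCompact_closure
    (hu.continuousOn_indicator hΩ).abs fun t x _ hx => by
      rw [indicator_of_notMem fun hc => hx (subset_closure hc), abs_zero]
  refine h.congr fun t _ => ?_
  simp only []
  rw [← integral_indicator hΩ.measurableSet]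
  refine integral_congr_ae (Eventually.of_forall fun x => ?_)
  by_cases hx : x ∈ Ω <;> simp [hx]

/-- The velocity field of a continuous weak solution is jointly continuous. -/
theorem continuousOn_velocity (hu : IsContinuousWeakSolution Ω S K f T u₀ u)
    (hΩ : IsOpen Ω) (hΩb : Bornology.IsBounded Ω) (hS : MeasurableSet S) (hK : ContDiff ℝ 1 K)
    (hf : IntegrableOn f Ω) :
    ContinuousOn (fun z : ℝ × EuclideanSpace ℝ (Fin n) => velocity Ω S K f (u z.1) z.2)
      (Ioc 0 T ×ˢ Ω) := by
  obtain ⟨A, hA⟩ := exists_norm_velocity_sub_le hΩ.measurableSet hΩb hS hK hf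
  rintro ⟨t, x⟩ ⟨ht, hx⟩
  rw [ContinuousWithinAt, Metric.tendsto_nhds]
  intro ε hε
  have h1 : ∀ᶠ s in 𝓝[Ioc 0 T] t, ∀ y ∈ closure Ω, |u s y - u t y| < ε / (2 * (|A| + 1)) := by
    obtain ⟨w, hw, h⟩ := hΩb.isCompact_closure.mem_uniformity_of_prod
      (f := u) hu.continuousOn_swap ht (Metric.dist_mem_uniformity
        (show 0 < ε / (2 * (|A| + 1)) by positivity))
    filter_upwards [hw] with s hs y hy
    simpa [Real.dist_eq] using h s hs y hy
  have hVc : Continuous (velocity Ω S K f (u t)) :=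
    continuous_velocity hΩ.measurableSet hΩb hS hK hf (hu.integrableOn hΩ hΩb ht)
  have h2 : ∀ᶠ y in 𝓝[Ω] x, dist (velocity Ω S K f (u t) y) (velocity Ω S K f (u t) x) < ε / 2 :=
    nhdsWithin_le_nhds (Metric.tendsto_nhds.1 (hVc.tendsto x) _ (half_pos hε))
  rw [nhdsWithin_prod_eq]
  filter_upwards [(h1.and self_mem_nhdsWithin).prod_mk (h2.and self_mem_nhdsWithin)]
    with ⟨s, y⟩ ⟨⟨ha, hs⟩, hb, hy⟩
  have h3 := hA (u s) (u t) (hu.integrableOn hΩ hΩb hs) (hu.integrableOn hΩ hΩb ht) _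
    (fun x hx => (ha x (subset_closure hx)).le) y hy
  rw [← dist_eq_norm] at h3
  have h4 : A * (ε / (2 * (|A| + 1))) ≤ ε / 2 := by
    rw [mul_div_assoc', div_le_iff₀ (by positivity)]
    nlinarith [le_abs_self A]
  calc dist (velocity Ω S K f (u s) y) (velocity Ω S K f (u t) x)
      ≤ _ := dist_triangle _ (velocity Ω S K f (u t) y) _
    _ < ε / 2 + ε / 2 := add_lt_add_of_le_of_lt (h3.trans h4) hb
    _ = ε := add_halves ε

/-- The velocity is only known to be jointly continuous inside `Ω`, but `∇φ` vanishes elsewhere. -/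
theorem continuousOn_flux (hu : IsContinuousWeakSolution Ω S K f T u₀ u)
    (hΩ : IsOpen Ω) (hΩb : Bornology.IsBounded Ω) (hS : MeasurableSet S) (hK : ContDiff ℝ 1 K)
    (hf : IntegrableOn f Ω) {φ : EuclideanSpace ℝ (Fin n) → ℝ} (hφ : ContDiff ℝ 1 φ)
    (hφs : tsupport φ ⊆ Ω) :
    ContinuousOn (fun z : ℝ × EuclideanSpace ℝ (Fin n) =>
      |Ω.indicator (u z.1) z.2| * fderiv ℝ φ z.2 (velocity Ω S K f (u z.1) z.2))
      (Ioc 0 T ×ˢ univ) := by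
  rintro ⟨t, x⟩ ⟨ht, -⟩
  by_cases hx : x ∈ tsupport φ
  · have hxΩ := hφs hx
    have hφ' : Continuous fun z : ℝ × EuclideanSpace ℝ (Fin n) => fderiv ℝ φ z.2 :=
      (hφ.continuous_fderiv one_ne_zero).comp continuous_snd
    have h := ((hu.continuousOn_indicator hΩ).mono (prod_mono_right (subset_univ Ω))).abs.mul
      (hφ'.continuousOn.clm_apply (hu.continuousOn_velocity hΩ hΩb hS hK hf))
    refine (h (t, x) ⟨ht, hxΩ⟩).mono_of_mem_nhdsWithin ?_
    rw [nhdsWithin_prod_eq, nhdsWithin_univ]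
    exact prod_mem_prod self_mem_nhdsWithin (hΩ.mem_nhds hxΩ)
  · have h0 : ∀ᶠ z : ℝ × EuclideanSpace ℝ (Fin n) in 𝓝 (t, x), fderiv ℝ φ z.2 = 0 := by
      have : ∀ᶠ y in 𝓝 x, fderiv ℝ φ y = 0 := by
        filter_upwards [(isClosed_tsupport φ).isOpen_compl.mem_nhds hx] with y hy
        rw [(notMem_tsupport_iff_eventuallyEq.1 hy).fderiv_eq]
        simp
      exact (continuous_snd.tendsto (t, x)).eventually this
    refine ContinuousAt.continuousWithinAt ((continuousAt_const (y := (0 : ℝ))).congr ?_)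
    filter_upwards [h0] with z hz
    rw [hz]; simp

/-- The equation tested with functions of space only, pointwise in time. The weak formulation,
tested with products `φ(x) θ(t)`, gives the derivative of `∫ φ u` in the sense of distributions,
which is continuous. -/
theorem hasDerivAt (hu : IsContinuousWeakSolution Ω S K f T u₀ u)
    (hΩ : IsOpen Ω) (hΩb : Bornology.IsBounded Ω) (hS : MeasurableSet S) (hK : ContDiff ℝ 1 K)
    (hf : IntegrableOn f Ω) {φ : EuclideanSpace ℝ (Fin n) → ℝ} (hφ : ContDiff ℝ 1 φ)
    (hφc : HasCompactSupport φ) (hφs : tsupport φ ⊆ Ω) :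
    ∀ t ∈ Ioo 0 T, HasDerivAt (fun τ => ∫ x, φ x * Ω.indicator (u τ) x)
      (-∫ x, |Ω.indicator (u t) x| * fderiv ℝ φ x (velocity Ω S K f (u t) x)) t := by
  have hsub : (Ioo 0 T ×ˢ univ : Set (ℝ × EuclideanSpace ℝ (Fin n))) ⊆ Ioc 0 T ×ˢ univ :=
    prod_mono_left Ioo_subset_Ioc_self
  have hφd : ∀ x ∉ tsupport φ, fderiv ℝ φ x = 0 := fun x hx => by
    rw [(notMem_tsupport_iff_eventuallyEq.1 hx).fderiv_eq]; simp
  have c1 : ContinuousOn (fun z : ℝ × EuclideanSpace ℝ (Fin n) => φ z.2 * Ω.indicator (u z.1) z.2)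
      (Ioo 0 T ×ˢ univ) :=
    (hφ.continuous.comp continuous_snd).continuousOn.mul ((hu.continuousOn_indicator hΩ).mono hsub)
  have c2 := (hu.continuousOn_flux hΩ hΩb hS hK hf hφ hφs).mono hsub
  refine hasDerivAt_of_forall_integral_eq_zero
    (F := fun t => -∫ x, |Ω.indicator (u t) x| * fderiv ℝ φ x (velocity Ω S K f (u t) x)) ?_ ?_ ?_
  · exact continuousOn_integral_of_compact_support (μ := volume)
      (f := fun τ x => φ x * Ω.indicator (u τ) x) hφc.isCompact c1 fun t x _ hx => by
        rw [image_eq_zero_of_notMem_tsupport hx, zero_mul]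
  · exact (continuousOn_integral_of_compact_support (μ := volume)
      (f := fun t x => |Ω.indicator (u t) x| * fderiv ℝ φ x (velocity Ω S K f (u t) x))
      hφc.isCompact c2 fun t x _ hx => by rw [hφd x hx]; simp).neg
  · intro θ hθ hθc hθs
    have hη : ContDiff ℝ 1 fun z : EuclideanSpace ℝ (Fin n) × ℝ => φ z.1 * θ z.2 :=
      (hφ.comp contDiff_fst).mul (hθ.comp contDiff_snd)
    have hηs : tsupport (fun z : EuclideanSpace ℝ (Fin n) × ℝ => φ z.1 * θ z.2)
        ⊆ tsupport φ ×ˢ tsupport θ := by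
      refine closure_minimal (fun z hz => ?_) ((isClosed_tsupport φ).prod (isClosed_tsupport θ))
      exact ⟨subset_tsupport _ (left_ne_zero_of_mul hz),
        subset_tsupport _ (right_ne_zero_of_mul hz)⟩
    have hηc : HasCompactSupport fun z : EuclideanSpace ℝ (Fin n) × ℝ => φ z.1 * θ z.2 :=
      (hφc.isCompact.prod hθc.isCompact).of_isClosed_subset (isClosed_tsupport _) hηs
    have key := hu.weak_eq _ hη hηc (hηs.trans (prod_mono hφs hθs))
    set k : EuclideanSpace ℝ (Fin n) × ℝ → ℝ := fun z =>
      deriv θ z.2 * (φ z.1 * Ω.indicator (u z.2) z.1)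
        - θ z.2 * (|Ω.indicator (u z.2) z.1|
          * fderiv ℝ φ z.1 (velocity Ω S K f (u z.2) z.1)) with hk
    have hθd : ∀ t ∉ tsupport θ, deriv θ t = 0 := fun t ht =>
      image_eq_zero_of_notMem_tsupport fun hc => ht (tsupport_deriv_subset hc)
    have hk0 : ∀ z ∉ tsupport φ ×ˢ tsupport θ, k z = 0 := by
      intro z hz
      rw [mem_prod, not_and_or] at hz
      rcases hz with h | h
      · simp [hk, hφd _ h, image_eq_zero_of_notMem_tsupport h]
      · simp [hk, hθd _ h, image_eq_zero_of_notMem_tsupport h]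
    have hkc : ContinuousOn k (tsupport φ ×ˢ tsupport θ) := by
      have m : MapsTo (Prod.swap : EuclideanSpace ℝ (Fin n) × ℝ → ℝ × EuclideanSpace ℝ (Fin n))
          (tsupport φ ×ˢ tsupport θ) (Ioo 0 T ×ˢ univ) := fun z hz => ⟨hθs hz.2, mem_univ _⟩
      exact (((hθ.continuous_deriv le_rfl).comp continuous_snd).continuousOn.mul
        (c1.comp continuous_swap.continuousOn m)).sub
        ((hθ.continuous.comp continuous_snd).continuousOn.mul
          (c2.comp continuous_swap.continuousOn m))
    have hki : Integrable k (volume.prod volume) :=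
      integrable_of_continuousOn_of_eq_zero (hφc.isCompact.prod hθc.isCompact) hkc hk0
    have e1 : ∫ z in Ω ×ˢ Ioc 0 T, k z = 0 := by
      refine Eq.trans ?_ key
      refine setIntegral_congr_fun (hΩ.measurableSet.prod measurableSet_Ioc) fun z hz => ?_
      simp only [hk, inner_gradient_left, indicator_of_mem hz.1, velocity]
      rw [fderiv_mul_const (hφ.differentiable one_ne_zero z.1), deriv_const_mul_field]
      simp only [smul_apply, smul_eq_mul]
      ring
    have hk1 : ∀ z ∉ Ω ×ˢ Ioc 0 T, k z = 0 := fun z hz => hk0 z fun hc =>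
      hz ⟨hφs hc.1, Ioo_subset_Ioc_self (hθs hc.2)⟩
    rw [setIntegral_eq_integral_of_forall_compl_eq_zero hk1, Measure.volume_eq_prod,
      integral_prod_symm _ hki] at e1
    refine Eq.trans ?_ e1
    refine integral_congr_ae (Eventually.of_forall fun t => ?_)
    simp only [hk]
    by_cases ht : t ∈ tsupport θ
    · have i1 : Integrable fun x => φ x * Ω.indicator (u t) x :=
        integrable_of_continuousOn_of_eq_zero hφc.isCompact
          (c1.comp (f := fun x => (t, x)) (by fun_prop) fun x _ => ⟨hθs ht, mem_univ _⟩)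
          fun x hx => by rw [image_eq_zero_of_notMem_tsupport hx, zero_mul]
      have i2 : Integrable fun x =>
          |Ω.indicator (u t) x| * fderiv ℝ φ x (velocity Ω S K f (u t) x) :=
        integrable_of_continuousOn_of_eq_zero hφc.isCompact
          (c2.comp (f := fun x => (t, x)) (by fun_prop) fun x _ => ⟨hθs ht, mem_univ _⟩)
          fun x hx => by rw [hφd x hx]; simp
      rw [integral_sub (i1.const_mul _) (i2.const_mul _), integral_const_mul, integral_const_mul]
      ring
    · simp [hθd t ht, image_eq_zero_of_notMem_tsupport ht]

end IsContinuousWeakSolution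

end WeakSolution


/-! ### Conservation of mass for a Lipschitz kernel gradient -/

section Conservation

/-- Both the positive and the negative part have constant mass, since both are again solutions of
the linear transport equation, which may be tested with the constant `1`. -/
theorem IsTransportSolution.integral_abs_eq {E : Type*} [NormedAddCommGroup E]
    [InnerProductSpace ℝ E] [FiniteDimensional ℝ E] [MeasurableSpace E] [BorelSpace E]
    {Ω : Set E} {a b M B : ℝ} {L : NNReal} {u : ℝ → E → ℝ} {V : ℝ → E → E}
    (hu : IsTransportSolution Ω a b M B L u V) {s t : ℝ} (hs : s ∈ Ioo a b) (ht : t ∈ Ioo a b) :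
    ∫ x, |u s x| = ∫ x, |u t x| := by
  have key : ∀ {u : ℝ → E → ℝ} {V : ℝ → E → E}, IsTransportSolution Ω a b M B L u V →
      ∫ x, max (u s x) 0 = ∫ x, max (u t x) 0 := by
    intro u V hu
    have h : ∀ t ∈ Ioo a b, HasDerivAt (fun τ => ∫ x, max (u τ x) 0) 0 t := by
      intro t ht
      have := hu.hasDerivAt_integral_posPart (φ := fun _ => 1) contDiff_const ht
      simpa using this
    exact isOpen_Ioo.is_const_of_deriv_eq_zero isPreconnected_Ioo
      (fun t ht => (h t ht).differentiableAt.differentiableWithinAt) (fun t ht => (h t ht).deriv)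
      hs ht
  have split : ∀ t ∈ Ioo a b, ∫ x, |u t x| = (∫ x, max (u t x) 0) + ∫ x, max (-u t x) 0 := by
    intro t ht
    have hi : Integrable (u t) := (hu.continuous ht).integrable_of_hasCompactSupport
      (hasCompactSupport_of_bounded hu.isBounded (hu.eq_zero t ht))
    rw [← integral_add hi.pos_part hi.neg_part]
    refine integral_congr_ae (Eventually.of_forall fun x => ?_)
    exact (max_zero_add_max_neg_zero_eq_abs_self _).symm
  rw [split s hs, split t ht, key hu, key hu.neg]

variable {n : ℕ} {Ω S : Set (EuclideanSpace ℝ (Fin n))} {K f u₀ : EuclideanSpace ℝ (Fin n) → ℝ}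
  {T : ℝ} {u : ℝ → EuclideanSpace ℝ (Fin n) → ℝ}

namespace IsContinuousWeakSolution

/-- If `∇K` is locally Lipschitz, a bounded continuous weak solution solves a transport equation
whose velocity field is Lipschitz in space. The velocity is only estimated on `Ω`, from where it is
extended. -/
theorem exists_isTransportSolution (hu : IsContinuousWeakSolution Ω S K f T u₀ u)
    (hΩ : IsOpen Ω) (hΩb : Bornology.IsBounded Ω) (hS : MeasurableSet S) (hK : ContDiff ℝ 1 K)
    (hK' : LocallyLipschitz (fderiv ℝ K)) (hf : IntegrableOn f Ω) {s : ℝ} (hs : 0 ≤ s) {M : ℝ}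
    (hM : ∀ t ∈ Ioo s T, ∀ x ∈ Ω, |u t x| ≤ M) :
    ∃ B L V, IsTransportSolution Ω s T |M| B L (fun t => Ω.indicator (u t)) V := by
  have hsub : Ioo s T ⊆ Ioo 0 T := Ioo_subset_Ioo_left hs
  have hi : ∀ t ∈ Ioo s T, IntegrableOn (u t) Ω := fun t ht =>
    hu.integrableOn hΩ hΩb (Ioo_subset_Ioc_self (hsub ht))
  obtain ⟨B, hB⟩ := exists_norm_velocity_le hΩ.measurableSet hΩb hS hK hf M
  obtain ⟨L, hL⟩ := exists_lipschitzOnWith_velocity hΩ.measurableSet hΩb hS hK hK' hf M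
  have hex : ∀ t, ∃ g : EuclideanSpace ℝ (Fin n) → EuclideanSpace ℝ (Fin n), t ∈ Ioo s T →
      LipschitzWith (lipschitzExtensionConstant (EuclideanSpace ℝ (Fin n)) * L) g ∧
        EqOn (velocity Ω S K f (u t)) g Ω := by
    intro t
    by_cases ht : t ∈ Ioo s T
    · obtain ⟨g, hg⟩ := (hL (u t) (hi t ht) (hM t ht)).extend_finite_dimension
      exact ⟨g, fun _ => hg⟩
    · exact ⟨0, fun h => absurd h ht⟩
  choose V hV using hex
  refine ⟨B, _, V, hΩb, (hu.continuousOn_indicator hΩ).mono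
    (prod_mono_left (hsub.trans Ioo_subset_Ioc_self)), fun t _ x hx => indicator_of_notMem hx _,
    fun t ht x => ?_, fun t ht x hx => ?_, fun t ht => (hV t ht).1, fun φ h1 h2 h3 t ht => ?_⟩
  · by_cases hx : x ∈ Ω
    · rw [indicator_of_mem hx]; exact (hM t ht x hx).trans (le_abs_self M)
    · rw [indicator_of_notMem hx, abs_zero]; exact abs_nonneg M
  · rw [← (hV t ht).2 hx]; exact hB _ (hi t ht) (hM t ht) x hx
  · convert! hu.hasDerivAt hΩ hΩb hS hK hf h1 h2 h3 t (hsub ht) using 1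
    congr 1
    refine integral_congr_ae (Eventually.of_forall fun x => ?_)
    by_cases hx : x ∈ Ω
    · simp only [(hV t ht).2 hx]
    · simp [hx]

theorem integral_abs_indicator {v : EuclideanSpace ℝ (Fin n) → ℝ} (hΩ : MeasurableSet Ω) :
    ∫ x, |Ω.indicator v x| = ∫ x in Ω, |v x| := by
  rw [← integral_indicator hΩ]
  refine integral_congr_ae (Eventually.of_forall fun x => ?_)
  by_cases hx : x ∈ Ω <;> simp [hx]

theorem setIntegral_abs_eq_of_locallyLipschitz (hu : IsContinuousWeakSolution Ω S K f T u₀ u)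
    (hΩ : IsOpen Ω) (hΩb : Bornology.IsBounded Ω) (hS : MeasurableSet S) (hK : ContDiff ℝ 1 K)
    (hK' : LocallyLipschitz (fderiv ℝ K)) (hf : IntegrableOn f Ω) {s t : ℝ} (hs : s ∈ Ioo 0 T)
    (ht : t ∈ Ioo 0 T) : ∫ x in Ω, |u s x| = ∫ x in Ω, |u t x| := by
  have hr : 0 < min s t / 2 := half_pos (lt_min hs.1 ht.1)
  obtain ⟨M, hM⟩ := hu.exists_abs_le hΩb hr
  obtain ⟨B, L, V, h⟩ := hu.exists_isTransportSolution hΩ hΩb hS hK hK' hf hr.le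
    fun t ht => hM t ⟨ht.1.le, ht.2.le⟩
  have := h.integral_abs_eq (s := s) (t := t)
    ⟨by linarith [min_le_left s t, hr], hs.2⟩ ⟨by linarith [min_le_right s t, hr], ht.2⟩
  rwa [integral_abs_indicator hΩ.measurableSet, integral_abs_indicator hΩ.measurableSet] at this

/-- The initial condition holds in the weak sense against functions of space only. -/
theorem tendsto_initial (hu : IsContinuousWeakSolution Ω S K f T u₀ u)
    {φ : EuclideanSpace ℝ (Fin n) → ℝ} (hφ : ContDiff ℝ 1 φ)
    (hφc : HasCompactSupport φ) (hφs : tsupport φ ⊆ Ω) :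
    Tendsto (fun t => ∫ x in Ω, φ x * u t x) (𝓝[>] 0) (𝓝 (∫ x in Ω, φ x * u₀ x)) := by
  let χ : ContDiffBump (0 : ℝ) := ⟨1, 2, one_pos, one_lt_two⟩
  have hη : ContDiff ℝ 1 fun z : EuclideanSpace ℝ (Fin n) × ℝ => φ z.1 * χ z.2 :=
    (hφ.comp contDiff_fst).mul ((χ.contDiff (n := 1)).comp contDiff_snd)
  have hηs : tsupport (fun z : EuclideanSpace ℝ (Fin n) × ℝ => φ z.1 * χ z.2)
      ⊆ tsupport φ ×ˢ tsupport χ := by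
    refine closure_minimal (fun z hz => ?_) ((isClosed_tsupport φ).prod (isClosed_tsupport χ))
    exact ⟨subset_tsupport _ (left_ne_zero_of_mul hz), subset_tsupport _ (right_ne_zero_of_mul hz)⟩
  have h := hu.initial _ hη ((hφc.isCompact.prod χ.hasCompactSupport.isCompact).of_isClosed_subset
    (isClosed_tsupport _) hηs) (hηs.trans (prod_mono hφs (subset_univ _)))
  have h0 : χ 0 = 1 := χ.eventuallyEq_one.eq_of_nhds
  simp only [h0, mul_one] at h
  refine h.congr' ?_
  filter_upwards [nhdsWithin_le_nhds χ.eventuallyEq_one] with t ht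
  have ht' : χ t = 1 := ht
  simp only [ht', mul_one]

theorem le_setIntegral_abs_initial_of_locallyLipschitz
    (hu : IsContinuousWeakSolution Ω S K f T u₀ u)
    (hΩ : IsOpen Ω) (hΩb : Bornology.IsBounded Ω) (hS : MeasurableSet S) (hK : ContDiff ℝ 1 K)
    (hK' : LocallyLipschitz (fderiv ℝ K)) (hf : IntegrableOn f Ω) (hT : 0 < T)
    (hu₀ : ContinuousOn u₀ Ω) {M m : ℝ} (hM : ∀ t ∈ Ioo 0 T, ∀ x ∈ Ω, |u t x| ≤ M)
    (hM₀ : ∀ x ∈ Ω, |u₀ x| ≤ M) (hm : ∀ t ∈ Ioo 0 T, m ≤ ∫ x in Ω, |u t x|) :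
    m ≤ ∫ x in Ω, |u₀ x| := by
  obtain ⟨B, L, V, h⟩ := hu.exists_isTransportSolution hΩ hΩb hS hK hK' hf le_rfl hM
  have e : ∀ (k : EuclideanSpace ℝ (Fin n) → ℝ → ℝ) t, ∫ x in Ω, k x (Ω.indicator (u t) x)
      = ∫ x in Ω, k x (u t x) := fun k t =>
    setIntegral_congr_fun hΩ.measurableSet fun x hx => by simp only [indicator_of_mem hx]
  refine h.le_setIntegral_abs_initial hT hΩ (hu₀.aestronglyMeasurable hΩ.measurableSet)
    (fun x hx => (hM₀ x hx).trans (le_abs_self M)) ?_ ?_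
  · intro φ h1 h2 h3
    simp only [e fun x r => φ x * r]
    exact hu.tendsto_initial h1 h2 h3
  · intro t ht
    rw [e fun _ r => |r|]
    exact hm t ht

end IsContinuousWeakSolution

end Conservation


/-! ### Primitives of solutions in one space dimension -/

section Line

/-- A continuous function on the line that vanishes off an open set `O` and is differentiable in
`O` is a primitive of its derivative, provided the derivative extends continuously by zero:
the right derivative also exists off `O`, by the mean value theorem applied from the last point
outside `O`. -/
theorem sub_eq_integral_of_hasDerivAt_of_eq_zero {O : Set ℝ} (hO : IsOpen O) {F g : ℝ → ℝ}
    (hF : Continuous F) (hg : Continuous g) (hF0 : ∀ x ∉ O, F x = 0) (hg0 : ∀ x ∉ O, g x = 0)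
    (hd : ∀ x ∈ O, HasDerivAt F (g x) x) {p q : ℝ} (hpq : p ≤ q) :
    F q - F p = ∫ x in p..q, g x := by
  have hG : ∀ x, HasDerivAt (fun x => ∫ y in p..x, g y) (g x) x := fun x =>
    intervalIntegral.integral_hasDerivAt_right (hg.intervalIntegrable _ _)
      (hg.stronglyMeasurableAtFilter _ _) hg.continuousAt
  have hFr : ∀ x, HasDerivWithinAt F (g x) (Ici x) x := by
    intro x₀
    by_cases hx₀ : x₀ ∈ O
    · exact (hd x₀ hx₀).hasDerivWithinAt
    · rw [hg0 x₀ hx₀, hasDerivWithinAt_iff_isLittleO]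
      refine Asymptotics.isLittleO_iff.2 fun ε hε => ?_
      obtain ⟨δ, hδ, hclose⟩ := Metric.continuousAt_iff.1 (hg.continuousAt (x := x₀)) ε hε
      filter_upwards [nhdsWithin_le_nhds (Metric.ball_mem_nhds x₀ hδ), self_mem_nhdsWithin]
        with x hx hx'
      simp only [hF0 x₀ hx₀, sub_zero, smul_zero]
      by_cases hxO : x ∈ O
      · obtain ⟨r, ⟨hr, hrO⟩, hmax⟩ :=
          (isCompact_Icc.inter_right hO.isClosed_compl).exists_isGreatest
          (⟨x₀, ⟨le_rfl, hx'⟩, hx₀⟩ : (Icc x₀ x ∩ Oᶜ).Nonempty)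
        have hrx : r < x := lt_of_le_of_ne hr.2 fun h => hrO (h ▸ hxO)
        obtain ⟨c, hc, hceq⟩ := exists_hasDerivAt_eq_slope F g hrx hF.continuousOn fun y hy =>
          hd y (by_contra fun hy' => (hmax ⟨⟨hr.1.trans hy.1.le, hy.2.le⟩, hy'⟩).not_gt hy.1)
        have h1 : |g c| ≤ ε := by
          have h2 : dist c x₀ < δ := by
            rw [Real.dist_eq, abs_of_nonneg (by linarith [hr.1, hc.1])]
            rw [Metric.mem_ball, Real.dist_eq, abs_of_nonneg (sub_nonneg.2 hx')] at hx
            linarith [hc.2]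
          have := hclose h2
          rw [hg0 x₀ hx₀, dist_zero_right] at this
          exact this.le
        have h3 : F x = g c * (x - r) := by
          rw [hceq, hF0 r hrO, sub_zero, div_mul_cancel₀ _ (sub_pos.2 hrx).ne']
        rw [h3, norm_mul, Real.norm_eq_abs, Real.norm_eq_abs, Real.norm_eq_abs,
          abs_of_nonneg (sub_nonneg.2 hrx.le), abs_of_nonneg (sub_nonneg.2 hx')]
        exact mul_le_mul h1 (by linarith [hr.1]) (sub_nonneg.2 hrx.le) hε.le
      · rw [hF0 x hxO, norm_zero]; positivity
  have h := constant_of_has_deriv_right_zero (f := fun x => F x - ∫ y in p..x, g y) (a := p)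
    (b := q)
    (hF.sub (continuous_iff_continuousAt.2 fun x => (hG x).continuousAt)).continuousOn
    (fun x _ => by simpa using (hFr x).fun_sub (hG x).hasDerivWithinAt) q ⟨hpq, le_rfl⟩
  simp only [intervalIntegral.integral_same, sub_zero] at h
  linarith

/-- In one space dimension the weak equation `w_t = q_x` can be integrated once: the primitive
of `w` in space is differentiable in time with derivative `q`. -/
theorem hasDerivAt_primitive {O : Set ℝ} {a b R : ℝ} {w q : ℝ → ℝ → ℝ} (hO : IsOpen O)
    (hR : O ⊆ Ioi (-R))
    (hw : ContinuousOn (fun z : ℝ × ℝ => w z.1 z.2) (Ioo a b ×ˢ univ))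
    (hw0 : ∀ t ∈ Ioo a b, ∀ x ∉ O, w t x = 0)
    (hq : ContinuousOn (fun z : ℝ × ℝ => q z.1 z.2) (Ioo a b ×ˢ univ))
    (hq0 : ∀ t ∈ Ioo a b, ∀ x ∉ O, q t x = 0)
    (h : ∀ φ : ℝ → ℝ, ContDiff ℝ 1 φ → HasCompactSupport φ → tsupport φ ⊆ O → ∀ t ∈ Ioo a b,
      HasDerivAt (fun τ => ∫ x, φ x * w τ x) (-∫ x, q t x * deriv φ x) t) :
    ∀ t ∈ Ioo a b, ∀ x, HasDerivAt (fun τ => ∫ y in -R..x, w τ y) (q t x) t := by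
  have hwc : ∀ t ∈ Ioo a b, Continuous (w t) := fun t ht => by
    rw [← continuousOn_univ]
    exact hw.comp (f := fun x => (t, x)) (by fun_prop) fun x _ => ⟨ht, mem_univ _⟩
  have key : ∀ s ∈ Ioo a b, ∀ t ∈ Ioo a b, s ≤ t → ∀ x,
      (∫ y in -R..x, w t y) - ∫ y in -R..x, w s y = ∫ τ in s..t, q τ x := by
    intro s hs t ht hst x
    have hsub : Icc s t ⊆ Ioo a b := Icc_subset_Ioo hs.1 ht.2
    -- `q` with the time variable clamped to `[s, t]` is continuous everywhere
    set k : ℝ → ℝ → ℝ := fun τ x => q (projIcc s t hst τ) x with hk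
    have hkc : Continuous fun z : ℝ × ℝ => k z.1 z.2 := by
      rw [← continuousOn_univ]
      refine hq.comp (f := fun z : ℝ × ℝ => ((projIcc s t hst z.1 : ℝ), z.2)) ?_
        fun z _ => ⟨hsub (projIcc s t hst z.1).2, mem_univ _⟩
      exact ((continuous_subtype_val.comp (continuous_projIcc.comp continuous_fst)).prodMk
        continuous_snd).continuousOn
    have hkq : ∀ τ ∈ Icc s t, ∀ x, k τ x = q τ x := fun τ hτ x => by
      simp only [hk, projIcc_of_mem hst hτ]
    have hFc : Continuous fun x => ∫ τ in s..t, k τ x :=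
      intervalIntegral.continuous_parametric_intervalIntegral_of_continuous'
        (f := fun x τ => k τ x) (hkc.comp continuous_swap) s t
    have hF0 : ∀ x ∉ O, ∫ τ in s..t, k τ x = 0 := fun x hx => by
      simp [hk, hq0 _ (hsub (projIcc s t hst _).2) x hx]
    have hgc : Continuous fun x => w t x - w s x := (hwc t ht).sub (hwc s hs)
    have htest : ∀ φ : ℝ → ℝ, ContDiff ℝ 1 φ → HasCompactSupport φ → tsupport φ ⊆ O →
        ∫ x, (deriv φ x * (∫ τ in s..t, k τ x) + φ x * (w t x - w s x)) = 0 := by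
      intro φ hφ hφc hφO
      have hφ' : Continuous (deriv φ) := hφ.continuous_deriv le_rfl
      have hkφ : Continuous fun z : ℝ × ℝ => k z.1 z.2 * deriv φ z.2 :=
        hkc.mul (hφ'.comp continuous_snd)
      have hint : Integrable (fun z : ℝ × ℝ => k z.1 z.2 * deriv φ z.2)
          ((volume.restrict (Ioc s t)).prod volume) := by
        have h1 : IntegrableOn (fun z : ℝ × ℝ => k z.1 z.2 * deriv φ z.2)
            (Ioc s t ×ˢ univ) (volume.prod volume) := by
          refine IntegrableOn.of_forall_sdiff_eq_zero (s := Icc s t ×ˢ tsupport φ)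
            (hkφ.continuousOn.integrableOn_compact (isCompact_Icc.prod hφc.isCompact))
            (measurableSet_Ioc.prod MeasurableSet.univ) fun z hz => ?_
          have : z.2 ∉ tsupport φ := fun hc => hz.2 ⟨Ioc_subset_Icc_self hz.1.1, hc⟩
          rw [image_eq_zero_of_notMem_tsupport fun hc => this (tsupport_deriv_subset hc), mul_zero]
        rwa [IntegrableOn, ← Measure.prod_restrict, Measure.restrict_univ] at h1
      have hi : ∀ t ∈ Ioo a b, Integrable fun x => φ x * w t x := fun t ht =>
        (hφ.continuous.mul (hwc t ht)).integrable_of_hasCompactSupport hφc.mul_right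
      have hJ : Continuous fun τ => ∫ x, k τ x * deriv φ x := by
        rw [← continuousOn_univ]
        refine continuousOn_integral_of_compact_support (k := tsupport φ) hφc.isCompact
          (f := fun τ x => k τ x * deriv φ x) hkφ.continuousOn fun τ x _ hx => ?_
        rw [image_eq_zero_of_notMem_tsupport fun hc => hx (tsupport_deriv_subset hc), mul_zero]
      have hftc : (∫ τ in s..t, -∫ x, k τ x * deriv φ x)
          = (∫ x, φ x * w t x) - ∫ x, φ x * w s x := by
        refine intervalIntegral.integral_eq_sub_of_hasDerivAt (f := fun τ => ∫ x, φ x * w τ x)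
          (f' := fun τ => -∫ x, k τ x * deriv φ x) (fun τ hτ => ?_)
          (hJ.neg.intervalIntegrable _ _)
        rw [uIcc_of_le hst] at hτ
        simpa only [hkq τ hτ] using h φ hφ hφc hφO τ (hsub hτ)
      have hswap : ∫ τ in s..t, ∫ x, k τ x * deriv φ x
          = ∫ x, deriv φ x * ∫ τ in s..t, k τ x := by
        rw [intervalIntegral.integral_of_le hst, integral_integral_swap hint]
        refine integral_congr_ae (Eventually.of_forall fun x => ?_)
        simp only [intervalIntegral.integral_of_le hst]
        rw [integral_mul_const, mul_comm]
      rw [intervalIntegral.integral_neg, hswap] at hftc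
      have h2 : ∫ x, φ x * (w t x - w s x) = (∫ x, φ x * w t x) - ∫ x, φ x * w s x := by
        rw [← integral_sub (hi t ht) (hi s hs)]
        simp only [mul_sub]
      have i1 : Integrable fun x => deriv φ x * ∫ τ in s..t, k τ x :=
        (hφ'.mul hFc).integrable_of_hasCompactSupport hφc.deriv.mul_right
      have i2 : Integrable fun x => φ x * (w t x - w s x) :=
        (hφ.continuous.mul hgc).integrable_of_hasCompactSupport hφc.mul_right
      rw [integral_add i1 i2, h2]
      linarith
    have hd : ∀ x ∈ O, HasDerivAt (fun x => ∫ τ in s..t, k τ x) (w t x - w s x) x := by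
      intro x hx
      obtain ⟨r, hr, hball⟩ := Metric.isOpen_iff.1 hO x hx
      rw [Real.ball_eq_Ioo] at hball
      exact hasDerivAt_of_forall_integral_eq_zero hFc.continuousOn hgc.continuousOn
        (fun θ h1 h2 h3 => htest θ h1 h2 (h3.trans hball)) x ⟨by linarith, by linarith⟩
    have hRO : -R ∉ O := fun hc => lt_irrefl (-R) (hR hc)
    have e1 : (∫ y in -R..x, w t y) - ∫ y in -R..x, w s y = ∫ τ in s..t, k τ x := by
      rw [← intervalIntegral.integral_sub ((hwc t ht).intervalIntegrable _ _)
        ((hwc s hs).intervalIntegrable _ _)]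
      have hz : ∀ x ∉ O, w t x - w s x = 0 := fun x hx => by
        rw [hw0 t ht x hx, hw0 s hs x hx, sub_zero]
      rcases le_total (-R) x with hx | hx
      · rw [← sub_eq_integral_of_hasDerivAt_of_eq_zero hO hFc hgc hF0 hz hd hx, hF0 _ hRO, sub_zero]
      · rw [intervalIntegral.integral_symm,
          ← sub_eq_integral_of_hasDerivAt_of_eq_zero hO hFc hgc hF0 hz hd hx, hF0 _ hRO]
        ring
    rw [e1]
    refine intervalIntegral.integral_congr fun τ hτ => ?_
    rw [uIcc_of_le hst] at hτ
    exact hkq τ hτ x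
  intro t ht x
  have hqx : ContinuousOn (fun τ => q τ x) (Ioo a b) :=
    hq.comp (f := fun τ => (τ, x)) (by fun_prop) fun τ hτ => ⟨hτ, mem_univ _⟩
  have hd : HasDerivAt (fun s => ∫ τ in t..s, q τ x) (q t x) t :=
    intervalIntegral.integral_hasDerivAt_right (by simp)
      (hqx.stronglyMeasurableAtFilter isOpen_Ioo t ht) (hqx.continuousAt (isOpen_Ioo.mem_nhds ht))
  refine (hd.add_const (∫ y in -R..x, w t y)).congr_of_eventuallyEq ?_
  filter_upwards [isOpen_Ioo.mem_nhds ht] with s hs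
  rcases le_total t s with hts | hts
  · linarith [key t ht s hs hts x]
  · rw [intervalIntegral.integral_symm s t]
    linarith [key s hs t ht hts x]

end Line


/-! ### Signed variations -/

section SignedVariation

/-- A continuous family of maxima `S t = max Φ(t, ·)` is nondecreasing if the time derivative of
`Φ` vanishes at some maximizer: near `t` the function `S` lies above `Φ(·, x)`, where `x` is the
maximizer at time `t`. -/
theorem max_le_max_of_hasDerivAt_zero {X : Type*} {A : Set X} {Φ : ℝ → X → ℝ} {S : ℝ → ℝ}
    {a b : ℝ} (hS : ContinuousOn S (Ioo a b)) (hle : ∀ t ∈ Ioo a b, ∀ x ∈ A, Φ t x ≤ S t)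
    (hmax : ∀ t ∈ Ioo a b, ∃ x ∈ A, Φ t x = S t ∧ HasDerivAt (fun τ => Φ τ x) 0 t)
    {s t : ℝ} (hs : s ∈ Ioo a b) (ht : t ∈ Ioo a b) (hst : s ≤ t) : S s ≤ S t := by
  have hsub : Icc s t ⊆ Ioo a b := Icc_subset_Ioo hs.1 ht.2
  have h := image_le_of_liminf_slope_right_le_deriv_boundary (f := fun τ => -S τ) (a := s) (b := t)
    (B := fun _ => -S s) (B' := fun _ => 0) (hS.mono hsub).neg le_rfl continuousOn_const
    (fun _ _ => hasDerivWithinAt_const _ _ _) (fun τ hτ r hr => ?_) (right_mem_Icc.2 hst)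
  · linarith
  · have hτ' := hsub (Ico_subset_Icc_self hτ)
    obtain ⟨x, hxA, hx, hd⟩ := hmax τ hτ'
    have h1 := hd.tendsto_slope.mono_left (nhdsGT_le_nhdsNE τ)
    refine Eventually.frequently ?_
    filter_upwards [h1.eventually (lt_mem_nhds (show -r < 0 by linarith)), self_mem_nhdsWithin,
      nhdsWithin_le_nhds (isOpen_Ioo.mem_nhds hτ')] with z hz hzτ hzI
    have hpos : 0 < z - τ := sub_pos.2 hzτ
    rw [slope_def_field, lt_div_iff₀ hpos, hx] at hz
    rw [slope_def_field, div_lt_iff₀ hpos]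
    have := hle z hzI x hxA
    linarith

theorem max_eq_max_of_hasDerivAt_zero {X : Type*} {A : Set X} {Φ : ℝ → X → ℝ} {S : ℝ → ℝ}
    {a b : ℝ} (hS : ContinuousOn S (Ioo a b)) (hle : ∀ t ∈ Ioo a b, ∀ x ∈ A, Φ t x ≤ S t)
    (hmax : ∀ t ∈ Ioo a b, ∃ x ∈ A, Φ t x = S t ∧ HasDerivAt (fun τ => Φ τ x) 0 t)
    {s t : ℝ} (hs : s ∈ Ioo a b) (ht : t ∈ Ioo a b) : S s = S t := by
  have key : ∀ s ∈ Ioo a b, ∀ t ∈ Ioo a b, s ≤ t → S s = S t := by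
    intro s hs t ht hst
    have hneg : ∀ {τ}, τ ∈ Ioo (-b) (-a) → -τ ∈ Ioo a b := fun h =>
      ⟨by linarith [h.2], by linarith [h.1]⟩
    refine le_antisymm (max_le_max_of_hasDerivAt_zero hS hle hmax hs ht hst) ?_
    -- time reversal
    have h := max_le_max_of_hasDerivAt_zero (A := A) (a := -b) (b := -a) (S := fun τ => S (-τ))
      (Φ := fun τ x => Φ (-τ) x)
      (hS.comp continuous_neg.continuousOn fun τ hτ => hneg hτ)
      (fun τ hτ x hx => hle _ (hneg hτ) x hx) (fun τ hτ => ?_) (s := -t) (t := -s)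
      ⟨by linarith [ht.2], by linarith [ht.1]⟩ ⟨by linarith [hs.2], by linarith [hs.1]⟩
      (by linarith)
    · simpa using h
    · obtain ⟨x, hxA, hx, hd⟩ := hmax _ (hneg hτ)
      refine ⟨x, hxA, hx, ?_⟩
      simpa [Function.comp_def] using! hd.scomp τ (hasDerivAt_neg τ)
  rcases le_total s t with h | h
  · exact key s hs t ht h
  · exact (key t ht s hs h).symm

/-- The signed variation `∑ σᵢ (U(xᵢ₊₁) - U(xᵢ))` of `U` over the points `x₀, …, x_N`. -/
def signedVariation (N : ℕ) (σ : ℕ → ℝ) (U : ℝ → ℝ) (x : ℕ → ℝ) : ℝ :=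
  ∑ i ∈ Finset.range N, σ i * (U (x (i + 1)) - U (x i))

/-- Subdivisions `x₀ ≤ x₁ ≤ ⋯ ≤ x_N` with points in `[-R, R]`. The later members of the sequence
are irrelevant, and are kept in `[-R, R]` to have a compact set. -/
def subdivisions (N : ℕ) (R : ℝ) : Set (ℕ → ℝ) :=
  {x | (∀ i < N, x i ≤ x (i + 1)) ∧ ∀ i, x i ∈ Icc (-R) R}

theorem isCompact_subdivisions (N : ℕ) (R : ℝ) : IsCompact (subdivisions N R) := by
  have h : subdivisions N R
      = (univ.pi fun _ : ℕ => Icc (-R) R) ∩ ⋂ i, ⋂ (_ : i < N), {x | x i ≤ x (i + 1)} := by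
    ext x
    simp only [subdivisions, mem_ofPred_eq, mem_inter_iff, mem_univ_pi, mem_iInter]
    exact and_comm
  rw [h]
  refine (isCompact_univ_pi fun _ => isCompact_Icc).inter_right ?_
  exact isClosed_iInter fun i => isClosed_iInter fun _ =>
    isClosed_le (continuous_apply i) (continuous_apply (i + 1))

theorem continuous_signedVariation {N : ℕ} {σ : ℕ → ℝ} {U : ℝ → ℝ} (hU : Continuous U) :
    Continuous (signedVariation N σ U) :=
  continuous_finsetSum _ fun i _ => continuous_const.mul
    ((hU.comp (continuous_apply (i + 1))).sub (hU.comp (continuous_apply i)))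

theorem abs_signedVariation_sub_le {N : ℕ} {σ : ℕ → ℝ} (hσ : ∀ i, |σ i| ≤ 1) {U W : ℝ → ℝ}
    {m : ℝ} (h : ∀ x, |U x - W x| ≤ m) (x : ℕ → ℝ) :
    |signedVariation N σ U x - signedVariation N σ W x| ≤ N * (2 * m) := by
  rw [signedVariation, signedVariation, ← Finset.sum_sub_distrib]
  refine (Finset.abs_sum_le_sum_abs _ _).trans ?_
  refine (Finset.sum_le_card_nsmul _ _ (2 * m) fun i _ => ?_).trans (le_of_eq (by simp))
  rw [← mul_sub, abs_mul]
  have h1 : |U (x (i + 1)) - U (x i) - (W (x (i + 1)) - W (x i))| ≤ 2 * m := by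
    rw [show U (x (i + 1)) - U (x i) - (W (x (i + 1)) - W (x i))
      = (U (x (i + 1)) - W (x (i + 1))) - (U (x i) - W (x i)) by ring]
    linarith [abs_sub (U (x (i + 1)) - W (x (i + 1))) (U (x i) - W (x i)), h (x (i + 1)), h (x i)]
  nlinarith [hσ i, abs_nonneg (U (x (i + 1)) - U (x i) - (W (x (i + 1)) - W (x i)))]

/-- At a subdivision maximizing the signed variation of `U`, the signed variation of any function
vanishing with the derivative `w` of `U` is zero. All points at a given position `p` may be moved
simultaneously, so that by Fermat's theorem their total weight is zero, unless `w p = 0`. -/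
theorem signedVariation_eq_zero_of_isMaxOn {N : ℕ} {σ : ℕ → ℝ} {R : ℝ} {U w q : ℝ → ℝ}
    (hU : ∀ x, HasDerivAt U (w x) x) (hw : ∀ x ∉ Ioo (-R) R, w x = 0)
    (hq : ∀ x, w x = 0 → q x = 0) {x : ℕ → ℝ} (hx : x ∈ subdivisions N R)
    (hmax : ∀ y ∈ subdivisions N R, signedVariation N σ U y ≤ signedVariation N σ U x) :
    signedVariation N σ q x = 0 := by
  classical
  -- the total weight of the points at position `p`
  set D : ℝ → ℝ := fun p => ∑ i ∈ Finset.range N,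
    σ i * ((if x (i + 1) = p then 1 else 0) - if x i = p then 1 else 0) with hD
  have hDw : ∀ p, D p * w p = 0 := by
    intro p
    by_cases hp : p ∈ Ioo (-R) R
    · set y : ℝ → ℕ → ℝ := fun h i => if x i = p then x i + h else x i with hy
      have hy0 : y 0 = x := by ext i; simp [hy]
      have hyd : ∀ i, HasDerivAt (fun h => U (y h i)) ((if x i = p then 1 else 0) * w p) 0 := by
        intro i
        by_cases hi : x i = p
        · simp only [hy, hi, if_true, one_mul]
          have h1 : HasDerivAt U (w p) (p + 0) := by rw [add_zero]; exact hU p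
          simpa using h1.comp_const_add p 0
        · simp only [hy, hi, if_false, zero_mul]
          exact hasDerivAt_const _ _
      have hder : HasDerivAt (fun h => signedVariation N σ U (y h)) (D p * w p) 0 := by
        have h1 := HasDerivAt.fun_sum (u := Finset.range N) fun i _ =>
          ((hyd (i + 1)).fun_sub (hyd i)).const_mul (σ i)
        refine h1.congr_deriv ?_
        rw [hD, Finset.sum_mul]
        exact Finset.sum_congr rfl fun i _ => by ring
      have hmem : ∀ᶠ h in 𝓝 (0 : ℝ), y h ∈ subdivisions N R := by
        have hord : ∀ᶠ h in 𝓝 (0 : ℝ), ∀ i ∈ Finset.range N, y h i ≤ y h (i + 1) := by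
          refine (Finset.eventually_all _).2 fun i hi => ?_
          have hxi := hx.1 i (Finset.mem_range.1 hi)
          have hyc : ∀ j, ContinuousAt (fun h => y h j) 0 := fun j => by
            by_cases hj : x j = p
            · simp only [hy, hj, if_true]; fun_prop
            · simp only [hy, hj, if_false]; fun_prop
          rcases hxi.lt_or_eq with hlt | heq
          · have hlt' : y 0 i < y 0 (i + 1) := by rw [hy0]; exact hlt
            exact ((hyc i).eventually_lt (hyc (i + 1)) hlt').mono fun h hh => hh.le
          · exact Eventually.of_forall fun h => by simp only [hy, heq]; exact le_rfl
        have hin : ∀ᶠ h in 𝓝 (0 : ℝ), p + h ∈ Icc (-R) R := by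
          have hc : ContinuousAt (fun h : ℝ => p + h) 0 := by fun_prop
          refine hc.eventually (Icc_mem_nhds ?_ ?_)
          · simpa using hp.1
          · simpa using hp.2
        filter_upwards [hord, hin] with h h1 h2
        refine ⟨fun i hi => h1 i (Finset.mem_range.2 hi), fun i => ?_⟩
        by_cases hi : x i = p
        · simpa only [hy, hi, if_true] using h2
        · simpa only [hy, hi, if_false] using hx.2 i
      have hloc : IsLocalMax (fun h => signedVariation N σ U (y h)) 0 := by
        filter_upwards [hmem] with h hh
        simp only [hy0]
        exact hmax _ hh
      exact hloc.hasDerivAt_eq_zero hder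
    · rw [hw p hp, mul_zero]
  have hDq : ∀ p, D p * q p = 0 := fun p => by
    rcases mul_eq_zero.1 (hDw p) with h | h
    · rw [h, zero_mul]
    · rw [hq p h, mul_zero]
  set P := (Finset.range (N + 1)).image x with hP
  have hsum : ∀ i ∈ Finset.range (N + 1), q (x i) = ∑ p ∈ P, (if x i = p then 1 else 0) * q p := by
    intro i hi
    have : x i ∈ P := Finset.mem_image_of_mem _ hi
    simp [this]
  calc signedVariation N σ q x = ∑ i ∈ Finset.range N, ∑ p ∈ P,
        σ i * ((if x (i + 1) = p then 1 else 0) - if x i = p then 1 else 0) * q p := by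
        refine Finset.sum_congr rfl fun i hi => ?_
        have hi' := Finset.mem_range.1 hi
        rw [hsum (i + 1) (Finset.mem_range.2 (by omega)), hsum i (Finset.mem_range.2 (by omega)),
          ← Finset.sum_sub_distrib, Finset.mul_sum]
        exact Finset.sum_congr rfl fun p _ => by ring
    _ = ∑ p ∈ P, D p * q p := by
        rw [Finset.sum_comm]
        exact Finset.sum_congr rfl fun p _ => by rw [hD, Finset.sum_mul]
    _ = 0 := Finset.sum_eq_zero fun p _ => hDq p

/-- The maximal signed variation is conserved by solutions `U` of an equation
`∂ₜU = q`, where `q` vanishes wherever `∂ₓU` does. -/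
theorem exists_signedVariation_le {N : ℕ} {σ : ℕ → ℝ} (hσ : ∀ i, |σ i| ≤ 1) {a b R C : ℝ}
    {U w q : ℝ → ℝ → ℝ} (hUx : ∀ t ∈ Ioo a b, ∀ x, HasDerivAt (U t) (w t x) x)
    (hUt : ∀ t ∈ Ioo a b, ∀ x, HasDerivAt (fun τ => U τ x) (q t x) t)
    (hw : ∀ t ∈ Ioo a b, ∀ x ∉ Ioo (-R) R, w t x = 0)
    (hq : ∀ t ∈ Ioo a b, ∀ x, w t x = 0 → q t x = 0)
    (hqC : ∀ t ∈ Ioo a b, ∀ x, |q t x| ≤ C) {s t : ℝ} (hs : s ∈ Ioo a b) (ht : t ∈ Ioo a b)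
    {x : ℕ → ℝ} (hx : x ∈ subdivisions N R) :
    ∃ y ∈ subdivisions N R, signedVariation N σ (U t) x ≤ signedVariation N σ (U s) y := by
  have hex : ∀ τ ∈ Ioo a b, ∃ y ∈ subdivisions N R,
      sSup (signedVariation N σ (U τ) '' subdivisions N R) = signedVariation N σ (U τ) y ∧
        ∀ z ∈ subdivisions N R, signedVariation N σ (U τ) z ≤ signedVariation N σ (U τ) y :=
    fun τ hτ => (isCompact_subdivisions N R).exists_sSup_image_eq_and_ge ⟨x, hx⟩
      (continuous_signedVariation (continuous_iff_continuousAt.2 fun x =>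
        (hUx τ hτ x).continuousAt)).continuousOn
  set M : ℝ → ℝ := fun τ => sSup (signedVariation N σ (U τ) '' subdivisions N R) with hM
  have hle : ∀ τ ∈ Ioo a b, ∀ z ∈ subdivisions N R, signedVariation N σ (U τ) z ≤ M τ := by
    intro τ hτ z hz
    obtain ⟨y, _, h1, h2⟩ := hex τ hτ
    exact (h2 z hz).trans_eq h1.symm
  have hUlip : ∀ τ ∈ Ioo a b, ∀ τ' ∈ Ioo a b, ∀ z, |U τ z - U τ' z| ≤ C * |τ - τ'| := by
    intro τ hτ τ' hτ' z
    exact (convex_Ioo a b).norm_image_sub_le_of_norm_hasDerivWithin_le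
      (fun r hr => (hUt r hr z).hasDerivWithinAt) (fun r hr => hqC r hr z) hτ' hτ
  have hMlip : ∀ τ ∈ Ioo a b, ∀ τ' ∈ Ioo a b, M τ - M τ' ≤ N * (2 * (C * |τ - τ'|)) := by
    intro τ hτ τ' hτ'
    obtain ⟨y, hy, h1, _⟩ := hex τ hτ
    have h2 := (abs_le.1 (abs_signedVariation_sub_le (N := N) hσ (hUlip τ hτ τ' hτ') y)).2
    have h3 := hle τ' hτ' y hy
    have h4 : M τ = signedVariation N σ (U τ) y := h1
    linarith
  have hMc : ContinuousOn M (Ioo a b) := by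
    refine (LipschitzOnWith.of_dist_le_mul (K := Real.toNNReal (N * (2 * C)))
      fun τ hτ τ' hτ' => ?_).continuousOn
    have h1 := hMlip τ hτ τ' hτ'
    have h2 := hMlip τ' hτ' τ hτ
    rw [abs_sub_comm τ' τ] at h2
    rw [Real.dist_eq, Real.dist_eq]
    refine (abs_le.2 ⟨by linarith, h1⟩).trans ?_
    rw [show (N : ℝ) * (2 * (C * |τ - τ'|)) = N * (2 * C) * |τ - τ'| by ring]
    exact mul_le_mul_of_nonneg_right (Real.le_coe_toNNReal _) (abs_nonneg _)
  have hconst := max_eq_max_of_hasDerivAt_zero (A := subdivisions N R)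
    (Φ := fun τ => signedVariation N σ (U τ)) hMc hle (fun τ hτ => by
      obtain ⟨y, hy, h1, h2⟩ := hex τ hτ
      refine ⟨y, hy, h1.symm, ?_⟩
      rw [← signedVariation_eq_zero_of_isMaxOn (hUx τ hτ) (hw τ hτ) (hq τ hτ) hy h2]
      exact HasDerivAt.fun_sum fun i _ =>
        ((hUt τ hτ (y (i + 1))).fun_sub (hUt τ hτ (y i))).const_mul (σ i)) ht hs
  obtain ⟨y, hy, h1, _⟩ := hex s hs
  exact ⟨y, hy, ((hle t ht x hx).trans_eq hconst).trans_eq h1⟩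

/-- Signed variations of a primitive of `v` are bounded by the `L¹` norm of `v`. -/
theorem signedVariation_primitive_le {N : ℕ} {σ : ℕ → ℝ} (hσ : ∀ i, |σ i| ≤ 1) {R : ℝ}
    {v : ℝ → ℝ} (hv : Integrable v) {x : ℕ → ℝ} (hx : x ∈ subdivisions N R) :
    signedVariation N σ (fun x => ∫ y in -R..x, v y) x ≤ ∫ y, |v y| := by
  have hle : ∀ n ≤ N, x 0 ≤ x n := by
    intro n
    induction n with
    | zero => exact fun _ => le_rfl
    | succ n ih => exact fun h => (ih (by omega)).trans (hx.1 n (by omega))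
  calc signedVariation N σ (fun x => ∫ y in -R..x, v y) x
      ≤ ∑ i ∈ Finset.range N, ∫ y in x i..x (i + 1), |v y| := by
        refine Finset.sum_le_sum fun i hi => ?_
        rw [intervalIntegral.integral_interval_sub_left hv.intervalIntegrable
          hv.intervalIntegrable]
        have h1 := intervalIntegral.abs_integral_le_integral_abs (f := v) (μ := volume)
          (hx.1 i (Finset.mem_range.1 hi))
        refine (le_abs_self _).trans ?_
        rw [abs_mul]
        exact (mul_le_of_le_one_left (abs_nonneg _) (hσ i)).trans h1
    _ = ∫ y in x 0..x N, |v y| := intervalIntegral.sum_integral_adjacent_intervals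
        fun i _ => hv.abs.intervalIntegrable
    _ ≤ ∫ y, |v y| := by
        rw [intervalIntegral.integral_of_le (hle N le_rfl)]
        exact setIntegral_le_integral hv.abs (Eventually.of_forall fun y => abs_nonneg _)

/-- The `L¹` norm of `v` is the supremum of the signed variations of its primitive. The weights are
the signs of `v` at the points of a fine uniform subdivision. -/
theorem exists_integral_abs_le_signedVariation {R ε : ℝ} (hR : 0 ≤ R) (hε : 0 < ε) {v : ℝ → ℝ}
    (hv : Continuous v) (hv0 : ∀ x ∉ Ioo (-R) R, v x = 0) :
    ∃ (N : ℕ) (σ : ℕ → ℝ), (∀ i, |σ i| ≤ 1) ∧ ∃ x ∈ subdivisions N R,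
      ∫ y, |v y| ≤ signedVariation N σ (fun x => ∫ y in -R..x, v y) x + ε := by
  set ε' := ε / (4 * R + 1) with hε'
  have hε'0 : 0 < ε' := by positivity
  obtain ⟨δ, hδ, hosc⟩ := Metric.uniformContinuousOn_iff.1
    (isCompact_Icc.uniformContinuousOn_of_continuous (hv.continuousOn (s := Icc (-R) R))) ε' hε'0
  obtain ⟨N, hN⟩ := exists_nat_gt (2 * R / δ)
  have hN0 : (0 : ℝ) < N := lt_of_le_of_lt (by positivity) hN
  have hmesh : 2 * R / N < δ := by
    rw [div_lt_iff₀ hδ] at hN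
    rw [div_lt_iff₀ hN0]; linarith
  have hmesh0 : 0 ≤ 2 * R / N := by positivity
  -- the minimum only matters for the irrelevant indices `i > N`
  set x : ℕ → ℝ := fun i => min (-R + i * (2 * R / N)) R with hx
  have hxs : ∀ i, x i ≤ x (i + 1) ∧ x (i + 1) ≤ x i + 2 * R / N := by
    intro i
    simp only [hx]; push_cast
    refine ⟨min_le_min_right _ (by nlinarith), ?_⟩
    rw [← min_add_add_right]
    exact min_le_min (le_of_eq (by ring)) (by linarith)
  have hxR : ∀ i, x i ∈ Icc (-R) R := fun i =>
    ⟨le_min (le_add_of_nonneg_right (by positivity)) (by linarith), min_le_right _ _⟩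
  have hx0 : x 0 = -R := by simp only [hx]; simp; linarith
  have hxN : x N = R := by
    simp only [hx]
    rw [mul_div_cancel₀ _ hN0.ne', min_eq_right (by linarith)]
  set σ : ℕ → ℝ := fun i => if 0 ≤ v (x i) then 1 else -1 with hσ
  have hσv : ∀ i, σ i * v (x i) = |v (x i)| := by
    intro i
    by_cases h : 0 ≤ v (x i)
    · simp only [hσ, h, if_true, abs_of_nonneg h, one_mul]
    · simp only [hσ, h, if_false, abs_of_neg (not_le.1 h)]; ring
  have hσ1 : ∀ i, |σ i| ≤ 1 := by
    intro i
    by_cases h : 0 ≤ v (x i) <;> simp [hσ, h]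
  refine ⟨N, σ, hσ1, x, ⟨fun i _ => (hxs i).1, hxR⟩, ?_⟩
  have hvi : ∀ p q, IntervalIntegrable v volume p q := fun p q => hv.intervalIntegrable p q
  -- on each piece `|v| ≤ σ i * v + 2 * ε'`, by the choice of the mesh
  have hpiece : ∀ i, ∫ y in x i..x (i + 1), |v y|
      ≤ σ i * (∫ y in x i..x (i + 1), v y) + (x (i + 1) - x i) * (2 * ε') := by
    intro i
    have e : σ i * (∫ y in x i..x (i + 1), v y) + (x (i + 1) - x i) * (2 * ε')
        = ∫ y in x i..x (i + 1), (σ i * v y + 2 * ε') := by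
      rw [intervalIntegral.integral_add ((hvi _ _).const_mul _) intervalIntegrable_const,
        intervalIntegral.integral_const_mul, intervalIntegral.integral_const, smul_eq_mul]
    rw [e]
    refine intervalIntegral.integral_mono_on (hxs i).1 (hvi _ _).abs
      (((hvi _ _).const_mul _).add intervalIntegrable_const) fun y hy => ?_
    have h1 := hosc y ⟨(hxR i).1.trans hy.1, hy.2.trans (hxR (i + 1)).2⟩ (x i) (hxR i) (by
      rw [Real.dist_eq, abs_of_nonneg (by linarith [hy.1])]
      linarith [hy.2, (hxs i).2])
    rw [Real.dist_eq] at h1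
    have h2 : |σ i * (v y - v (x i))| ≤ ε' := by
      rw [abs_mul]
      exact (mul_le_of_le_one_left (abs_nonneg _) (hσ1 i)).trans h1.le
    have h3 := (abs_le.1 h2).1
    have h4 := abs_sub_abs_le_abs_sub (v y) (v (x i))
    rw [mul_sub, hσv] at h3
    linarith
  have htot : ∫ y, |v y| = ∫ y in -R..R, |v y| := by
    rw [intervalIntegral.integral_of_le (by linarith)]
    refine (setIntegral_eq_integral_of_forall_compl_eq_zero fun y hy => ?_).symm
    rw [hv0 y fun hc => hy (Ioo_subset_Ioc_self hc), abs_zero]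
  calc ∫ y, |v y| = ∑ i ∈ Finset.range N, ∫ y in x i..x (i + 1), |v y| := by
        rw [htot, intervalIntegral.sum_integral_adjacent_intervals fun i _ => (hvi _ _).abs, hx0,
          hxN]
    _ ≤ ∑ i ∈ Finset.range N,
          (σ i * (∫ y in x i..x (i + 1), v y) + (x (i + 1) - x i) * (2 * ε')) :=
        Finset.sum_le_sum fun i _ => hpiece i
    _ = signedVariation N σ (fun x => ∫ y in -R..x, v y) x + 2 * R * (2 * ε') := by
        rw [Finset.sum_add_distrib, ← Finset.sum_mul, Finset.sum_range_sub, hx0, hxN]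
        congr 1
        · refine Finset.sum_congr rfl fun i _ => ?_
          rw [intervalIntegral.integral_interval_sub_left (hvi _ _) (hvi _ _)]
        · ring
    _ ≤ _ := by
        have : 2 * R * (2 * ε') ≤ ε := by
          rw [hε', ← mul_assoc, mul_div_assoc', div_le_iff₀ (by positivity)]
          nlinarith
        linarith

end SignedVariation


/-! ### Conservation of mass in one space dimension -/

section OneDimensional

/-- The isometry between the real line and the one-dimensional Euclidean space. -/
noncomputable def lineEquiv : ℝ ≃ₗᵢ[ℝ] EuclideanSpace ℝ (Fin 1) :=
  (OrthonormalBasis.singleton (Fin 1) ℝ).repr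

theorem integral_comp_lineEquiv (g : EuclideanSpace ℝ (Fin 1) → ℝ) :
    ∫ x, g (lineEquiv x) = ∫ y, g y :=
  lineEquiv.measurePreserving.integral_comp lineEquiv.toHomeomorph.measurableEmbedding g

namespace IsContinuousWeakSolution

variable {Ω S : Set (EuclideanSpace ℝ (Fin 1))} {K f u₀ : EuclideanSpace ℝ (Fin 1) → ℝ}
  {T : ℝ} {u : ℝ → EuclideanSpace ℝ (Fin 1) → ℝ}

/-- In one space dimension, the weak equation says that the primitive in space of the solution is
differentiable in time, its derivative being the flux. -/
theorem exists_hasDerivAt_primitive (hu : IsContinuousWeakSolution Ω S K f T u₀ u)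
    (hΩ : IsOpen Ω) (hΩb : Bornology.IsBounded Ω) (hS : MeasurableSet S) (hK : ContDiff ℝ 1 K)
    (hf : IntegrableOn f Ω) {s : ℝ} (hs : 0 ≤ s) {M : ℝ}
    (hM : ∀ t ∈ Ioo s T, ∀ x ∈ Ω, |u t x| ≤ M) :
    ∃ R : ℝ, 0 ≤ R ∧ (∀ x ∉ Ioo (-R) R, lineEquiv x ∉ Ω) ∧ ∃ (C : ℝ) (q : ℝ → ℝ → ℝ),
      (∀ t ∈ Ioo s T, ∀ x,
        HasDerivAt (fun τ => ∫ y in -R..x, Ω.indicator (u τ) (lineEquiv y)) (q t x) t) ∧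
      (∀ t ∈ Ioo s T, ∀ x, Ω.indicator (u t) (lineEquiv x) = 0 → q t x = 0) ∧
      ∀ t ∈ Ioo s T, ∀ x, |q t x| ≤ C := by
  have hsub : Ioo s T ⊆ Ioo 0 T := Ioo_subset_Ioo_left hs
  have hsub' : Ioo s T ⊆ Ioc 0 T := hsub.trans Ioo_subset_Ioc_self
  obtain ⟨B, hB⟩ := exists_norm_velocity_le hΩ.measurableSet hΩb hS hK hf M
  obtain ⟨R₀, hR₀⟩ := hΩb.exists_norm_le
  have hR : ∀ x ∉ Ioo (-(|R₀| + 1)) (|R₀| + 1), lineEquiv x ∉ Ω := by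
    intro x hx hc
    have h1 := hR₀ _ hc
    rw [LinearIsometryEquiv.norm_map, Real.norm_eq_abs] at h1
    exact hx (abs_lt.1 (by linarith [le_abs_self R₀]))
  set O : Set ℝ := lineEquiv ⁻¹' Ω with hO
  have hOo : IsOpen O := hΩ.preimage lineEquiv.continuous
  set w : ℝ → ℝ → ℝ := fun t x => Ω.indicator (u t) (lineEquiv x) with hw
  set a : ℝ → ℝ → ℝ := fun t x => lineEquiv.symm (velocity Ω S K f (u t) (lineEquiv x)) with ha
  have haB : ∀ t ∈ Ioo s T, ∀ x ∈ O, |a t x| ≤ B := by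
    intro t ht x hx
    rw [← Real.norm_eq_abs, ha]
    simp only [LinearIsometryEquiv.norm_map]
    exact hB _ (hu.integrableOn hΩ hΩb (hsub' ht)) (hM t ht) _ hx
  have hw0 : ∀ t, ∀ x ∉ O, w t x = 0 := fun t x hx =>
    indicator_of_notMem (show lineEquiv x ∉ Ω from hx) _
  have hqw : ∀ t ∈ Ioo s T, ∀ x, |(|w t x| * a t x)| ≤ |B| * |w t x| := by
    intro t ht x
    rw [abs_mul, abs_abs, mul_comm]
    by_cases hx : x ∈ O
    · exact mul_le_mul_of_nonneg_right ((haB t ht x hx).trans (le_abs_self B)) (abs_nonneg _)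
    · rw [hw0 t x hx]; simp
  have hwc : ContinuousOn (fun z : ℝ × ℝ => w z.1 z.2) (Ioo s T ×ˢ univ) :=
    (hu.continuousOn_indicator hΩ).comp (f := fun z : ℝ × ℝ => (z.1, lineEquiv z.2))
      (by fun_prop) fun z hz => ⟨hsub' hz.1, mem_univ _⟩
  have hqc : ContinuousOn (fun z : ℝ × ℝ => |w z.1 z.2| * a z.1 z.2) (Ioo s T ×ˢ univ) := by
    rintro ⟨t, x⟩ ⟨ht, -⟩
    by_cases hx : x ∈ O
    · have hac : ContinuousOn (fun z : ℝ × ℝ => a z.1 z.2) (Ioo s T ×ˢ O) :=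
        lineEquiv.symm.continuous.comp_continuousOn
          ((hu.continuousOn_velocity hΩ hΩb hS hK hf).comp
            (f := fun z : ℝ × ℝ => (z.1, lineEquiv z.2)) (by fun_prop)
            fun z hz => ⟨hsub' hz.1, hz.2⟩)
      refine (((hwc.mono (prod_mono_right (subset_univ O))).abs.mul hac) (t, x)
        ⟨ht, hx⟩).mono_of_mem_nhdsWithin ?_
      rw [nhdsWithin_prod_eq, nhdsWithin_univ]
      exact prod_mem_prod self_mem_nhdsWithin (hOo.mem_nhds hx)
    · have h1 := ((hwc (t, x) ⟨ht, mem_univ _⟩).abs).const_mul |B|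
      rw [ContinuousWithinAt] at h1 ⊢
      simp only [hw0 t x hx, abs_zero, mul_zero, zero_mul] at h1 ⊢
      refine squeeze_zero_norm' ?_ h1
      filter_upwards [self_mem_nhdsWithin] with z hz using hqw z.1 hz.1 z.2
  refine ⟨|R₀| + 1, by positivity, hR, |B| * |M|, fun t x => |w t x| * a t x, ?_, ?_, ?_⟩
  · refine hasDerivAt_primitive hOo (fun x hx => ?_) hwc (fun t _ => hw0 t) hqc
      (fun t _ x hx => by simp [hw0 t x hx]) fun φ h1 h2 h3 t ht => ?_
    · exact (by_contra fun hc => hR x hc hx : x ∈ Ioo (-(|R₀| + 1)) (|R₀| + 1)).1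
    · have hts : tsupport (φ ∘ lineEquiv.symm) ⊆ lineEquiv.symm ⁻¹' tsupport φ :=
        closure_minimal (fun y hy => subset_tsupport φ hy)
          ((isClosed_tsupport φ).preimage lineEquiv.symm.continuous)
      have hd := hu.hasDerivAt hΩ hΩb hS hK hf (φ := φ ∘ lineEquiv.symm)
        (h1.comp lineEquiv.symm.contDiff)
        ((lineEquiv.symm.toHomeomorph.isCompact_preimage.2 h2.isCompact).of_isClosed_subset
          (isClosed_tsupport _) hts)
        (fun y hy => by simpa [hO] using h3 (hts hy)) t (hsub ht)
      simp only [← integral_comp_lineEquiv, Function.comp_apply,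
        LinearIsometryEquiv.symm_apply_apply] at hd
      convert! hd using 3
      ext x
      have hfd : fderiv ℝ (φ ∘ lineEquiv.symm) (lineEquiv x)
          (velocity Ω S K f (u t) (lineEquiv x)) = a t x * deriv φ x := by
        have := lineEquiv.symm.toContinuousLinearEquiv.comp_right_fderiv (f := φ)
          (x := lineEquiv x)
        have h4 := DFunLike.congr_fun this (velocity Ω S K f (u t) (lineEquiv x))
        refine h4.trans ?_
        simp [ha]
      simp only [hfd, hw]
      ring
  · intro t ht x hx
    have : w t x = 0 := hx
    simp [this]
  · intro t ht x
    refine (hqw t ht x).trans (mul_le_mul_of_nonneg_left ?_ (abs_nonneg _))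
    by_cases hx : x ∈ O
    · simp only [hw]
      rw [indicator_of_mem (show lineEquiv x ∈ Ω from hx)]
      exact (hM t ht _ hx).trans (le_abs_self M)
    · rw [hw0 t x hx, abs_zero]; exact abs_nonneg M

theorem integral_abs_indicator_lineEquiv {v : EuclideanSpace ℝ (Fin 1) → ℝ}
    (hΩ : MeasurableSet Ω) :
    ∫ x, |Ω.indicator v (lineEquiv x)| = ∫ y in Ω, |v y| :=
  (integral_comp_lineEquiv fun y => |Ω.indicator v y|).trans (integral_abs_indicator hΩ)

theorem continuous_indicator_lineEquiv (hu : IsContinuousWeakSolution Ω S K f T u₀ u)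
    (hΩ : IsOpen Ω) {t : ℝ} (ht : t ∈ Ioo 0 T) :
    Continuous fun x => Ω.indicator (u t) (lineEquiv x) :=
  (hu.continuous_indicator hΩ (Ioo_subset_Ioc_self ht)).comp lineEquiv.continuous

/-- Almost all of the mass at time `t` is seen by a signed variation, whose maximum is the same at
time `s`. -/
theorem setIntegral_abs_le_of_dim_one (hu : IsContinuousWeakSolution Ω S K f T u₀ u)
    (hΩ : IsOpen Ω) (hΩb : Bornology.IsBounded Ω) (hS : MeasurableSet S) (hK : ContDiff ℝ 1 K)
    (hf : IntegrableOn f Ω) {s t : ℝ} (hs : s ∈ Ioo 0 T)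
    (ht : t ∈ Ioo 0 T) : ∫ x in Ω, |u t x| ≤ ∫ x in Ω, |u s x| := by
  have hr : 0 < min s t / 2 := half_pos (lt_min hs.1 ht.1)
  obtain ⟨M, hM⟩ := hu.exists_abs_le hΩb hr
  obtain ⟨R, hR, hRΩ, C, q, hd, hq0, hqC⟩ := hu.exists_hasDerivAt_primitive hΩ hΩb hS hK hf hr.le
    fun t ht => hM t ⟨ht.1.le, ht.2.le⟩
  have hsub : Ioo (min s t / 2) T ⊆ Ioo 0 T := Ioo_subset_Ioo_left hr.le
  have hw : ∀ t, ∀ x ∉ Ioo (-R) R, Ω.indicator (u t) (lineEquiv x) = 0 := fun t x hx =>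
    indicator_of_notMem (hRΩ x hx) _
  rw [← integral_abs_indicator_lineEquiv hΩ.measurableSet,
    ← integral_abs_indicator_lineEquiv hΩ.measurableSet]
  refine le_of_forall_pos_le_add fun ε hε => ?_
  obtain ⟨N, σ, hσ, x, hx, hle⟩ := exists_integral_abs_le_signedVariation hR hε
    (hu.continuous_indicator_lineEquiv hΩ ht) (hw t)
  obtain ⟨y, hy, hle'⟩ := exists_signedVariation_le hσ
    (U := fun t x => ∫ y in -R..x, Ω.indicator (u t) (lineEquiv y))
    (w := fun t x => Ω.indicator (u t) (lineEquiv x)) (fun t ht x =>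
      have hc := hu.continuous_indicator_lineEquiv hΩ (hsub ht)
      intervalIntegral.integral_hasDerivAt_right (hc.intervalIntegrable _ _)
        (hc.stronglyMeasurableAtFilter _ _) hc.continuousAt)
    hd (fun t _ => hw t) hq0 hqC (s := s) (t := t)
    ⟨by linarith [min_le_left s t, hr], hs.2⟩ ⟨by linarith [min_le_right s t, hr], ht.2⟩ hx
  have hi : Integrable fun x => Ω.indicator (u s) (lineEquiv x) :=
    integrable_of_continuousOn_of_eq_zero isCompact_Icc
      (hu.continuous_indicator_lineEquiv hΩ hs).continuousOn
      fun x hx => hw s x fun hc => hx (Ioo_subset_Icc_self hc)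
  linarith [signedVariation_primitive_le hσ hi hy]

/-- As `s → 0` the primitives of `u s` converge uniformly to that of `u₀`, at the rate of the
bound for the flux; hence so do the maximal signed variations. -/
theorem le_setIntegral_abs_initial_of_dim_one (hu : IsContinuousWeakSolution Ω S K f T u₀ u)
    (hΩ : IsOpen Ω) (hΩb : Bornology.IsBounded Ω) (hS : MeasurableSet S) (hK : ContDiff ℝ 1 K)
    (hf : IntegrableOn f Ω) (hu₀ : ContinuousOn u₀ Ω) {M : ℝ}
    (hM : ∀ t ∈ Ioo 0 T, ∀ x ∈ Ω, |u t x| ≤ M) (hM₀ : ∀ x ∈ Ω, |u₀ x| ≤ M) {t : ℝ}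
    (ht : t ∈ Ioo 0 T) : ∫ x in Ω, |u t x| ≤ ∫ x in Ω, |u₀ x| := by
  have hfin : Fact (volume Ω < ⊤) := ⟨hΩb.measure_lt_top⟩
  have hu₀m := hu₀.aestronglyMeasurable (μ := volume) hΩ.measurableSet
  obtain ⟨R, hR, hRΩ, C, q, hd, hq0, hqC⟩ :=
    hu.exists_hasDerivAt_primitive hΩ hΩb hS hK hf le_rfl hM
  have hw : ∀ t, ∀ x ∉ Ioo (-R) R, Ω.indicator (u t) (lineEquiv x) = 0 := fun t x hx =>
    indicator_of_notMem (hRΩ x hx) _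
  have hset : ∀ (v : EuclideanSpace ℝ (Fin 1) → ℝ) (p r : ℝ),
      ∫ y in Ioc p r, Ω.indicator v (lineEquiv y)
        = ∫ y in Ω, (Ioc p r).indicator (fun _ => (1 : ℝ)) (lineEquiv.symm y) * v y := by
    intro v p r
    rw [← integral_indicator measurableSet_Ioc, ← integral_indicator hΩ.measurableSet,
      ← integral_comp_lineEquiv]
    refine integral_congr_ae (Eventually.of_forall fun x => ?_)
    by_cases h1 : lineEquiv x ∈ Ω <;> by_cases h2 : x ∈ Ioc p r <;> simp [h1, h2]
  have hlim : ∀ p r : ℝ, Tendsto (fun s => ∫ y in Ioc p r, Ω.indicator (u s) (lineEquiv y))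
      (𝓝[>] 0) (𝓝 (∫ y in Ioc p r, Ω.indicator u₀ (lineEquiv y))) := by
    intro p r
    simp only [hset]
    refine tendsto_setIntegral_mul_of_bounded hΩ hΩb (M := M) ?_ hu₀m hM₀
      (fun φ h1 h2 h3 => hu.tendsto_initial h1 h2 h3) ?_
    · filter_upwards [Ioo_mem_nhdsGT (ht.1.trans ht.2)] with s hs
      exact ⟨(hu.integrableOn hΩ hΩb (Ioo_subset_Ioc_self hs)).aestronglyMeasurable, hM s hs⟩
    · refine Integrable.of_bound (((measurable_const.indicator measurableSet_Ioc).comp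
        lineEquiv.symm.continuous.measurable).aestronglyMeasurable) 1
        (Eventually.of_forall fun y => ?_)
      exact (norm_indicator_le_norm_self _ _).trans (by simp)
  have hclose : ∀ s ∈ Ioo 0 T, ∀ x, |(∫ y in -R..x, Ω.indicator (u s) (lineEquiv y))
      - ∫ y in -R..x, Ω.indicator u₀ (lineEquiv y)| ≤ C * s := by
    intro s hs x
    have h1 : Tendsto (fun r => |(∫ y in -R..x, Ω.indicator (u s) (lineEquiv y))
        - ∫ y in -R..x, Ω.indicator (u r) (lineEquiv y)|) (𝓝[>] 0)
        (𝓝 |(∫ y in -R..x, Ω.indicator (u s) (lineEquiv y))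
          - ∫ y in -R..x, Ω.indicator u₀ (lineEquiv y)|) :=
      (tendsto_const_nhds.sub ((hlim (-R) x).sub (hlim x (-R)))).abs
    refine le_of_tendsto h1 ?_
    filter_upwards [Ioo_mem_nhdsGT hs.1] with r hr
    have h2 := (convex_Ioo 0 T).norm_image_sub_le_of_norm_hasDerivWithin_le
      (fun τ hτ => (hd τ hτ x).hasDerivWithinAt) (fun τ hτ => hqC τ hτ x)
      (show r ∈ Ioo 0 T from ⟨hr.1, hr.2.trans hs.2⟩) hs
    refine h2.trans ?_
    have hC : 0 ≤ C := (abs_nonneg _).trans (hqC s hs x)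
    rw [Real.norm_eq_abs, abs_of_nonneg (by linarith [hr.2])]
    exact mul_le_mul_of_nonneg_left (by linarith [hr.1]) hC
  have hi₀ : Integrable fun x => Ω.indicator u₀ (lineEquiv x) := by
    have h1 : Integrable (Ω.indicator u₀) := by
      rw [integrable_indicator_iff hΩ.measurableSet]
      refine Integrable.of_bound hu₀m M ?_
      filter_upwards [ae_restrict_mem hΩ.measurableSet] with x hx using hM₀ x hx
    exact (lineEquiv.measurePreserving.integrable_comp_emb
      lineEquiv.toHomeomorph.measurableEmbedding).2 h1
  rw [← integral_abs_indicator_lineEquiv hΩ.measurableSet,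
    ← integral_abs_indicator_lineEquiv hΩ.measurableSet]
  refine le_of_forall_pos_le_add fun ε hε => ?_
  obtain ⟨N, σ, hσ, x, hx, hle⟩ := exists_integral_abs_le_signedVariation hR hε
    (hu.continuous_indicator_lineEquiv hΩ ht) (hw t)
  have hlim0 : Tendsto (fun s : ℝ => (∫ x, |Ω.indicator u₀ (lineEquiv x)|)
      + N * (2 * (C * s)) + ε) (𝓝[>] 0)
      (𝓝 ((∫ x, |Ω.indicator u₀ (lineEquiv x)|) + N * (2 * (C * 0)) + ε)) :=
    (Continuous.tendsto (by fun_prop) 0).mono_left nhdsWithin_le_nhds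
  rw [mul_zero, mul_zero, mul_zero, add_zero] at hlim0
  refine ge_of_tendsto hlim0 ?_
  filter_upwards [Ioo_mem_nhdsGT (ht.1.trans ht.2)] with s hs
  obtain ⟨y, hy, hle'⟩ := exists_signedVariation_le hσ
    (U := fun t x => ∫ y in -R..x, Ω.indicator (u t) (lineEquiv y))
    (w := fun t x => Ω.indicator (u t) (lineEquiv x)) (fun t ht x =>
      have hc := hu.continuous_indicator_lineEquiv hΩ ht
      intervalIntegral.integral_hasDerivAt_right (hc.intervalIntegrable _ _)
        (hc.stronglyMeasurableAtFilter _ _) hc.continuousAt)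
    hd (fun t _ => hw t) hq0 hqC hs ht hx
  have h1 := (abs_le.1 (abs_signedVariation_sub_le (N := N) hσ (hclose s hs) y)).2
  linarith [signedVariation_primitive_le hσ hi₀ hy]

end IsContinuousWeakSolution

end OneDimensional

end MotionPDE

/-! ### Conservation of the `L¹` norm -/

theorem mainTheorem2 (n : ℕ) (Ω S : Set (EuclideanSpace ℝ (Fin n)))
    (hΩ_open : IsOpen Ω) (hΩ_bdd : Bornology.IsBounded Ω) (hS : MeasurableSet S)
    (K : EuclideanSpace ℝ (Fin n) → ℝ) (hK : ContDiff ℝ 1 K)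
    (hK' : 2 ≤ n → LocallyLipschitz (fderiv ℝ K))
    (f : EuclideanSpace ℝ (Fin n) → ℝ) (hf : MemLp f 2 (volume.restrict Ω))
    (T : ℝ) (hT : 0 < T)
    (u₀ : EuclideanSpace ℝ (Fin n) → ℝ) (hu₀ : ContinuousOn u₀ Ω)
    (u : ℝ → EuclideanSpace ℝ (Fin n) → ℝ)
    (hu : MotionPDE.IsContinuousWeakSolution Ω S K f T u₀ u) :
    (∀ t ∈ Ioc 0 T, IntegrableOn (u t) Ω) ∧
    (∀ s ∈ Ioc 0 T, ∀ t ∈ Ioc 0 T, ∫ x in Ω, |u s x| = ∫ x in Ω, |u t x|) ∧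
    ((∃ M : ℝ, ∀ t ∈ Ioc 0 T, ∀ x ∈ Ω, |u t x| ≤ M) →
      IntegrableOn u₀ Ω ∧ ∀ t ∈ Ioc 0 T, ∫ x in Ω, |u t x| = ∫ x in Ω, |u₀ x|) := by
  have hfin : Fact (volume Ω < ⊤) := ⟨hΩ_bdd.measure_lt_top⟩
  have hf1 : IntegrableOn f Ω := hf.integrable one_le_two
  -- for `n = 0` the Lipschitz condition is void
  have hdim : n = 1 ∨ LocallyLipschitz (fderiv ℝ K) := by
    rcases Nat.lt_or_ge n 2 with h | h
    · interval_cases n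
      · exact Or.inr fun x => ⟨0, univ, univ_mem, fun y _ z _ => by simp [Subsingleton.elim y z]⟩
      · exact Or.inl rfl
    · exact Or.inr (hK' h)
  have hIoo : ∀ s ∈ Ioo 0 T, ∀ t ∈ Ioo 0 T, ∫ x in Ω, |u s x| = ∫ x in Ω, |u t x| := by
    intro s hs t ht
    rcases hdim with rfl | hL
    · exact le_antisymm (hu.setIntegral_abs_le_of_dim_one hΩ_open hΩ_bdd hS hK hf1 ht hs)
        (hu.setIntegral_abs_le_of_dim_one hΩ_open hΩ_bdd hS hK hf1 hs ht)
    · exact hu.setIntegral_abs_eq_of_locallyLipschitz hΩ_open hΩ_bdd hS hK hL hf1 hs ht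
  -- the final time is reached by continuity
  obtain ⟨m, hm⟩ : ∃ m, ∀ t ∈ Ioc 0 T, ∫ x in Ω, |u t x| = m := by
    have hT2 : T / 2 ∈ Ioo 0 T := ⟨half_pos hT, half_lt_self hT⟩
    have hc := hu.continuousOn_setIntegral_abs hΩ_open hΩ_bdd
    refine ⟨∫ x in Ω, |u (T / 2) x|, fun t ht => ?_⟩
    rcases ht.2.lt_or_eq with h | rfl
    · exact hIoo t ⟨ht.1, h⟩ _ hT2
    · have h1 : Tendsto (fun s => ∫ x in Ω, |u s x|) (𝓝[<] t) (𝓝 (∫ x in Ω, |u t x|)) :=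
        (hc t ht).mono_left (nhdsWithin_le_of_mem (Ioc_mem_nhdsLT ht.1))
      refine tendsto_nhds_unique h1 (tendsto_const_nhds.congr' ?_)
      filter_upwards [Ioo_mem_nhdsLT ht.1] with s hs using hIoo _ hT2 s hs
  refine ⟨fun t ht => hu.integrableOn hΩ_open hΩ_bdd ht,
    fun s hs t ht => (hm s hs).trans (hm t ht).symm, ?_⟩
  rintro ⟨M, hM⟩
  have hM' : ∀ t ∈ Ioo 0 T, ∀ x ∈ Ω, |u t x| ≤ M := fun t ht => hM t (Ioo_subset_Ioc_self ht)
  have hnear : ∀ᶠ t in 𝓝[>] (0 : ℝ), t ∈ Ioc 0 T := Ioc_mem_nhdsGT hT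
  have hM₀ : ∀ x ∈ Ω, |u₀ x| ≤ M := MotionPDE.abs_le_of_tendsto_weak hΩ_open
    (hnear.mono fun t ht => hM t ht) hu₀ fun φ h1 h2 h3 => hu.tendsto_initial h1 h2 h3
  have hu₀m := hu₀.aestronglyMeasurable (μ := volume) hΩ_open.measurableSet
  refine ⟨Integrable.of_bound hu₀m M ?_, fun t ht => ?_⟩
  · filter_upwards [ae_restrict_mem hΩ_open.measurableSet] with x hx using hM₀ x hx
  rw [hm t ht]
  refine le_antisymm ?_ ?_
  · rcases hdim with rfl | hL
    · rw [← hm (T / 2) ⟨half_pos hT, (half_lt_self hT).le⟩]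
      exact hu.le_setIntegral_abs_initial_of_dim_one hΩ_open hΩ_bdd hS hK hf1 hu₀ hM' hM₀
        ⟨half_pos hT, half_lt_self hT⟩
    · exact hu.le_setIntegral_abs_initial_of_locallyLipschitz hΩ_open hΩ_bdd hS hK hL hf1 hT hu₀
        hM' hM₀ fun t ht => (hm t (Ioo_subset_Ioc_self ht)).ge
  · exact MotionPDE.setIntegral_abs_le_of_tendsto hΩ_open hΩ_bdd
      (hnear.mono fun t ht =>
        ⟨(hu.integrableOn hΩ_open hΩ_bdd ht).aestronglyMeasurable, hM t ht⟩) hu₀m hM₀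
      (fun φ h1 h2 h3 => hu.tendsto_initial h1 h2 h3)
      (hnear.mono fun t ht => (hm t ht).le)
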